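/- **Setting.** Let $f:\mathbb R^n\to\mathbb R$ and $c:\mathbb R^n\to\mathbb R^q$ be continuously differentiable, with $f\ge f^{low}$, and let $\nabla f$ and the Jacobian $J$ of $c$ be Lipschitz with constants $L_g,L_J>0$ (Euclidean and operator norm). A stochastic first-order oracle (SFO) call at $x$ returns $G(x,\zeta)$, with a fresh random seed $\zeta$ whose law does not depend on $x$, such that $\mathbb E[G(x,\zeta)]=\nabla f(x)$ and $\mathbb E\|G(x,\zeta)-\nabla f(x)\|^2\le\sigma^2$ for every $x$, where $\sigma>0$. Put $\Phi_\rho=f+\rho\|c\|$, $L_\rho=L_g+\rho L_J$, and let $\Phi_\rho^{low}\ge f^{low}$ be a lower bound of $\Phi_\rho$ for each $\rho>0$. Put $$\theta(x)=\|c(x)\|-\min_{\|s\|\le1}\|c(x)+J(x)s\|,\qquad \phi_\rho(x,g)=\rho\|c(x)\|-\min_{\|s\|\le1}\{\langle g,s\rangle+\rho\|c(x)+J(x)s\|\}.$$ A random point $X$ is an *$\epsilon$-stochastic critical point* of $\min\{f(x):c(x)=0\}$ if there is a random vector $\lambda$ in $\mathbb R^q$ with $\mathbb E\|\nabla f(X)+J(X)^T\lambda\|^2\le\epsilon$,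 and $\mathbb E[\theta(X)]\le\sqrt\epsilon$. **Penalty method.** The input is $\epsilon\in(0,1)$, $\xi\in(0,1)$, $\rho_0\ge1$, $\tau>0$, $\tilde D>0$, $N\ge2$, and $x_1,G_1\in\mathbb R^n$. For $k=1,\dots,N-1$: (a) Choose $\rho_k\ge\rho_{k-1}+\tau$ with $\phi_{\rho_k}(x_k,G_k)\ge\rho_k\,\xi\,\theta(x_k)$. (b) Write $\rho=\rho_k$ and $D=\Phi_\rho(x_k)-\Phi^{low}_\rho$. Choose an integer SFO budget $$\bar N_k\ge B_k:=\max\Big\{\frac{(4DC_2+4L_\rho C_3)^2}{\epsilon^2}+\frac{128L_\rho D}{\epsilon},\ \frac{C_1}{L_\rho^2}\Big\},\qquad C_1=\frac{\sigma^2}{\tilde D},\quad C_2=\frac{8\sigma}{\sqrt{\tilde D}},\quad C_3=6\sigma\sqrt{\tilde D},$$ and the batch size $m=\lceil\min\{\bar N_k,\max\{1,\frac{\sigma}{L_\rho}\sqrt{\bar N_k/\tilde D}\}\}\rceil$. Let $R_k$ be uniformly distributed on $\{1,\dots,\lceil\bar N_k/m\rceil\}$ and independent, given the past, of the oracle noise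 of this iteration. Set $y_1=x_k$. For $i=1,2,\dots$ let $g_i$ be the average of $m$ SFO calls at $y_i$ and $$y_{i+1}=\arg\min_u\ \langle g_i,u-y_i\rangle+\rho\|c(y_i)+J(y_i)(u-y_i)\|+\tfrac{L_\rho}{2}\|u-y_i\|^2.$$ Set $x_{k+1}=y_{R_k}$ and $G_{k+1}=g_{R_k}$. This costs $mR_k$ SFO calls. The choices of $\rho_k$ and $\bar N_k$ depend only on the past. Assume that the outer iterates are bounded in the sense that there are positive constants, not depending on $\epsilon$, with $f(x_k)\le\kappa_f$, $\|c(x_k)\|\le\kappa_c$, $\|\nabla f(x_k)\|\le\kappa_g$ and $\|J(x_k)\|\le\kappa_J$ almost surely for all $1\le k\le N$. Put $$\bar C=\frac{\kappa_J}{L_J}+\frac{(\kappa_g^2+0.25\epsilon)^{1/2}}{L_g},\qquad \tilde C=\max\Big\{\frac{(4\bar C+(8\bar C)^{1/2}(L_g+L_J)^{1/2})^2}{\xi^{2}},\ \frac{(4\kappa_g^2+\epsilon)^{1/2}}{1-\xi}\Big\},$$ $$\bar\rho=\tilde C\epsilon^{-1/2},\qquad \hat N=\lceil\tau^{-1}\tilde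 C\epsilon^{-1/2}-\tau^{-1}\rho_0+1\rceil .$$ **Theorem.** 1. The output $x_N$ satisfies $$\mathbb E[\theta(x_N)]\le\frac{2\bar C+(2\bar C)^{1/2}(L_g+L_J)^{1/2}}{\xi(\rho_0+(N-1)\tau)^{1/2}}\,\epsilon^{1/4}+\frac{(\kappa_g^2+0.25\epsilon)^{1/2}}{(1-\xi)(\rho_0+(N-1)\tau)},$$ and $\mathbb E\|\nabla f(x_N)+J(x_N)^T\lambda_N\|^2\le\epsilon$ for some random vector $\lambda_N$. Consequently, if $N\ge\hat N$, then $x_N$ is an $\epsilon$-stochastic critical point. 2. Let $N\ge\max\{2,\hat N\}$ and let $K\ge1$ be the first (random) outer iteration with $\rho_K\ge\bar\rho$. Then $K+1\le N$ and $K+1\le\max\{2,\hat N\}$, and $x_{K+1}$, the output of the method when it is stopped after iteration $K$, is an $\epsilon$-stochastic critical point. Moreover, for every $\Lambda\ge1$ there is a constant $C$ not depending on $\epsilon$, $N$ or the run such that, whenever $\bar N_k\le\Lambda\lceil B_k\rceil$ for all $k$, almost surely: - the iterations $k<K$, that is, those before the penalty parameter reaches $\bar\rho$, use at most $C\epsilon^{-3.5}$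 SFO calls in total; - if in addition $\rho_k\le\Lambda\rho$ for all $k$ and every value $\rho\ge\rho_{k-1}+\tau$ that is admissible in Step (a) (for instance, if the smallest admissible value is chosen, $\Lambda=1$), then all iterations $1,\dots,K$ together, after which the $\epsilon$-stochastic critical point $x_{K+1}$ is available, use at most $C\epsilon^{-3.5}$ SFO calls. -/

import Mathlib

open MeasureTheory ProbabilityTheory

namespace PenaltySFO

/-- The Euclidean space of dimension `n`. -/
abbrev Euc (n : ℕ) := EuclideanSpace ℝ (Fin n)

/-! ### Deterministic notions -/

/-- The infeasibility measure `θ(x) = ‖c(x)‖ - min_{‖s‖ ≤ 1} ‖c(x) + J(x) s‖`;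
the Jacobian `J(x)` is the Fréchet derivative of `c` at `x`. -/
noncomputable def theta {n q : ℕ} (c : Euc n → Euc q) (x : Euc n) : ℝ :=
  ‖c x‖ - sInf ((fun s : Euc n => ‖c x + fderiv ℝ c x s‖) '' Metric.closedBall 0 1)

/-- `φ_ρ(x) = ρ‖c(x)‖ - min_{‖s‖ ≤ 1} (⟨g, s⟩ + ρ‖c(x) + J(x) s‖)`, where `g` is the current
stochastic gradient. -/
noncomputable def phi {n q : ℕ} (c : Euc n → Euc q) (ρ : ℝ) (x g : Euc n) : ℝ :=
  ρ * ‖c x‖ -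
    sInf ((fun s : Euc n => inner ℝ g s + ρ * ‖c x + fderiv ℝ c x s‖) '' Metric.closedBall 0 1)

/-- The penalty function `Φ_ρ(x) = f(x) + ρ‖c(x)‖`. -/
noncomputable def penalty {n q : ℕ} (f : Euc n → ℝ) (c : Euc n → Euc q) (ρ : ℝ) (x : Euc n) : ℝ :=
  f x + ρ * ‖c x‖

/-- The model `ψ_γ(x, g, u) = ⟨g, u - x⟩ + h(c(x) + J(x)(u - x)) + ‖u - x‖² / (2γ)` whose minimizer
in `u` is the next iterate of the stochastic approximation algorithm. -/
noncomputable def psi {n q : ℕ} (h : Euc q → ℝ) (c : Euc n → Euc q) (γ : ℝ) (x g u : Euc n) : ℝ :=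
  inner ℝ g (u - x) + h (c x + fderiv ℝ c x (u - x)) + 1 / (2 * γ) * ‖u - x‖ ^ 2

/-! ### The problem, its oracle and the standing assumptions -/

/-- Minimize `f` subject to `c = 0`. A call of the stochastic first-order oracle at `x` returns
`G x ζ` with a random seed `ζ` of law `law`. -/
structure Problem (n q : ℕ) (Ξ : Type*) [MeasurableSpace Ξ] where
  f : Euc n → ℝ
  c : Euc n → Euc q
  G : Euc n → Ξ → Euc n
  law : Measure Ξ
  /-- lower bound of `f` -/
  flow : ℝ
  /-- Lipschitz constant of `∇f` -/
  Lg : ℝ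
  /-- Lipschitz constant of the Jacobian (for the operator norm) -/
  LJ : ℝ
  /-- noise level of the oracle -/
  σ : ℝ

/-- Smoothness of `f` and `c`, and an unbiased oracle with variance at most `σ²`. -/
structure Problem.Assumptions {n q : ℕ} {Ξ : Type*} [MeasurableSpace Ξ]
    (p : Problem n q Ξ) : Prop where
  f_contDiff : ContDiff ℝ 1 p.f
  c_contDiff : ContDiff ℝ 1 p.c
  flow_le : ∀ x, p.flow ≤ p.f x
  Lg_pos : 0 < p.Lg
  LJ_pos : 0 < p.LJ
  grad_lipschitz : ∀ x y, ‖gradient p.f x - gradient p.f y‖ ≤ p.Lg * ‖x - y‖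
  jac_lipschitz : ∀ x y, ‖fderiv ℝ p.c x - fderiv ℝ p.c y‖ ≤ p.LJ * ‖x - y‖
  σ_pos : 0 < p.σ
  law_prob : IsProbabilityMeasure p.law
  G_measurable : Measurable (Function.uncurry p.G)
  G_integrable : ∀ x, Integrable (p.G x) p.law
  G_unbiased : ∀ x, ∫ ζ, p.G x ζ ∂p.law = gradient p.f x
  G_sq_integrable : ∀ x, Integrable (fun ζ => ‖p.G x ζ - gradient p.f x‖ ^ 2) p.law
  G_variance : ∀ x, ∫ ζ, ‖p.G x ζ - gradient p.f x‖ ^ 2 ∂p.law ≤ p.σ ^ 2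

/-- The input of the penalty method, apart from the tolerance and the iteration number. -/
structure Settings (n : ℕ) where
  /-- initial iterate -/
  x₁ : Euc n
  /-- initial stochastic gradient -/
  G₁ : Euc n
  /-- initial penalty parameter -/
  ρ₀ : ℝ
  /-- minimal increase of the penalty parameter -/
  τ : ℝ
  /-- steering parameter -/
  ξ : ℝ
  /-- the constant that balances the batch sizes -/
  Dt : ℝ
  /-- `Φlow ρ` is a lower bound of the penalty function `Φ_ρ` -/
  Φlow : ℝ → ℝ

structure Settings.Valid {n q : ℕ} {Ξ : Type*} [MeasurableSpace Ξ]
    (s : Settings n) (p : Problem n q Ξ) : Prop where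
  ρ₀_ge : 1 ≤ s.ρ₀
  τ_pos : 0 < s.τ
  ξ_pos : 0 < s.ξ
  ξ_lt : s.ξ < 1
  Dt_pos : 0 < s.Dt
  flow_le : ∀ ρ, 0 < ρ → p.flow ≤ s.Φlow ρ
  Φlow_le : ∀ ρ, 0 < ρ → ∀ x, s.Φlow ρ ≤ penalty p.f p.c ρ x

/-- Bounds for `f`, `‖c‖`, `‖∇f‖` and `‖J‖` along the iterates. -/
structure Bounds where
  κf : ℝ
  κc : ℝ
  κg : ℝ
  κJ : ℝ

structure Bounds.Valid (b : Bounds) : Prop where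
  κf_pos : 0 < b.κf
  κc_pos : 0 < b.κc
  κg_pos : 0 < b.κg
  κJ_pos : 0 < b.κJ

section Constants

variable {n q : ℕ} {Ξ : Type*} [MeasurableSpace Ξ] (p : Problem n q Ξ) (s : Settings n) (b : Bounds)

/-- `L_ρ = L_g + ρ L_J`. The stepsize of the subproblem solver is `1 / L_ρ`. -/
noncomputable def Lrho (ρ : ℝ) : ℝ := p.Lg + ρ * p.LJ

/-- `C₁ = σ² / D̃`. -/
noncomputable def C1 : ℝ := p.σ ^ 2 / s.Dt

/-- `C₂ = 8σ / √D̃`. -/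
noncomputable def C2 : ℝ := 8 * p.σ / √s.Dt

/-- `C₃ = 6σ√D̃`. -/
noncomputable def C3 : ℝ := 6 * p.σ * √s.Dt

/-- `D_{Φ_ρ} = Φ_ρ(x) - Φ_ρ^low`, with `x` the starting point of the subproblem. -/
noncomputable def gap (ρ : ℝ) (x : Euc n) : ℝ := penalty p.f p.c ρ x - s.Φlow ρ

/-- The lower bound for the budget of oracle calls of one subproblem. -/
noncomputable def budgetBound (ε ρ : ℝ) (x : Euc n) : ℝ :=
  max ((4 * gap p s ρ x * C2 p s + 4 * Lrho p ρ * C3 p s) ^ 2 / ε ^ 2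
      + 128 * Lrho p ρ * gap p s ρ x / ε)
    (C1 p s / Lrho p ρ ^ 2)

/-- The batch size `⌈min {N̄, max {1, (σ / L_ρ) √(N̄ / D̃)}}⌉` for the budget `N̄`. -/
noncomputable def batchSize (ρ : ℝ) (Nbar : ℕ) : ℕ :=
  ⌈min (Nbar : ℝ) (max 1 (p.σ / Lrho p ρ * √((Nbar : ℝ) / s.Dt)))⌉₊

/-- The iteration limit `⌈N̄ / m⌉` of the subproblem solver. -/
noncomputable def innerLimit (ρ : ℝ) (Nbar : ℕ) : ℕ :=
  ⌈(Nbar : ℝ) / (batchSize p s ρ Nbar : ℝ)⌉₊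

/-- `C̄ = κ_J / L_J + (κ_g² + ε/4)^{1/2} / L_g`. -/
noncomputable def Cbar (ε : ℝ) : ℝ := b.κJ / p.LJ + √(b.κg ^ 2 + 0.25 * ε) / p.Lg

/-- `C̃ = max {(4C̄ + (8C̄)^{1/2}(L_g + L_J)^{1/2})² ξ⁻², (4κ_g² + ε)^{1/2} (1 - ξ)⁻¹}`. -/
noncomputable def Ctilde (ε : ℝ) : ℝ :=
  max ((4 * Cbar p b ε + √(8 * Cbar p b ε) * √(p.Lg + p.LJ)) ^ 2 / s.ξ ^ 2)
    (√(4 * b.κg ^ 2 + ε) / (1 - s.ξ))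

/-- `ρ̄ = C̃ ε^{-1/2}`. -/
noncomputable def rhoBar (ε : ℝ) : ℝ := Ctilde p s b ε / √ε

/-- `N̂ = ⌈τ⁻¹ C̃ ε^{-1/2} - τ⁻¹ ρ₀ + 1⌉`. -/
noncomputable def Nhat (ε : ℝ) : ℤ := ⌈rhoBar p s b ε / s.τ - s.ρ₀ / s.τ + 1⌉

end Constants

/-! ### The penalty method as a random process -/

/-- A run of the penalty method with tolerance `ε` and maximum iteration number `N` (outer
iterations `k = 1, …, N - 1`), in which every subproblem is solved by the stochastic approximation
algorithm. In the `k`-th outer iteration the inner iterates are `y k 1, y k 2, …`, and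
`sample k i j` is the seed of the `j`-th oracle call at `y k i`. The random index `R k` selects the
inner iterate that is returned. The inner sequence is written down for all `i`; the algorithm itself
computes it only up to `i = R k`.

The information available before the oracle is called at `y k i` is `hist k i`. -/
structure Run {n q : ℕ} {Ξ : Type*} [MeasurableSpace Ξ] (p : Problem n q Ξ) (s : Settings n)
    (ε : ℝ) (N : ℕ) {Ω : Type*} [mΩ : MeasurableSpace Ω] (P : Measure Ω) where
  /-- outer iterates -/
  x : ℕ → Ω → Euc n
  /-- stochastic gradients at the outer iterates -/
  g : ℕ → Ω → Euc n
  /-- penalty parameters -/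
  ρ : ℕ → Ω → ℝ
  /-- budgets of oracle calls of the subproblems -/
  budget : ℕ → Ω → ℕ
  R : ℕ → Ω → ℕ
  y : ℕ → ℕ → Ω → Euc n
  sample : ℕ → ℕ → ℕ → Ω → Ξ
  hist : ℕ → Filtration ℕ mΩ
  x_one : ∀ ω, x 1 ω = s.x₁
  g_one : ∀ ω, g 1 ω = s.G₁
  ρ_zero : ∀ ω, ρ 0 ω = s.ρ₀
  /- Step (a): the penalty parameter. -/
  ρ_measurable : ∀ k, 1 ≤ k → k < N → Measurable[hist k 1] (ρ k)
  ρ_increase : ∀ k, 1 ≤ k → k < N → ∀ ω, ρ (k - 1) ω + s.τ ≤ ρ k ω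
  ρ_steering : ∀ k, 1 ≤ k → k < N → ∀ ω,
    ρ k ω * s.ξ * theta p.c (x k ω) ≤ phi p.c (ρ k ω) (x k ω) (g k ω)
  /- Step (b): the budget is fixed before the subproblem is solved. -/
  budget_measurable : ∀ k, 1 ≤ k → k < N → Measurable[hist k 1] (budget k)
  budget_ge : ∀ k, 1 ≤ k → k < N → ∀ ω, budgetBound p s ε (ρ k ω) (x k ω) ≤ (budget k ω : ℝ)
  /- Step (b): the oracle seeds are independent draws from `law`, independent of the past. -/
  sample_measurable : ∀ k, 1 ≤ k → k < N → ∀ i, 1 ≤ i → ∀ j,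
    Measurable[hist k (i + 1)] (sample k i j)
  sample_law : ∀ k, 1 ≤ k → k < N → ∀ i, 1 ≤ i → ∀ j, P.map (sample k i j) = p.law
  sample_iIndep : ∀ k, 1 ≤ k → k < N → ∀ i, 1 ≤ i → iIndepFun (sample k i) P
  sample_indep_past : ∀ k, 1 ≤ k → k < N → ∀ i, 1 ≤ i →
    Indep (⨆ j, MeasurableSpace.comap (sample k i j) inferInstance) (hist k i) P
  /- Step (b): inner iterates, with stepsize `1 / L_ρ` and the mini-batch stochastic gradient. -/
  y_one : ∀ k, 1 ≤ k → k < N → ∀ ω, y k 1 ω = x k ω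
  y_adapted : ∀ k, 1 ≤ k → k < N → ∀ i, 1 ≤ i → Measurable[hist k i] (y k i)
  y_succ : ∀ k, 1 ≤ k → k < N → ∀ i, 1 ≤ i → ∀ ω,
    IsMinOn (psi (fun v => ρ k ω * ‖v‖) p.c (1 / Lrho p (ρ k ω)) (y k i ω)
      ((1 / (batchSize p s (ρ k ω) (budget k ω) : ℝ)) •
        ∑ j ∈ Finset.range (batchSize p s (ρ k ω) (budget k ω)), p.G (y k i ω) (sample k i j ω)))
      Set.univ (y k (i + 1) ω)
  /- Step (b): given the past and the noise of the `k`-th subproblem, `R k` is uniformly distributed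
  on `{1, …, innerLimit}`. For the constant stepsize `γ = 1 / L_ρ` this is the law proportional to
  `γ - L_ρ γ² / 2`. -/
  R_uniform : ∀ k, 1 ≤ k → k < N → ∀ r : ℕ,
    P[(R k ⁻¹' {r}).indicator (fun _ => (1 : ℝ)) | ⨆ i, (hist k i : MeasurableSpace Ω)] =ᵐ[P]
      fun ω => if 1 ≤ r ∧ r ≤ innerLimit p s (ρ k ω) (budget k ω)
        then 1 / (innerLimit p s (ρ k ω) (budget k ω) : ℝ) else 0
  R_measurable : ∀ k, 1 ≤ k → k < N → Measurable[hist (k + 1) 1] (R k)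
  hist_le : ∀ k, 1 ≤ k → k < N → ∀ i, (hist k i : MeasurableSpace Ω) ≤ hist (k + 1) 1
  /- The output of the subproblem solver. -/
  x_succ : ∀ k, 1 ≤ k → k < N → ∀ ω, x (k + 1) ω = y k (R k ω) ω
  g_succ : ∀ k, 1 ≤ k → k < N → ∀ ω, g (k + 1) ω =
    (1 / (batchSize p s (ρ k ω) (budget k ω) : ℝ)) •
      ∑ j ∈ Finset.range (batchSize p s (ρ k ω) (budget k ω)),
        p.G (y k (R k ω) ω) (sample k (R k ω) j ω)

namespace Run

variable {n q : ℕ} {Ξ : Type*} [MeasurableSpace Ξ] {p : Problem n q Ξ} {s : Settings n}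
  {ε : ℝ} {N : ℕ} {Ω : Type*} [MeasurableSpace Ω] {P : Measure Ω}

/-- The outer iterates stay, almost surely, where the bounds `b` hold. -/
def BoundedBy (r : Run p s ε N P) (b : Bounds) : Prop :=
  ∀ k, 1 ≤ k → k ≤ N → ∀ᵐ ω ∂P, p.f (r.x k ω) ≤ b.κf ∧ ‖p.c (r.x k ω)‖ ≤ b.κc ∧
    ‖gradient p.f (r.x k ω)‖ ≤ b.κg ∧ ‖fderiv ℝ p.c (r.x k ω)‖ ≤ b.κJ

/-- The number of oracle calls in the `k`-th outer iteration: one batch at each of the inner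
iterates `y k 1, …, y k (R k)`. -/
noncomputable def calls (r : Run p s ε N P) (k : ℕ) (ω : Ω) : ℕ :=
  batchSize p s (r.ρ k ω) (r.budget k ω) * r.R k ω

/-- Every budget is the least admissible one up to the factor `Λ`. -/
def EconomicalBudgets (r : Run p s ε N P) (Λ : ℝ) : Prop :=
  ∀ k, 1 ≤ k → k < N → ∀ ω,
    (r.budget k ω : ℝ) ≤ Λ * (⌈budgetBound p s ε (r.ρ k ω) (r.x k ω)⌉₊ : ℝ)

/-- Every penalty parameter is at most `Λ` times any value that Step (a) admits in its place. -/
def EconomicalPenalties (r : Run p s ε N P) (Λ : ℝ) : Prop :=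
  ∀ k, 1 ≤ k → k < N → ∀ ω, ∀ ρ' : ℝ, r.ρ (k - 1) ω + s.τ ≤ ρ' →
    ρ' * s.ξ * theta p.c (r.x k ω) ≤ phi p.c ρ' (r.x k ω) (r.g k ω) → r.ρ k ω ≤ Λ * ρ'

/-- The first outer iteration `k ≥ 1` whose penalty parameter is at least `ρbar`. -/
noncomputable def hit (r : Run p s ε N P) (ρbar : ℝ) (ω : Ω) : ℕ :=
  sInf {k : ℕ | 1 ≤ k ∧ ρbar ≤ r.ρ k ω}

end Run

/-! ### Stochastic critical points -/

/-- `E ‖∇f(X) + J(X)ᵀ lam‖² ≤ ε` for some random multiplier `lam`. -/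
def HasMultiplier {n q : ℕ} (f : Euc n → ℝ) (c : Euc n → Euc q) {Ω : Type*} [MeasurableSpace Ω]
    (P : Measure Ω) (X : Ω → Euc n) (ε : ℝ) : Prop :=
  ∃ lam : Ω → Euc q, Measurable lam ∧
    Integrable (fun ω => ‖gradient f (X ω) + (fderiv ℝ c (X ω)).adjoint (lam ω)‖ ^ 2) P ∧
    ∫ ω, ‖gradient f (X ω) + (fderiv ℝ c (X ω)).adjoint (lam ω)‖ ^ 2 ∂P ≤ ε

/-- The random point `X` is an `ε`-stochastic critical point of `min f` subject to `c = 0`. -/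
def IsStochasticCritical {n q : ℕ} (f : Euc n → ℝ) (c : Euc n → Euc q) {Ω : Type*}
    [MeasurableSpace Ω] (P : Measure Ω) (X : Ω → Euc n) (ε : ℝ) : Prop :=
  HasMultiplier f c P X ε ∧
    Integrable (fun ω => theta c (X ω)) P ∧ ∫ ω, theta c (X ω) ∂P ≤ √ε

end PenaltySFO

/-! Fix a penalty parameter ρ and let Q(x) be `proxGrad p ρ x`, that is, -L_ρ times the step from x
computed with the exact gradient. Two deterministic facts make Q the quantity to control. Since
moving along ker J(x) leaves the norm term unchanged, the smooth part is stationary there, hence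
Q(x) = ∇f(x) + J(x)ᵀλ for some λ (`exists_multiplier`); a bound on E‖Q‖² is thus the multiplier
condition. Comparing the step with multiples t s, where s attains the minimum in θ(x), gives ρ θ(x)
≤ ‖∇f(x)‖ + O(‖Q‖) + O((ρ‖Q‖)^{1/2}) when gradient and Jacobian are bounded
(`penalty_mul_theta_le`). So a small Q together with a large ρ forces near feasibility.

The stochastic part is E‖Q‖² ≤ 5ε/16 at the returned point. A step with a noisy gradient decreases
L_ρ Φ_ρ by ‖Q‖²/4, up to an inner product of the noise with Q, which has mean zero, and 3/2 times
the squared noise (`penalty_descent`). Weighting inner iterate i by its conditional probability of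
being returned and summing over i telescopes, and bounds the mean of ‖Q‖² by 4 L_ρ D / M + 6σ² / m
for iteration limit M and batch size m. The budget is what makes this at most 5ε/16
(`inner_error_le`). As ρ, budget, M and m are random but known when the outer iteration starts, the
estimate is proved on every event A of that past (`setLIntegral_proxGrad_le`). Summing over A = {K =
k} extends it to a random outer iteration K that is known at its own start. Hence `random_iterate`
serves both claims: K = N - 1, and K the first iteration with ρ_K ≥ ρ̄.

For the oracle count, one subproblem costs O(ρ²/ε²). Before ρ̄ = O(ε^{-1/2}) is reached this is
O(ε^{-3}), and increments of at least τ allow only O(ε^{-1/2}) such iterations. The last iteration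
needs ρ_K = O(ε^{-1/2}) although the stochastic gradient in Step (a) is unbounded. This works
because, whatever the gradient is, either ρ or 4ρ/(1-ξ) is admissible (`steering_admissible`): one
of the directions s, -s is good enough. -/

namespace PenaltySFO

/-! ### Strong convexity and optimality of the step model -/

section Deterministic

variable {E F : Type*} [NormedAddCommGroup E] [InnerProductSpace ℝ E]
  [NormedAddCommGroup F] [InnerProductSpace ℝ F]

/-- First-order Taylor estimate for a map with Lipschitz derivative. -/
lemma norm_taylor_one_le {F : Type*} [NormedAddCommGroup F] [NormedSpace ℝ F] {f : E → F} {L : ℝ}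
    (hf : Differentiable ℝ f)
    (hL : ∀ x y, ‖fderiv ℝ f x - fderiv ℝ f y‖ ≤ L * ‖x - y‖) (x d : E) :
    ‖f (x + d) - f x - fderiv ℝ f x d‖ ≤ L / 2 * ‖d‖ ^ 2 := by
  have hγ : ∀ t : ℝ, HasDerivAt (fun t : ℝ => x + t • d) d t := fun t => by
    simpa using ((hasDerivAt_id t).smul_const d).const_add x
  have h1 : ∀ t : ℝ, HasDerivAt (fun t : ℝ => f (x + t • d) - f x - t • fderiv ℝ f x d)
      (fderiv ℝ f (x + t • d) d - fderiv ℝ f x d) t := fun t => by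
    have := (hf (x + t • d)).hasFDerivAt.comp_hasDerivAt t (hγ t)
    simpa using (this.sub_const (f x)).fun_sub ((hasDerivAt_id t).smul_const (fderiv ℝ f x d))
  have h2 : ∀ t : ℝ, HasDerivAt (fun t : ℝ => L / 2 * ‖d‖ ^ 2 * t ^ 2) (L * ‖d‖ ^ 2 * t) t :=
    fun t => by
      have := (hasDerivAt_pow 2 t).const_mul (L / 2 * ‖d‖ ^ 2)
      refine this.congr_deriv ?_
      simp; ring
  -- The Taylor remainder along t ↦ x + t d has a derivative of norm at most L‖d‖² t, which is the
  -- derivative of (L/2)‖d‖² t².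
  have h := image_norm_le_of_norm_deriv_right_le_deriv_boundary (a := 0) (b := 1)
    (fun t _ => (h1 t).continuousAt.continuousWithinAt)
    (fun t _ => (h1 t).hasDerivWithinAt) (by simp) h2 ?_ (Set.right_mem_Icc.2 zero_le_one)
  · simpa using h
  · intro t ht
    rw [← sub_apply]
    refine (ContinuousLinearMap.le_opNorm _ _).trans ?_
    have := hL (x + t • d) x
    rw [add_sub_cancel_left, norm_smul, Real.norm_of_nonneg ht.1] at this
    nlinarith [norm_nonneg d]

/-- The model whose minimizer in `d` is the step of the stochastic approximation algorithm. -/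
noncomputable def stepModel (g : E) (ρ L : ℝ) (v : F) (A : E →L[ℝ] F) (d : E) : ℝ :=
  inner ℝ g d + ρ * ‖v + A d‖ + L / 2 * ‖d‖ ^ 2

lemma continuous_stepModel (g : E) (ρ L : ℝ) (v : F) (A : E →L[ℝ] F) :
    Continuous (stepModel g ρ L v A) := by
  unfold stepModel; fun_prop

lemma stepModel_zero (g : E) (ρ L : ℝ) (v : F) (A : E →L[ℝ] F) :
    stepModel g ρ L v A 0 = ρ * ‖v‖ := by
  simp [stepModel]

/-- The model is a convex function plus (L/2)‖·‖². Convexity on the segment from d to w, with the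
exact identity for the squared norm, leaves the gain (1-t)(L/2)‖w-d‖² after division by t; then t →
0. -/
lemma stepModel_growth {g : E} {ρ L : ℝ} {v : F} {A : E →L[ℝ] F} {d : E} (hρ : 0 ≤ ρ)
    (hd : ∀ w, stepModel g ρ L v A d ≤ stepModel g ρ L v A w) (w : E) :
    stepModel g ρ L v A d + L / 2 * ‖w - d‖ ^ 2 ≤ stepModel g ρ L v A w := by
  have key : ∀ t ∈ Set.Ioc (0 : ℝ) 1,
      stepModel g ρ L v A d + (1 - t) * (L / 2 * ‖w - d‖ ^ 2) ≤ stepModel g ρ L v A w := by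
    intro t ht
    have h1 := hd (d + t • (w - d))
    have e1 : v + A (d + t • (w - d)) = (1 - t) • (v + A d) + t • (v + A w) := by
      simp only [map_add, map_smul, map_sub]; module
    have h2 : ‖v + A (d + t • (w - d))‖ ≤ (1 - t) * ‖v + A d‖ + t * ‖v + A w‖ := by
      rw [e1]
      refine (norm_add_le _ _).trans ?_
      rw [norm_smul, norm_smul, Real.norm_of_nonneg ht.1.le,
        Real.norm_of_nonneg (sub_nonneg.2 ht.2)]
    have h3 : ‖d + t • (w - d)‖ ^ 2 =
        (1 - t) * ‖d‖ ^ 2 + t * ‖w‖ ^ 2 - t * (1 - t) * ‖w - d‖ ^ 2 := by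
      rw [norm_add_sq_real, norm_smul, Real.norm_of_nonneg ht.1.le, norm_sub_sq_real,
        mul_pow, norm_sub_sq_real, inner_smul_right, inner_sub_right, real_inner_self_eq_norm_sq,
        real_inner_comm]
      ring
    have h4 : inner ℝ g (d + t • (w - d)) = (1 - t) * inner ℝ g d + t * inner ℝ g w := by
      rw [inner_add_right, inner_smul_right, inner_sub_right]; ring
    unfold stepModel at h1 ⊢
    rw [h3, h4] at h1
    have h5 := mul_le_mul_of_nonneg_left h2 hρ
    have h6 : 0 ≤ t * ((inner ℝ g w + ρ * ‖v + A w‖ + L / 2 * ‖w‖ ^ 2) -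
      (inner ℝ g d + ρ * ‖v + A d‖ + L / 2 * ‖d‖ ^ 2 + (1 - t) * (L / 2 * ‖w - d‖ ^ 2))) := by
      nlinarith
    linarith [nonneg_of_mul_nonneg_right h6 ht.1]
  have lim : Filter.Tendsto
      (fun t : ℝ => stepModel g ρ L v A d + (1 - t) * (L / 2 * ‖w - d‖ ^ 2))
      (nhdsWithin 0 (Set.Ioi 0)) (nhds (stepModel g ρ L v A d + L / 2 * ‖w - d‖ ^ 2)) := by
    have : Continuous fun t : ℝ => stepModel g ρ L v A d + (1 - t) * (L / 2 * ‖w - d‖ ^ 2) := by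
      fun_prop
    simpa using (this.tendsto 0).mono_left nhdsWithin_le_nhds
  refine le_of_tendsto lim ?_
  filter_upwards [Ioc_mem_nhdsGT (zero_lt_one' ℝ)] with t ht using key t ht

/-- Beyond the radius (2‖g‖ + 2ρ‖A‖)/L the quadratic term outweighs all decrease of the other two,
so the model exceeds its value at 0 and a minimizer over the ball is global. -/
lemma exists_stepModel_min [FiniteDimensional ℝ E] (g : E) {ρ L : ℝ} (v : F) (A : E →L[ℝ] F)
    (hρ : 0 ≤ ρ) (hL : 0 < L) :
    ∃ d, ∀ w, stepModel g ρ L v A d ≤ stepModel g ρ L v A w := by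
  have := FiniteDimensional.proper_real E
  obtain ⟨d, -, hd⟩ := (isCompact_closedBall (0 : E) ((2 * ‖g‖ + 2 * ρ * ‖A‖) / L)).exists_isMinOn
    (Metric.nonempty_closedBall.2 (by positivity))
    (continuous_stepModel g ρ L v A).continuousOn
  refine ⟨d, fun w => ?_⟩
  by_cases hw : w ∈ Metric.closedBall (0 : E) ((2 * ‖g‖ + 2 * ρ * ‖A‖) / L)
  · exact hd hw
  · have h0 : stepModel g ρ L v A d ≤ stepModel g ρ L v A 0 :=
      hd (Metric.mem_closedBall_self (by positivity))
    refine h0.trans ?_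
    rw [stepModel_zero, stepModel]
    rw [mem_closedBall_zero_iff, not_le, div_lt_iff₀ hL] at hw
    have h1 : -(‖g‖ * ‖w‖) ≤ inner ℝ g w := neg_le_of_abs_le (abs_real_inner_le_norm g w)
    have h2 : ‖v‖ - ‖A‖ * ‖w‖ ≤ ‖v + A w‖ := by
      have := norm_sub_le (v + A w) (A w)
      rw [add_sub_cancel_right] at this
      linarith [A.le_opNorm w]
    have h3 := mul_le_mul_of_nonneg_left h2 hρ
    nlinarith [norm_nonneg w]

/-- Each minimizer is inserted in the growth inequality of the other; in the sum only ⟨g - g', d' -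
d⟩ survives. -/
lemma stepModel_min_nonexpansive {g g' : E} {ρ L : ℝ} {v : F} {A : E →L[ℝ] F} {d d' : E}
    (hρ : 0 ≤ ρ)
    (hd : ∀ w, stepModel g ρ L v A d ≤ stepModel g ρ L v A w)
    (hd' : ∀ w, stepModel g' ρ L v A d' ≤ stepModel g' ρ L v A w) :
    L * ‖d - d'‖ ≤ ‖g - g'‖ := by
  have h1 := stepModel_growth hρ hd d'
  have h2 := stepModel_growth hρ hd' d
  have h3 : L * ‖d - d'‖ ^ 2 ≤ inner ℝ (g - g') (d' - d) := by
    rw [norm_sub_rev d' d] at h1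
    simp only [stepModel, inner_sub_left, inner_sub_right] at *
    linarith
  have h4 := h3.trans (real_inner_le_norm _ _)
  rw [norm_sub_rev d' d] at h4
  rcases eq_or_ne (‖d - d'‖) 0 with h | h
  · simp [h]
  · have : 0 < ‖d - d'‖ := lt_of_le_of_ne (norm_nonneg _) (Ne.symm h)
    nlinarith

/-- The optimality condition of the step, with a multiplier. -/
lemma exists_multiplier [FiniteDimensional ℝ E] [FiniteDimensional ℝ F] [CompleteSpace E]
    [CompleteSpace F] {g : E} {ρ L : ℝ} {v : F} {A : E →L[ℝ] F} {d : E}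
    (hd : ∀ w, stepModel g ρ L v A d ≤ stepModel g ρ L v A w) :
    ∃ lam : F, g + A.adjoint lam = -(L • d) := by
  -- On d + ker A the term ρ‖v + A d‖ is constant, so only the smooth part is differentiated and no
  -- subgradient of the norm is needed.
  have hmem : g + L • d ∈ (A.ker)ᗮ := by
    rw [Submodule.mem_orthogonal']
    intro w hw
    have hAw : A w = 0 := hw
    have hmin : ∀ t : ℝ, 0 ≤ t * inner ℝ (g + L • d) w + t ^ 2 * (L / 2 * ‖w‖ ^ 2) := by
      intro t
      have h := hd (d + t • w)
      simp only [stepModel, map_add, map_smul, hAw, smul_zero, add_zero, inner_add_right,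
        inner_smul_right, norm_add_sq_real, norm_smul, mul_pow, Real.norm_eq_abs, sq_abs] at h
      rw [inner_add_left, inner_smul_left]
      simp only [conj_trivial]
      linarith
    set a := inner ℝ (g + L • d) w
    set c := L / 2 * ‖w‖ ^ 2
    by_contra ha
    -- A step against the sign of a, short enough for the quadratic term with coefficient c not to
    -- compensate.
    have h1 := hmin (-a / (|c| + 1))
    have hc : 0 < |c| + 1 := by positivity
    have h2 : -a / (|c| + 1) * a + (-a / (|c| + 1)) ^ 2 * c
        = a ^ 2 * (c - (|c| + 1)) / (|c| + 1) ^ 2 := by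
      field_simp; ring
    rw [h2] at h1
    have h3 : a ^ 2 * (c - (|c| + 1)) / (|c| + 1) ^ 2 < 0 := by
      apply div_neg_of_neg_of_pos _ (by positivity)
      have : 0 < a ^ 2 := by positivity
      nlinarith [le_abs_self c]
    linarith
  have hrange : (A.ker)ᗮ = (A.adjoint).range := by
    have h := (A.adjoint).orthogonal_range
    rw [ContinuousLinearMap.adjoint_adjoint] at h
    rw [← h, Submodule.orthogonal_orthogonal]
  rw [hrange] at hmem
  obtain ⟨u, hu⟩ := hmem
  refine ⟨-u, ?_⟩
  have hu' : A.adjoint u = g + L • d := hu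
  rw [map_neg, hu']
  abel

end Deterministic

/-! ### The infeasibility measure and the steering condition -/

section Theta

variable {n q : ℕ} {c : Euc n → Euc q}

lemma exists_theta_min (c : Euc n → Euc q) (x : Euc n) :
    ∃ s : Euc n, ‖s‖ ≤ 1 ∧ theta c x = ‖c x‖ - ‖c x + fderiv ℝ c x s‖ ∧
      ∀ w : Euc n, ‖w‖ ≤ 1 → ‖c x + fderiv ℝ c x s‖ ≤ ‖c x + fderiv ℝ c x w‖ := by
  have hc : Continuous fun s : Euc n => ‖c x + fderiv ℝ c x s‖ := by fun_prop
  obtain ⟨s, hs, h1, h2⟩ := (isCompact_closedBall (0 : Euc n) 1).exists_sInf_image_eq_and_le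
    (Metric.nonempty_closedBall.2 zero_le_one) hc.continuousOn
  refine ⟨s, by simpa using hs, by rw [theta, h1], fun w hw => h2 w (by simpa using hw)⟩

lemma theta_nonneg (c : Euc n → Euc q) (x : Euc n) : 0 ≤ theta c x := by
  obtain ⟨s, -, h, hmin⟩ := exists_theta_min c x
  have := hmin 0 (by simp)
  simp at this
  linarith

lemma theta_le_norm (c : Euc n → Euc q) (x : Euc n) : theta c x ≤ ‖c x‖ := by
  obtain ⟨s, -, h, -⟩ := exists_theta_min c x
  rw [h]; linarith [norm_nonneg (c x + fderiv ℝ c x s)]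

lemma continuous_theta (hc : ContDiff ℝ 1 c) : Continuous (theta c) := by
  have h0 : Continuous c := hc.continuous
  have h1 : Continuous (fderiv ℝ c) := hc.continuous_fderiv one_ne_zero
  refine h0.norm.sub ((isCompact_closedBall (0 : Euc n) 1).continuous_sInf
    (f := fun x s => ‖c x + fderiv ℝ c x s‖) ?_)
  exact ((h0.comp continuous_fst).add
    ((h1.comp continuous_fst).clm_apply continuous_snd)).norm

lemma le_phi (c : Euc n → Euc q) {ρ : ℝ} (x g : Euc n) {s : Euc n} (hs : ‖s‖ ≤ 1) :
    ρ * ‖c x‖ - (inner ℝ g s + ρ * ‖c x + fderiv ℝ c x s‖) ≤ phi c ρ x g := by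
  have hc : Continuous fun s : Euc n => inner ℝ g s + ρ * ‖c x + fderiv ℝ c x s‖ := by fun_prop
  have := csInf_le ((isCompact_closedBall (0 : Euc n) 1).image hc).bddBelow
    (Set.mem_image_of_mem _ (mem_closedBall_zero_iff.2 hs))
  rw [phi]
  exact sub_le_sub_left this _

/-- If s is optimal, so that its linear image b = J s reduces the norm of a = c(x) by θ, then
reversing s cannot increase it by more than 3θ. Optimality against shrunken copies of s bounds ‖b‖²
by -⟨a, b⟩, which controls the asymmetry between ±b. -/
lemma norm_sub_le_of_theta_min {x s : Euc n} (hs : ‖s‖ ≤ 1)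
    (hθ : theta c x = ‖c x‖ - ‖c x + fderiv ℝ c x s‖)
    (hmin : ∀ w : Euc n, ‖w‖ ≤ 1 → ‖c x + fderiv ℝ c x s‖ ≤ ‖c x + fderiv ℝ c x w‖) :
    ‖c x + fderiv ℝ c x (-s)‖ ≤ ‖c x‖ + 3 * theta c x := by
  set a := c x
  set b := fderiv ℝ c x s with hb
  have hθ0 := theta_nonneg c x
  have hab : ‖a + b‖ ^ 2 = ‖a‖ ^ 2 + 2 * inner ℝ a b + ‖b‖ ^ 2 := norm_add_sq_real a b
  have hline : ∀ t ∈ Set.Ioc (0 : ℝ) 1, (2 - t) * ‖b‖ ^ 2 ≤ -2 * inner ℝ a b := by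
    intro t ht
    have h1 := hmin ((1 - t) • s) (by
      rw [norm_smul, Real.norm_of_nonneg (sub_nonneg.2 ht.2)]
      nlinarith [norm_nonneg s, ht.1])
    rw [map_smul, ← hb] at h1
    have h2 : ‖a + b‖ ^ 2 ≤ ‖a + (1 - t) • b‖ ^ 2 := by gcongr
    rw [norm_add_sq_real, norm_add_sq_real, norm_smul, mul_pow, Real.norm_eq_abs, sq_abs,
      inner_smul_right] at h2
    have h3 : 0 ≤ t * (-2 * inner ℝ a b - (2 - t) * ‖b‖ ^ 2) := by nlinarith
    linarith [nonneg_of_mul_nonneg_right h3 ht.1]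
  have h1 := hline 1 ⟨one_pos, le_rfl⟩
  have h2 : ‖b‖ ^ 2 * 2 ≤ -2 * inner ℝ a b := by
    have lim : Filter.Tendsto (fun t : ℝ => (2 - t) * ‖b‖ ^ 2)
        (nhdsWithin 0 (Set.Ioi 0)) (nhds ((2 - 0) * ‖b‖ ^ 2)) := by
      have : Continuous fun t : ℝ => (2 - t) * ‖b‖ ^ 2 := by fun_prop
      exact (this.tendsto 0).mono_left nhdsWithin_le_nhds
    have := le_of_tendsto lim (b := -2 * inner ℝ a b) (by
      filter_upwards [Ioc_mem_nhdsGT (zero_lt_one' ℝ)] with t ht using hline t ht)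
    linarith
  have h3 : ‖a + b‖ = ‖a‖ - theta c x := by linarith
  rw [h3] at hab
  -- By `hab`, -2⟨a,b⟩ - ‖b‖² = 2‖a‖θ - θ², and by `h2` this dominates ‖b‖². Hence ‖a - b‖² ≤ ‖a‖² +
  -- 3(2‖a‖θ - θ²).
  have h4 : ‖a + -b‖ ^ 2 ≤ (‖a‖ + 3 * theta c x) ^ 2 := by
    rw [norm_add_sq_real, norm_neg, inner_neg_right]
    nlinarith [norm_nonneg a, mul_nonneg hθ0 (norm_nonneg a), sq_nonneg (theta c x)]
  rw [map_neg, ← hb]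
  exact (sq_le_sq₀ (norm_nonneg _) (by positivity)).1 h4

/-- Admissibility of the steering condition is restored by a bounded increase of the penalty. -/
lemma steering_admissible {ξ ρ : ℝ} (hξ0 : 0 < ξ) (hξ : ξ < 1) (hρ : 0 < ρ) (x g : Euc n) :
    ρ * ξ * theta c x ≤ phi c ρ x g ∨
      (4 * ρ / (1 - ξ)) * ξ * theta c x ≤ phi c (4 * ρ / (1 - ξ)) x g := by
  obtain ⟨s, hs, hθ, hmin⟩ := exists_theta_min c x
  have hθ0 := theta_nonneg c x
  have h1 := norm_sub_le_of_theta_min hs hθ hmin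
  have hξ' : 0 < 1 - ξ := by linarith
  -- If ⟨g,s⟩ is this large, the trial direction -s gains 4ρθ from g and loses at most 3ρθ in the
  -- norm. Otherwise s itself works for the penalty 4ρ/(1-ξ), whose fraction 1-ξ is exactly 4ρ. No
  -- bound on g enters.
  by_cases h : 4 * ρ * theta c x ≤ inner ℝ g s
  · left
    have h2 := le_phi c (ρ := ρ) x g (s := -s) (by simpa using hs)
    rw [inner_neg_right] at h2
    nlinarith [mul_le_mul_of_nonneg_left h1 hρ.le, mul_nonneg hρ.le hθ0]
  · right
    have h2 := le_phi c (ρ := 4 * ρ / (1 - ξ)) x g hs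
    have h3 : 4 * ρ / (1 - ξ) * (1 - ξ) = 4 * ρ := div_mul_cancel₀ _ hξ'.ne'
    have h4 : 4 * ρ / (1 - ξ) * (1 - ξ) * theta c x = 4 * ρ * theta c x := by rw [h3]
    have h5 : ‖c x + fderiv ℝ c x s‖ = ‖c x‖ - theta c x := by linarith
    rw [h5] at h2
    nlinarith

/-- The infeasibility measure is controlled by the size of the step. -/
lemma penalty_mul_theta_le {g x d : Euc n} {ρ L : ℝ} (hρ : 0 ≤ ρ) (hL : 0 < L)
    (hd : ∀ w, stepModel g ρ L (c x) (fderiv ℝ c x) d ≤ stepModel g ρ L (c x) (fderiv ℝ c x) w) :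
    ρ * theta c x ≤ ‖g‖ + 2 * ((‖g‖ + ρ * ‖fderiv ℝ c x‖) * ‖d‖) +
      √(2 * L * ((‖g‖ + ρ * ‖fderiv ℝ c x‖) * ‖d‖)) := by
  obtain ⟨s, hs, hθ, -⟩ := exists_theta_min c x
  set D := (‖g‖ + ρ * ‖fderiv ℝ c x‖) * ‖d‖ with hD
  have hD0 : 0 ≤ D := by positivity
  -- Lower bound for the model at its minimizer d, by Lipschitz continuity of its first two terms,
  -- against an upper bound at t s, by convexity.
  have key : ∀ t : ℝ, 0 ≤ t → t ≤ 1 → t * (ρ * theta c x - ‖g‖) - L / 2 * t ^ 2 ≤ D := by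
    intro t ht0 ht1
    have h1 := hd (t • s)
    have h2 : ρ * ‖c x‖ - D ≤ stepModel g ρ L (c x) (fderiv ℝ c x) d := by
      have h1 : -(‖g‖ * ‖d‖) ≤ inner ℝ g d := neg_le_of_abs_le (abs_real_inner_le_norm g d)
      have h2 : ‖c x‖ - ‖fderiv ℝ c x‖ * ‖d‖ ≤ ‖c x + fderiv ℝ c x d‖ := by
        have := norm_sub_le (c x + fderiv ℝ c x d) (fderiv ℝ c x d)
        rw [add_sub_cancel_right] at this
        linarith [(fderiv ℝ c x).le_opNorm d]
      have h3 := mul_le_mul_of_nonneg_left h2 hρ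
      rw [stepModel]
      nlinarith [sq_nonneg ‖d‖]
    have h3 : stepModel g ρ L (c x) (fderiv ℝ c x) (t • s) ≤
        t * ‖g‖ + ρ * (‖c x‖ - t * theta c x) + L / 2 * t ^ 2 := by
      have e1 : c x + fderiv ℝ c x (t • s) = (1 - t) • c x + t • (c x + fderiv ℝ c x s) := by
        rw [map_smul]; module
      have e2 : ‖c x + fderiv ℝ c x (t • s)‖ ≤ ‖c x‖ - t * theta c x := by
        rw [e1, hθ]
        refine (norm_add_le _ _).trans ?_
        rw [norm_smul, norm_smul, Real.norm_of_nonneg ht0,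
          Real.norm_of_nonneg (sub_nonneg.2 ht1)]
        linarith
      have e3 : inner ℝ g (t • s) ≤ t * ‖g‖ := by
        rw [inner_smul_right]
        refine mul_le_mul_of_nonneg_left ((real_inner_le_norm g s).trans ?_) ht0
        nlinarith [norm_nonneg g]
      have e4 : ‖t • s‖ ^ 2 ≤ t ^ 2 := by
        rw [norm_smul, mul_pow, Real.norm_eq_abs, sq_abs]
        have : ‖s‖ ^ 2 ≤ 1 := by nlinarith [norm_nonneg s]
        nlinarith [sq_nonneg t]
      rw [stepModel]
      have := mul_le_mul_of_nonneg_left e2 hρ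
      have := mul_le_mul_of_nonneg_left e4 hL.le
      linarith
    nlinarith
  set B := ρ * theta c x - ‖g‖ with hB
  have hs0 := Real.sqrt_nonneg (2 * L * D)
  suffices B ≤ 2 * D + √(2 * L * D) by linarith
  rcases le_or_gt B 0 with hB0 | hB0
  · linarith
  -- The best t is min(1, B/L). It gives B ≤ 2D when B ≥ L, and B² ≤ 2LD otherwise.
  rcases le_or_gt L B with hLB | hLB
  · have := key 1 zero_le_one le_rfl
    linarith
  · have := key (B / L) (by positivity) ((div_le_one hL).2 hLB.le)
    have h5 : B ^ 2 ≤ 2 * L * D := by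
      have e : B / L * B - L / 2 * (B / L) ^ 2 = B ^ 2 / (2 * L) := by field_simp; ring
      rw [e, div_le_iff₀ (by positivity)] at this
      linarith
    have := Real.le_sqrt_of_sq_le h5
    linarith

end Theta

/-! ### Batch size, iteration limit and budget -/

section Batch

variable {n q : ℕ} {Ξ : Type*} [MeasurableSpace Ξ] {p : Problem n q Ξ} {s : Settings n}

lemma Lrho_pos (hp : p.Assumptions) {ρ : ℝ} (hρ : 0 ≤ ρ) : 0 < Lrho p ρ :=
  add_pos_of_pos_of_nonneg hp.Lg_pos (mul_nonneg hρ hp.LJ_pos.le)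

lemma gap_nonneg (hs : s.Valid p) {ρ : ℝ} (hρ : 0 < ρ) (x : Euc n) : 0 ≤ gap p s ρ x :=
  sub_nonneg.2 (hs.Φlow_le ρ hρ x)

lemma one_le_budget (hp : p.Assumptions) (hs : s.Valid p) {ε ρ : ℝ} (hρ : 0 ≤ ρ) {x : Euc n}
    {N : ℕ} (hN : budgetBound p s ε ρ x ≤ N) : 1 ≤ N := by
  have hL := Lrho_pos hp hρ
  have h1 : 0 < C1 p s / Lrho p ρ ^ 2 := by
    have := hp.σ_pos; have := hs.Dt_pos
    unfold C1; positivity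
  have h2 : (0 : ℝ) < N := (h1.trans_le (le_max_right _ _)).trans_le hN
  exact_mod_cast h2

lemma one_le_batchSize {ρ : ℝ} {N : ℕ} (hN : 1 ≤ N) : 1 ≤ batchSize p s ρ N := by
  refine Nat.one_le_ceil_iff.2 (lt_min (by exact_mod_cast hN) ?_)
  exact lt_max_of_lt_left one_pos

lemma batchSize_le {ρ : ℝ} {N : ℕ} : batchSize p s ρ N ≤ N :=
  Nat.ceil_le.2 (min_le_left _ _)

lemma one_le_innerLimit {ρ : ℝ} {N : ℕ} (hN : 1 ≤ N) : 1 ≤ innerLimit p s ρ N := by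
  have h1 : 1 ≤ batchSize p s ρ N := one_le_batchSize hN
  refine Nat.one_le_ceil_iff.2 (div_pos ?_ ?_)
  · exact_mod_cast hN
  · exact_mod_cast h1

/-- Rounding up the iteration limit adds at most one batch, and a batch is at most N. -/
lemma batchSize_mul_innerLimit_le {ρ : ℝ} {N : ℕ} (hN : 1 ≤ N) :
    batchSize p s ρ N * innerLimit p s ρ N ≤ 2 * N := by
  have h1 : 1 ≤ batchSize p s ρ N := one_le_batchSize hN
  have h2 : batchSize p s ρ N ≤ N := batchSize_le
  have h3 : (0 : ℝ) < batchSize p s ρ N := by exact_mod_cast h1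
  have h4 : (innerLimit p s ρ N : ℝ) ≤ N / batchSize p s ρ N + 1 :=
    (Nat.ceil_lt_add_one (by positivity)).le
  have h5 : (batchSize p s ρ N : ℝ) ≤ N := by exact_mod_cast h2
  have h6 : (batchSize p s ρ N : ℝ) * innerLimit p s ρ N ≤ 2 * N := by
    refine (mul_le_mul_of_nonneg_left h4 h3.le).trans ?_
    rw [mul_add, mul_div_cancel₀ _ h3.ne']
    linarith
  exact_mod_cast h6

/-- The budget makes the error of the stochastic approximation algorithm small. -/
lemma inner_error_le (hp : p.Assumptions) (hs : s.Valid p) {ε ρ : ℝ} (hε : 0 < ε) (hρ : 0 < ρ)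
    {x : Euc n} {N : ℕ} (hN : budgetBound p s ε ρ x ≤ N) :
    4 * (Lrho p ρ / innerLimit p s ρ N * gap p s ρ x) +
      6 * (p.σ ^ 2 / batchSize p s ρ N) ≤ 5 / 16 * ε := by
  have hL := Lrho_pos hp hρ.le
  have hD := gap_nonneg hs hρ x
  have hσ := hp.σ_pos
  have hDt := hs.Dt_pos
  have hN1 := one_le_budget hp hs hρ.le hN
  have hm1 : 1 ≤ batchSize p s ρ N := one_le_batchSize hN1
  have hN0 : (0 : ℝ) < N := by exact_mod_cast hN1
  have hm0 : (0 : ℝ) < batchSize p s ρ N := by exact_mod_cast hm1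
  have hb1 := (le_max_left _ _).trans hN
  have hb2 := (le_max_right _ _).trans hN
  have hM : (N : ℝ) / batchSize p s ρ N ≤ innerLimit p s ρ N := Nat.le_ceil _
  set L := Lrho p ρ
  set D := gap p s ρ x
  set S := √(N : ℝ) with hS
  set T := √s.Dt with hT
  have hS0 : 0 < S := Real.sqrt_pos.2 hN0
  have hT0 : 0 < T := Real.sqrt_pos.2 hDt
  have hSS : S ^ 2 = N := Real.sq_sqrt hN0.le
  have hTT : T ^ 2 = s.Dt := Real.sq_sqrt hDt.le
  have hst : p.σ / L * √((N : ℝ) / s.Dt) = p.σ * S / (L * T) := by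
    rw [Real.sqrt_div hN0.le, ← hS, ← hT]; field_simp
  set t := p.σ * S / (L * T) with ht
  have ht0 : 0 < t := by positivity
  -- The term C₁/L² of the budget says σ/(LT) ≤ √N, which is t ≤ N: the cap N in the batch size is
  -- inactive.
  have htN : t ≤ N := by
    have h1 : (p.σ / (L * T)) ^ 2 ≤ S ^ 2 := by
      rw [hSS]; refine le_trans (le_of_eq ?_) hb2
      rw [C1, ← hTT]; field_simp
    have h2 : p.σ / (L * T) ≤ S := (sq_le_sq₀ (by positivity) hS0.le).1 h1
    rw [← hSS, ht]
    calc p.σ * S / (L * T) = p.σ / (L * T) * S := by ring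
      _ ≤ S * S := by gcongr
      _ = S ^ 2 := by ring
  have hmin : min (N : ℝ) (max 1 t) = max 1 t :=
    min_eq_right (max_le (by exact_mod_cast hN1) htN)
  have hmdef : batchSize p s ρ N = ⌈max 1 t⌉₊ := by rw [batchSize, hst, hmin]
  set m : ℝ := (batchSize p s ρ N : ℝ) with hm
  have hmt : t ≤ m := by
    rw [hm, hmdef]; exact (le_max_right _ _).trans (Nat.le_ceil _)
  have hm2 : m ≤ 2 + t := by
    have h1 : m ≤ max 1 t + 1 := by
      rw [hm, hmdef]; exact (Nat.ceil_lt_add_one (by positivity)).le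
    have h2 : max 1 t ≤ 1 + t := max_le (by linarith) (by linarith)
    linarith
  -- With m between t and 2 + t, optimization error and variance are both of order 1/√N, up to the
  -- rounding term 2LD/N.
  have hA : L / innerLimit p s ρ N * D ≤ 2 * L * D / N + p.σ * D / (S * T) := by
    calc L / innerLimit p s ρ N * D ≤ L / (N / m) * D := by gcongr
      _ = L * D / N * m := by field_simp
      _ ≤ L * D / N * (2 + t) := by gcongr
      _ = 2 * L * D / N + p.σ * D / (S * T) := by
        rw [ht, ← hSS]; field_simp
  have hB : p.σ ^ 2 / m ≤ p.σ * L * T / S := by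
    calc p.σ ^ 2 / m ≤ p.σ ^ 2 / t := by gcongr
      _ = p.σ * L * T / S := by rw [ht]; field_simp
  have hC : 128 * L * D / ε ≤ N := le_trans (le_add_of_nonneg_left (by positivity)) hb1
  have hC' : 8 * (L * D / N) ≤ ε / 16 := by
    rw [div_le_iff₀ hε] at hC
    rw [← mul_div_assoc, div_le_iff₀ hN0]; linarith
  have hE : ((4 * D * C2 p s + 4 * L * C3 p s) / ε) ^ 2 ≤ S ^ 2 := by
    rw [hSS, div_pow]; refine le_trans (le_add_of_nonneg_right (by positivity)) hb1
  have hE' : (4 * D * C2 p s + 4 * L * C3 p s) / ε ≤ S := by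
    refine (sq_le_sq₀ ?_ hS0.le).1 hE
    unfold C2 C3; positivity
  -- The constant 5/16 is 1/4 + 1/16: the squared term of the budget pays ε/4, and 128LD/ε pays ε/16
  -- for the rounding.
  have hE2 : 8 * (p.σ * D / (S * T)) + 6 * (p.σ * L * T / S) ≤ ε / 4 := by
    rw [div_le_iff₀ hε] at hE'
    have : 8 * (p.σ * D / (S * T)) + 6 * (p.σ * L * T / S) =
        (D * C2 p s + L * C3 p s) / S := by
      unfold C2 C3; rw [← hT]; field_simp
    rw [this, div_le_iff₀ hS0]; linarith
  have h8 : 0 ≤ p.σ * D / (S * T) := by positivity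
  have h9 : 2 * L * D / N = 2 * (L * D / N) := by ring
  linarith

end Batch

/-! ### Measurable selection and measurable minimizers -/

section Measurability

variable {α : Type*} {mα : MeasurableSpace α}

/-- Take the first index that satisfies the predicate. -/
lemma exists_measurable_select {E : Type*} [MeasurableSpace E] (u : ℕ → E) {r : α → ℕ → Prop}
    (hr : ∀ a, ∃ k, r a k) (hm : ∀ k, MeasurableSet {a | r a k}) :
    ∃ T : α → E, Measurable T ∧ ∀ a, ∃ k, T a = u k ∧ r a k := by
  classical
  refine ⟨fun a => u (Nat.find (hr a)), ?_, fun a => ⟨_, rfl, Nat.find_spec (hr a)⟩⟩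
  exact (measurable_from_nat (f := u)).comp (measurable_find hr hm)

lemma ciInf_denseSeq_eq {E : Type*} [TopologicalSpace E] [TopologicalSpace.SeparableSpace E]
    [Nonempty E] {F : E → ℝ} (hF : Continuous F) {b : ℝ} (hb : ∀ u, b ≤ F u) (u : E) :
    ⨅ k, F (TopologicalSpace.denseSeq E k) ≤ F u := by
  have hbdd : BddBelow (Set.range fun k => F (TopologicalSpace.denseSeq E k)) :=
    ⟨b, by rintro _ ⟨k, rfl⟩; exact hb _⟩
  refine (TopologicalSpace.denseRange_denseSeq E).induction_on u
    (isClosed_le continuous_const hF) fun k => ciInf_le hbdd k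

/-- Quadratic growth turns near-minimizers into near points: a measurable choice from a dense
sequence with value within 1/(j+1) of the infimum lies within distance (κ(j+1))^{-1/2} of T, so T is
a pointwise limit of measurable maps. -/
lemma measurable_sharp_argmin {E : Type*} [NormedAddCommGroup E] [MeasurableSpace E] [BorelSpace E]
    [TopologicalSpace.SeparableSpace E] {F : α → E → ℝ} {T : α → E} {κ : ℝ} (hκ : 0 < κ)
    (hF : ∀ u, Measurable fun a => F a u) (hc : ∀ a, Continuous (F a))
    (hT : ∀ a u, F a (T a) + κ * ‖u - T a‖ ^ 2 ≤ F a u) : Measurable T := by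
  have hmin : ∀ a u, F a (T a) ≤ F a u := fun a u =>
    (le_add_of_nonneg_right (by positivity)).trans (hT a u)
  set v : α → ℝ := fun a => F a (T a)
  have hv : v = fun a => ⨅ k, F a (TopologicalSpace.denseSeq E k) := by
    funext a
    exact le_antisymm (le_ciInf fun k => hmin a _) (ciInf_denseSeq_eq (hc a) (hmin a) _)
  have hvm : Measurable v := by rw [hv]; exact Measurable.iInf fun k => hF _
  have hsel : ∀ j : ℕ, ∃ t : α → E, Measurable t ∧ ∀ a, F a (t a) < v a + 1 / (j + 1) := by
    intro j
    have hj : (0 : ℝ) < 1 / (j + 1) := by positivity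
    obtain ⟨t, ht, h⟩ := exists_measurable_select (α := α) (TopologicalSpace.denseSeq E)
      (r := fun a k => F a (TopologicalSpace.denseSeq E k) < v a + 1 / (j + 1)) (fun a => by
        have ho : IsOpen {u | F a u < v a + 1 / (j + 1)} := isOpen_lt (hc a) continuous_const
        obtain ⟨k, hk⟩ := (TopologicalSpace.denseRange_denseSeq E).exists_mem_open ho
          ⟨T a, lt_add_of_pos_right _ hj⟩
        exact ⟨k, hk⟩)
      (fun k => measurableSet_lt (hF _) (hvm.add_const _))
    refine ⟨t, ht, fun a => ?_⟩
    obtain ⟨k, h1, h2⟩ := h a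
    rw [h1]; exact h2
  choose t ht htv using hsel
  refine measurable_of_tendsto_metrizable ht (tendsto_pi_nhds.2 fun a => ?_)
  rw [tendsto_iff_norm_sub_tendsto_zero]
  have hsq : Filter.Tendsto (fun j : ℕ => ‖t j a - T a‖ ^ 2) Filter.atTop (nhds 0) := by
    have h0 := tendsto_one_div_add_atTop_nhds_zero_nat (𝕜 := ℝ).div_const κ
    rw [zero_div] at h0
    refine squeeze_zero (fun j => by positivity) (fun j => ?_) h0
    rw [le_div_iff₀ hκ]
    have := hT a (t j a)
    have := htv j a
    simp only [v] at this
    linarith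
  have := hsq.sqrt
  simpa using this

lemma measurable_sum_range {E : Type*} [NormedAddCommGroup E] [MeasurableSpace E] [BorelSpace E]
    [SecondCountableTopology E] {m : α → ℕ} (hm : Measurable m) {g : ℕ → α → E}
    (hg : ∀ j, Measurable (g j)) : Measurable fun a => ∑ j ∈ Finset.range (m a), g j a := by
  have h : Measurable fun z : ℕ × α => ∑ j ∈ Finset.range z.1, g j z.2 :=
    measurable_from_prod_countable_right fun k =>
      Finset.measurable_sum (Finset.range k) fun j _ => hg j
  exact h.comp (hm.prodMk measurable_id)

end Measurability

/-! ### Freezing the past, and conditional laws -/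

section Probability

variable {Ω : Type*} {H : MeasurableSpace Ω} [mΩ : MeasurableSpace Ω] {P : Measure Ω}

/-- Independence makes the joint law of past and noise a product, so Tonelli allows the noise to be
integrated with the past held fixed. -/
lemma lintegral_indep_eq [IsProbabilityMeasure P] (hH : H ≤ mΩ)
    {𝒵 𝒮 : Type*} [MeasurableSpace 𝒵] [MeasurableSpace 𝒮] {Z : Ω → 𝒵} {S : Ω → 𝒮}
    (hZ : Measurable[H] Z) (hS : Measurable S)
    (hind : Indep (MeasurableSpace.comap S inferInstance) H P)
    {F : 𝒵 × 𝒮 → ENNReal} (hF : Measurable F) :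
    ∫⁻ ω, F (Z ω, S ω) ∂P = ∫⁻ ω, ∫⁻ ω', F (Z ω, S ω') ∂P ∂P := by
  have hZ' : Measurable Z := hZ.mono hH le_rfl
  have hi : IndepFun Z S P := (indep_of_indep_of_le_right hind hZ.comap_le).symm
  have h1 := (indepFun_iff_map_prod_eq_prod_map_map hZ'.aemeasurable hS.aemeasurable).1 hi
  have : IsProbabilityMeasure (P.map S) := Measure.isProbabilityMeasure_map hS.aemeasurable
  rw [← lintegral_map hF (hZ'.prodMk hS), h1, lintegral_prod _ hF.aemeasurable,
    lintegral_map hF.lintegral_prod_right' hZ']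
  refine lintegral_congr fun ω => ?_
  exact lintegral_map (hF.comp measurable_prodMk_left) hS

lemma integral_indep_eq [IsProbabilityMeasure P] (hH : H ≤ mΩ)
    {𝒵 𝒮 : Type*} [MeasurableSpace 𝒵] [MeasurableSpace 𝒮] {Z : Ω → 𝒵} {S : Ω → 𝒮}
    (hZ : Measurable[H] Z) (hS : Measurable S)
    (hind : Indep (MeasurableSpace.comap S inferInstance) H P)
    {F : 𝒵 × 𝒮 → ℝ} (hF : Measurable F) (hi : Integrable (fun ω => F (Z ω, S ω)) P) :
    ∫ ω, F (Z ω, S ω) ∂P = ∫ ω, ∫ ω', F (Z ω, S ω') ∂P ∂P := by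
  have hZ' : Measurable Z := hZ.mono hH le_rfl
  have hind' : IndepFun Z S P := (indep_of_indep_of_le_right hind hZ.comap_le).symm
  have h1 := (indepFun_iff_map_prod_eq_prod_map_map hZ'.aemeasurable hS.aemeasurable).1 hind'
  have : IsProbabilityMeasure (P.map S) := Measure.isProbabilityMeasure_map hS.aemeasurable
  have : IsProbabilityMeasure (P.map Z) := Measure.isProbabilityMeasure_map hZ'.aemeasurable
  have hi' : Integrable F ((P.map Z).prod (P.map S)) := by
    rw [← h1]
    exact (integrable_map_measure hF.aestronglyMeasurable (hZ'.prodMk hS).aemeasurable).2 hi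
  rw [← integral_map (φ := fun ω => (Z ω, S ω)) (hZ'.prodMk hS).aemeasurable
    hF.aestronglyMeasurable, h1, integral_prod _ hi',
    integral_map hZ'.aemeasurable hF.stronglyMeasurable.integral_prod_right'.aestronglyMeasurable]
  refine integral_congr_ae (Filter.Eventually.of_forall fun ω => ?_)
  exact integral_map hS.aemeasurable (hF.comp measurable_prodMk_left).aestronglyMeasurable

/-- If the conditional probability of `B` is `w`, then `w` is the density of `P` restricted
to `B`. -/
lemma setLIntegral_eq_of_condExp [IsProbabilityMeasure P] (hH : H ≤ mΩ)
    {B : Set Ω} (hB : MeasurableSet B) {w : Ω → ℝ} (hw0 : ∀ ω, 0 ≤ w ω)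
    (hw : P[B.indicator (fun _ => (1 : ℝ)) | H] =ᵐ[P] w) {F : Ω → ENNReal}
    (hF : Measurable[H] F) :
    ∫⁻ ω in B, F ω ∂P = ∫⁻ ω, ENNReal.ofReal (w ω) * F ω ∂P := by
  have hwi : Integrable w P := integrable_condExp.congr hw
  have hwm : AEMeasurable (fun ω => ENNReal.ofReal (w ω)) P := hwi.aemeasurable.ennreal_ofReal
  have hBi : Integrable (B.indicator (fun _ => (1 : ℝ))) P :=
    (integrable_const 1).indicator hB
  -- The defining property of conditional expectation identifies the two measures on `H` only; that
  -- suffices because `F` is `H`-measurable.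
  have hEq : (P.restrict B).trim hH = (P.withDensity fun ω => ENNReal.ofReal (w ω)).trim hH := by
    refine @Measure.ext _ H _ _ fun A hA => ?_
    have hA' : MeasurableSet A := hH _ hA
    rw [trim_measurableSet_eq hH hA, trim_measurableSet_eq hH hA, withDensity_apply _ hA',
      Measure.restrict_apply hA',
      ← ofReal_integral_eq_lintegral_ofReal hwi.integrableOn (Filter.Eventually.of_forall hw0),
      ← setIntegral_congr_ae hA' (hw.mono fun _ h _ => h), setIntegral_condExp hH hBi hA,
      setIntegral_indicator hB]
    simp [Measure.real]
  rw [← lintegral_trim hH hF, hEq, lintegral_trim hH hF,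
    lintegral_withDensity_eq_lintegral_mul₀ hwm (hF.mono hH le_rfl).aemeasurable]
  rfl

/-- The second moment of a sum of independent centered vectors. -/
lemma integral_norm_sum_sq_le [IsProbabilityMeasure P] {n : ℕ} {X : ℕ → Ω → Euc n} {v : ℝ}
    (hi : ∀ j, Integrable (X j) P) (h0 : ∀ j, ∫ ω, X j ω ∂P = 0)
    (hsq : ∀ j, Integrable (fun ω => ‖X j ω‖ ^ 2) P) (hv : ∀ j, ∫ ω, ‖X j ω‖ ^ 2 ∂P ≤ v)
    (hind : ∀ i j, i ≠ j → IndepFun (X i) (X j) P) (m : ℕ) :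
    Integrable (fun ω => ‖∑ j ∈ Finset.range m, X j ω‖ ^ 2) P ∧
      ∫ ω, ‖∑ j ∈ Finset.range m, X j ω‖ ^ 2 ∂P ≤ m * v := by
  have hin : ∀ i j, i ≠ j → Integrable (fun ω => inner ℝ (X i ω) (X j ω)) P ∧
      ∫ ω, inner ℝ (X i ω) (X j ω) ∂P = 0 := fun i j hij => by
    refine ⟨(hind i j hij).integrable_bilin (hi i) (hi j) (innerSL ℝ), ?_⟩
    have := (hind i j hij).integral_bilin (hi i) (hi j) (innerSL ℝ)
    rw [h0 i, map_zero] at this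
    exact this
  induction m with
  | zero => simp
  | succ m ih =>
    have e : ∀ ω, ‖∑ j ∈ Finset.range (m + 1), X j ω‖ ^ 2 =
        ‖∑ j ∈ Finset.range m, X j ω‖ ^ 2 +
          2 * ∑ j ∈ Finset.range m, inner ℝ (X j ω) (X m ω) + ‖X m ω‖ ^ 2 := fun ω => by
      rw [Finset.sum_range_succ, norm_add_sq_real, sum_inner]
    have hne : ∀ j ∈ Finset.range m, j ≠ m := fun j hj => (Finset.mem_range.1 hj).ne
    have hcross : Integrable (fun ω => 2 * ∑ j ∈ Finset.range m, inner ℝ (X j ω) (X m ω)) P :=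
      (integrable_finsetSum _ fun j hj => (hin j m (hne j hj)).1).const_mul 2
    simp_rw [e]
    refine ⟨(ih.1.add hcross).add (hsq m), ?_⟩
    have h1 := integral_add (ih.1.add hcross) (hsq m)
    simp only [Pi.add_apply] at h1
    rw [h1, integral_add ih.1 hcross, integral_const_mul,
      integral_finsetSum _ fun j hj => (hin j m (hne j hj)).1,
      Finset.sum_eq_zero fun j hj => (hin j m (hne j hj)).2]
    push_cast
    linarith [ih.2, hv m]

end Probability

lemma norm_mul_norm_le_sq_add_sq {E : Type*} [SeminormedAddCommGroup E] (a b : E) :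
    ‖a‖ * ‖b‖ ≤ ‖a‖ ^ 2 + ‖b‖ ^ 2 := by
  nlinarith [sq_nonneg (‖a‖ - ‖b‖), sq_nonneg ‖a‖, sq_nonneg ‖b‖]

lemma comap_sequence_le {Ω Ξ : Type*} [MeasurableSpace Ξ] (S : ℕ → Ω → Ξ) :
    MeasurableSpace.comap (fun ω j => S j ω) inferInstance ≤
      ⨆ j, MeasurableSpace.comap (S j) inferInstance := by
  let _ : MeasurableSpace Ω := ⨆ j, MeasurableSpace.comap (S j) inferInstance
  have h : Measurable fun ω j => S j ω := measurable_pi_iff.2 fun j =>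
    (comap_measurable (S j)).mono
      (le_iSup (fun j => MeasurableSpace.comap (S j) inferInstance) j) le_rfl
  exact h.comap_le

/-! ### Moments of the mini-batch error -/

section Oracle

variable {n q : ℕ} {Ξ : Type*} [MeasurableSpace Ξ] {p : Problem n q Ξ}

lemma continuous_gradient_of_assumptions (hp : p.Assumptions) : Continuous (gradient p.f) :=
  (InnerProductSpace.toDual ℝ (Euc n)).symm.continuous.comp
    (hp.f_contDiff.continuous_fderiv one_ne_zero)

/-- The error of the mini-batch gradient at `y` that is computed from the seeds `S 0, …, S (m-1)`. -/
noncomputable def noise (p : Problem n q Ξ) (y : Euc n) (m : ℕ) (S : ℕ → Ξ) : Euc n :=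
  (1 / (m : ℝ)) • ∑ j ∈ Finset.range m, p.G y (S j) - gradient p.f y

lemma noise_eq (y : Euc n) {m : ℕ} (hm : 1 ≤ m) (S : ℕ → Ξ) :
    noise p y m S = (1 / (m : ℝ)) • ∑ j ∈ Finset.range m, (p.G y (S j) - gradient p.f y) := by
  have : (m : ℝ) ≠ 0 := by positivity
  rw [noise, Finset.sum_sub_distrib, smul_sub, Finset.sum_const, Finset.card_range,
    ← Nat.cast_smul_eq_nsmul ℝ, smul_smul, one_div, inv_mul_cancel₀ this, one_smul]

lemma measurable_noise (hp : p.Assumptions) :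
    Measurable fun z : (Euc n × ℕ) × (ℕ → Ξ) => noise p z.1.1 z.1.2 z.2 := by
  have h1 : Measurable fun z : (Euc n × ℕ) × (ℕ → Ξ) => z.1.2 := by fun_prop
  have h2 : Measurable fun z : (Euc n × ℕ) × (ℕ → Ξ) => (1 / (z.1.2 : ℝ)) := by fun_prop
  have h3 : ∀ j, Measurable fun z : (Euc n × ℕ) × (ℕ → Ξ) => p.G z.1.1 (z.2 j) := fun j =>
    hp.G_measurable.comp (f := fun z : (Euc n × ℕ) × (ℕ → Ξ) => (z.1.1, z.2 j)) (by fun_prop)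
  have h4 : Measurable fun z : (Euc n × ℕ) × (ℕ → Ξ) => gradient p.f z.1.1 :=
    (continuous_gradient_of_assumptions hp).measurable.comp (by fun_prop)
  exact (h2.smul (measurable_sum_range h1 h3)).sub h4

variable {Ω : Type*} {H : MeasurableSpace Ω} [mΩ : MeasurableSpace Ω] {P : Measure Ω}
  {S : ℕ → Ω → Ξ}

lemma integrable_oracle (hp : p.Assumptions) {T : Ω → Ξ} (hT : Measurable T)
    (hlaw : P.map T = p.law) (y : Euc n) :
    Integrable (fun ω => p.G y (T ω) - gradient p.f y) P ∧
      ∫ ω, (p.G y (T ω) - gradient p.f y) ∂P = 0 ∧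
      Integrable (fun ω => ‖p.G y (T ω) - gradient p.f y‖ ^ 2) P ∧
      ∫ ω, ‖p.G y (T ω) - gradient p.f y‖ ^ 2 ∂P ≤ p.σ ^ 2 := by
  have := hp.law_prob
  have hG : Measurable (p.G y) := hp.G_measurable.comp measurable_prodMk_left
  have h1 : Integrable (fun ξ => p.G y ξ - gradient p.f y) p.law :=
    (hp.G_integrable y).sub (integrable_const _)
  have h2 : ∫ ξ, (p.G y ξ - gradient p.f y) ∂p.law = 0 := by
    rw [integral_sub (hp.G_integrable y) (integrable_const _), hp.G_unbiased y]; simp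
  have h3 := hp.G_sq_integrable y
  have h4 := hp.G_variance y
  rw [← hlaw] at h1 h2 h3 h4
  have m1 : Measurable fun ξ => p.G y ξ - gradient p.f y := hG.sub_const _
  have m2 : Measurable fun ξ => ‖p.G y ξ - gradient p.f y‖ ^ 2 := m1.norm.pow_const 2
  refine ⟨h1.comp_measurable hT, ?_, h3.comp_measurable hT, ?_⟩
  · rwa [integral_map hT.aemeasurable m1.aestronglyMeasurable] at h2
  · rwa [integral_map hT.aemeasurable m2.aestronglyMeasurable] at h4

lemma noise_moments [IsProbabilityMeasure P] (hp : p.Assumptions) (hS : ∀ j, Measurable (S j))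
    (hlaw : ∀ j, P.map (S j) = p.law) (hind : iIndepFun S P) (y : Euc n) {m : ℕ} (hm : 1 ≤ m) :
    Integrable (fun ω => noise p y m fun j => S j ω) P ∧
      ∫ ω, noise p y m (fun j => S j ω) ∂P = 0 ∧
      Integrable (fun ω => ‖noise p y m fun j => S j ω‖ ^ 2) P ∧
      ∫ ω, ‖noise p y m fun j => S j ω‖ ^ 2 ∂P ≤ p.σ ^ 2 / m := by
  have hm0 : (0 : ℝ) < m := by exact_mod_cast hm
  have ho := fun j => integrable_oracle hp (hS j) (hlaw j) y
  have hG : Measurable fun ξ => p.G y ξ - gradient p.f y :=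
    (hp.G_measurable.comp measurable_prodMk_left).sub_const _
  have hs := integral_norm_sum_sq_le (P := P)
    (X := fun j ω => p.G y (S j ω) - gradient p.f y) (fun j => (ho j).1) (fun j => (ho j).2.1)
    (fun j => (ho j).2.2.1) (fun j => (ho j).2.2.2)
    (fun i j hij => (hind.indepFun hij).comp hG hG) m
  simp only [noise_eq y hm, norm_smul, mul_pow]
  refine ⟨(integrable_finsetSum _ fun j _ => (ho j).1).fun_smul _, ?_, hs.1.const_mul _, ?_⟩
  · rw [integral_smul, integral_finsetSum _ fun j _ => (ho j).1,
      Finset.sum_eq_zero fun j _ => (ho j).2.1, smul_zero]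
  · rw [integral_const_mul, Real.norm_of_nonneg (by positivity)]
    calc (1 / (m : ℝ)) ^ 2 * _ ≤ (1 / (m : ℝ)) ^ 2 * (m * p.σ ^ 2) := by gcongr; exact hs.2
      _ = p.σ ^ 2 / m := by field_simp

/-- The second moment of the mini-batch error, with a weight that depends only on the past. -/
lemma integral_weight_noise_sq [IsProbabilityMeasure P] (hp : p.Assumptions) (hH : H ≤ mΩ) (hS : ∀ j, Measurable (S j))
    (hlaw : ∀ j, P.map (S j) = p.law) (hind : iIndepFun S P)
    (hpast : Indep (⨆ j, MeasurableSpace.comap (S j) inferInstance) H P)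
    {Y : Ω → Euc n} (hY : Measurable[H] Y) {m : Ω → ℕ} (hm : Measurable[H] m)
    (hm1 : ∀ ω, 1 ≤ m ω) {w : Ω → ℝ} (hw : Measurable[H] w) (hw0 : ∀ ω, 0 ≤ w ω)
    (hw1 : ∀ ω, w ω ≤ 1) :
    Integrable (fun ω => w ω * ‖noise p (Y ω) (m ω) fun j => S j ω‖ ^ 2) P ∧
      ∫ ω, w ω * ‖noise p (Y ω) (m ω) fun j => S j ω‖ ^ 2 ∂P ≤
        ∫ ω, w ω * (p.σ ^ 2 / m ω) ∂P := by
  have hSm : Measurable fun ω j => S j ω := measurable_pi_iff.2 hS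
  have hcomap := comap_sequence_le S
  have hN := measurable_noise hp
  have hNs : Measurable fun z : ((Euc n × ℕ) × ℝ) × (ℕ → Ξ) =>
      z.1.2 * ‖noise p z.1.1.1 z.1.1.2 z.2‖ ^ 2 :=
    (by fun_prop : Measurable fun z : ((Euc n × ℕ) × ℝ) × (ℕ → Ξ) => z.1.2).mul
      ((hN.comp (g := fun z : (Euc n × ℕ) × (ℕ → Ξ) => noise p z.1.1 z.1.2 z.2)
        (f := fun z : ((Euc n × ℕ) × ℝ) × (ℕ → Ξ) => (z.1.1, z.2))
        (by fun_prop)).norm.pow_const 2)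
  have hZ : Measurable[H] fun ω => ((Y ω, m ω), w ω) := (hY.prodMk hm).prodMk hw
  have hlin := lintegral_indep_eq hH hZ hSm (indep_of_indep_of_le_left hpast hcomap)
    hNs.ennreal_ofReal
  have hmeas : Measurable fun ω => w ω * ‖noise p (Y ω) (m ω) fun j => S j ω‖ ^ 2 :=
    hNs.comp ((hZ.mono hH le_rfl).prodMk hSm)
  have hbm : Measurable fun ω => w ω * (p.σ ^ 2 / m ω) := by
    have h1 : Measurable w := hw.mono hH le_rfl
    have h2 : Measurable m := hm.mono hH le_rfl
    fun_prop
  have hb0 : ∀ ω, 0 ≤ w ω * (p.σ ^ 2 / m ω) := fun ω => mul_nonneg (hw0 ω) (by positivity)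
  have hbi : Integrable (fun ω => w ω * (p.σ ^ 2 / m ω)) P := by
    refine Integrable.of_bound hbm.aestronglyMeasurable (p.σ ^ 2)
      (Filter.Eventually.of_forall fun ω => ?_)
    rw [Real.norm_of_nonneg (hb0 ω)]
    have h1 : p.σ ^ 2 / m ω ≤ p.σ ^ 2 :=
      div_le_self (sq_nonneg _) (by exact_mod_cast hm1 ω)
    calc _ ≤ 1 * p.σ ^ 2 := mul_le_mul (hw1 ω) h1 (by positivity) zero_le_one
      _ = p.σ ^ 2 := one_mul _
  -- Integrability is not known yet, so the computation is first done with the Lebesgue integral of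
  -- nonnegative functions; finiteness of the bound then yields it.
  have hle : ∫⁻ ω, ENNReal.ofReal (w ω * ‖noise p (Y ω) (m ω) fun j => S j ω‖ ^ 2) ∂P ≤
      ENNReal.ofReal (∫ ω, w ω * (p.σ ^ 2 / m ω) ∂P) := by
    rw [ofReal_integral_eq_lintegral_ofReal hbi (Filter.Eventually.of_forall hb0)]
    refine hlin.le.trans (lintegral_mono fun ω => ?_)
    have hn := noise_moments hp hS hlaw hind (Y ω) (hm1 ω)
    have h1 := ofReal_integral_eq_lintegral_ofReal (hn.2.2.1.const_mul (w ω))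
      (Filter.Eventually.of_forall fun ω' => mul_nonneg (hw0 ω) (by positivity))
    rw [← h1, integral_const_mul]
    exact ENNReal.ofReal_le_ofReal (mul_le_mul_of_nonneg_left hn.2.2.2 (hw0 ω))
  have hnn : ∀ ω, 0 ≤ w ω * ‖noise p (Y ω) (m ω) fun j => S j ω‖ ^ 2 := fun ω =>
    mul_nonneg (hw0 ω) (by positivity)
  have hint : Integrable (fun ω => w ω * ‖noise p (Y ω) (m ω) fun j => S j ω‖ ^ 2) P := by
    refine ⟨hmeas.aestronglyMeasurable, ?_⟩
    rw [hasFiniteIntegral_iff_ofReal (Filter.Eventually.of_forall hnn)]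
    exact hle.trans_lt ENNReal.ofReal_lt_top
  refine ⟨hint, ?_⟩
  rw [← ofReal_integral_eq_lintegral_ofReal hint (Filter.Eventually.of_forall hnn)] at hle
  exact (ENNReal.ofReal_le_ofReal_iff (integral_nonneg hb0)).1 hle

/-- The mini-batch error is orthogonal to every vector that depends only on the past. -/
lemma integral_inner_noise [IsProbabilityMeasure P] (hp : p.Assumptions) (hH : H ≤ mΩ) (hS : ∀ j, Measurable (S j))
    (hlaw : ∀ j, P.map (S j) = p.law) (hind : iIndepFun S P)
    (hpast : Indep (⨆ j, MeasurableSpace.comap (S j) inferInstance) H P)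
    {Y : Ω → Euc n} (hY : Measurable[H] Y) {m : Ω → ℕ} (hm : Measurable[H] m)
    (hm1 : ∀ ω, 1 ≤ m ω) {v : Ω → Euc n} (hv : Measurable[H] v)
    (hvi : Integrable (fun ω => ‖v ω‖ ^ 2) P) :
    Integrable (fun ω => inner ℝ (noise p (Y ω) (m ω) fun j => S j ω) (v ω)) P ∧
      ∫ ω, inner ℝ (noise p (Y ω) (m ω) fun j => S j ω) (v ω) ∂P = 0 := by
  have hSm : Measurable fun ω j => S j ω := measurable_pi_iff.2 hS
  have hcomap := comap_sequence_le S
  have hN := measurable_noise hp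
  have hNs : Measurable fun z : ((Euc n × ℕ) × Euc n) × (ℕ → Ξ) =>
      inner ℝ (noise p z.1.1.1 z.1.1.2 z.2) z.1.2 :=
    (hN.comp (g := fun z : (Euc n × ℕ) × (ℕ → Ξ) => noise p z.1.1 z.1.2 z.2)
        (f := fun z : ((Euc n × ℕ) × Euc n) × (ℕ → Ξ) => (z.1.1, z.2)) (by fun_prop)).inner
      (by fun_prop : Measurable fun z : ((Euc n × ℕ) × Euc n) × (ℕ → Ξ) => z.1.2)
  have hZ : Measurable[H] fun ω => ((Y ω, m ω), v ω) := (hY.prodMk hm).prodMk hv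
  have hmeas : Measurable fun ω => inner ℝ (noise p (Y ω) (m ω) fun j => S j ω) (v ω) :=
    ((hN.comp ((hY.prodMk hm).mono hH le_rfl |>.prodMk hSm)).inner (hv.mono hH le_rfl))
  have hsq := (integral_weight_noise_sq hp hH hS hlaw hind hpast hY hm hm1
    (w := fun _ => 1) measurable_const (fun _ => zero_le_one) (fun _ => le_rfl)).1
  simp only [one_mul] at hsq
  have hint : Integrable (fun ω => inner ℝ (noise p (Y ω) (m ω) fun j => S j ω) (v ω)) P := by
    refine (hsq.add hvi).mono' hmeas.aestronglyMeasurable (Filter.Eventually.of_forall fun ω => ?_)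
    refine (norm_inner_le_norm _ _).trans ?_
    simp only [Pi.add_apply]
    exact norm_mul_norm_le_sq_add_sq _ _
  refine ⟨hint, ?_⟩
  have heq := integral_indep_eq hH hZ hSm (indep_of_indep_of_le_left hpast hcomap) hNs hint
  refine heq.trans ?_
  refine integral_eq_zero_of_ae (Filter.Eventually.of_forall fun ω => ?_)
  have hn := noise_moments hp hS hlaw hind (Y ω) (hm1 ω)
  simp only [Pi.zero_apply]
  simp_rw [real_inner_comm (v ω)]
  rw [integral_inner hn.1, hn.2.1, inner_zero_right]

end Oracle

/-! ### The generalized gradient and the descent inequality -/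

section ProxGradient

variable {n q : ℕ} {Ξ : Type*} [MeasurableSpace Ξ] {p : Problem n q Ξ}

/-- The minimizer of the step model at `x` with gradient `g`. -/
noncomputable def proxStep (p : Problem n q Ξ) (ρ : ℝ) (x g : Euc n) : Euc n :=
  Classical.epsilon fun d => ∀ w,
    stepModel g ρ (Lrho p ρ) (p.c x) (fderiv ℝ p.c x) d ≤
      stepModel g ρ (Lrho p ρ) (p.c x) (fderiv ℝ p.c x) w

lemma proxStep_min (hp : p.Assumptions) {ρ : ℝ} (hρ : 0 ≤ ρ) (x g w : Euc n) :
    stepModel g ρ (Lrho p ρ) (p.c x) (fderiv ℝ p.c x) (proxStep p ρ x g) ≤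
      stepModel g ρ (Lrho p ρ) (p.c x) (fderiv ℝ p.c x) w :=
  Classical.epsilon_spec
    (exists_stepModel_min g (p.c x) (fderiv ℝ p.c x) hρ (Lrho_pos hp hρ)) w

/-- The generalized gradient of the penalty function. -/
noncomputable def proxGrad (p : Problem n q Ξ) (ρ : ℝ) (x : Euc n) : Euc n :=
  -(Lrho p ρ • proxStep p ρ x (gradient p.f x))

lemma norm_proxGrad (hp : p.Assumptions) {ρ : ℝ} (hρ : 0 ≤ ρ) (x : Euc n) :
    ‖proxGrad p ρ x‖ = Lrho p ρ * ‖proxStep p ρ x (gradient p.f x)‖ := by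
  rw [proxGrad, norm_neg, norm_smul, Real.norm_of_nonneg (Lrho_pos hp hρ).le]

lemma exists_multiplier_proxGrad (hp : p.Assumptions) {ρ : ℝ} (hρ : 0 ≤ ρ) (x : Euc n) :
    ∃ lam : Euc q, gradient p.f x + (fderiv ℝ p.c x).adjoint lam = proxGrad p ρ x :=
  exists_multiplier (proxStep_min hp hρ x (gradient p.f x))

/-- The growth constant L_ρ/2 varies with ρ but never falls below L_g/2, which gives one κ for
`measurable_sharp_argmin`. -/
lemma measurable_proxGrad (hp : p.Assumptions) {α : Type*} {mα : MeasurableSpace α} {ρ : α → ℝ}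
    {x : α → Euc n} (hρ : Measurable ρ) (hρ0 : ∀ a, 0 ≤ ρ a) (hx : Measurable x) :
    Measurable fun a => proxGrad p (ρ a) (x a) := by
  have hL : Measurable fun a => Lrho p (ρ a) := by unfold Lrho; fun_prop
  have hg : Measurable fun a => gradient p.f (x a) :=
    (continuous_gradient_of_assumptions hp).measurable.comp hx
  have hc : Measurable fun a => p.c (x a) := hp.c_contDiff.continuous.measurable.comp hx
  have hJ : ∀ u, Measurable fun a => fderiv ℝ p.c (x a) u := fun u =>
    ((hp.c_contDiff.continuous_fderiv one_ne_zero).clm_apply continuous_const).measurable.comp hx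
  have hstep : Measurable fun a => proxStep p (ρ a) (x a) (gradient p.f (x a)) := by
    refine measurable_sharp_argmin (κ := p.Lg / 2)
      (F := fun a => stepModel (gradient p.f (x a)) (ρ a) (Lrho p (ρ a)) (p.c (x a))
        (fderiv ℝ p.c (x a))) (half_pos hp.Lg_pos) (fun u => ?_)
      (fun a => continuous_stepModel _ _ _ _ _) (fun a u => ?_)
    · unfold stepModel
      exact ((hg.inner measurable_const).add (hρ.mul (hc.add (hJ u)).norm)).add
        ((hL.div_const 2).mul_const _)
    · have h := stepModel_growth (hρ0 a) (proxStep_min hp (hρ0 a) (x a) (gradient p.f (x a))) u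
      have : p.Lg ≤ Lrho p (ρ a) :=
        le_add_of_nonneg_right (mul_nonneg (hρ0 a) hp.LJ_pos.le)
      refine le_trans ?_ h
      gcongr
  exact (hL.smul hstep).neg

/-- One step of the stochastic approximation algorithm decreases the penalty function. -/
lemma penalty_descent (hp : p.Assumptions) {ρ : ℝ} (hρ : 0 ≤ ρ) (x g d : Euc n)
    (hd : ∀ w, stepModel g ρ (Lrho p ρ) (p.c x) (fderiv ℝ p.c x) d ≤
      stepModel g ρ (Lrho p ρ) (p.c x) (fderiv ℝ p.c x) w) :
    Lrho p ρ * penalty p.f p.c ρ (x + d) + ‖proxGrad p ρ x‖ ^ 2 / 4 ≤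
      Lrho p ρ * penalty p.f p.c ρ x + inner ℝ (g - gradient p.f x) (proxGrad p ρ x) +
        3 / 2 * ‖g - gradient p.f x‖ ^ 2 := by
  have hL := Lrho_pos hp hρ
  set δ := g - gradient p.f x with hδ
  set e := proxStep p ρ x (gradient p.f x) with he
  have hf1 : Differentiable ℝ p.f := hp.f_contDiff.differentiable one_ne_zero
  have hc1 : Differentiable ℝ p.c := hp.c_contDiff.differentiable one_ne_zero
  have tf := norm_taylor_one_le hf1 (L := p.Lg) (fun x y => by
    have := hp.grad_lipschitz x y
    rwa [gradient, gradient, ← map_sub, LinearIsometryEquiv.norm_map] at this) x d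
  have tc := norm_taylor_one_le hc1 hp.jac_lipschitz x d
  have hin : fderiv ℝ p.f x d = inner ℝ (gradient p.f x) d := by
    rw [gradient, InnerProductSpace.toDual_symm_apply]
  rw [hin] at tf
  have tf' := (abs_le.1 (Real.norm_eq_abs _ ▸ tf)).2
  have tc' : ‖p.c (x + d)‖ ≤ ‖p.c x + fderiv ℝ p.c x d‖ + p.LJ / 2 * ‖d‖ ^ 2 := by
    have h1 : p.c (x + d) = (p.c x + fderiv ℝ p.c x d) +
      (p.c (x + d) - p.c x - fderiv ℝ p.c x d) := by abel
    rw [h1]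
    exact (norm_add_le _ _).trans (by gcongr)
  have hg := stepModel_growth hρ hd 0
  rw [stepModel_zero, zero_sub, norm_neg, stepModel] at hg
  have hgd : inner ℝ g d = inner ℝ (gradient p.f x) d + inner ℝ δ d := by
    rw [hδ, inner_sub_left]; ring
  -- Growth at w = 0 yields a decrease L_ρ‖d‖² of the linearized function; the Taylor errors of f
  -- and ρc use up half of it.
  have h1 : penalty p.f p.c ρ (x + d) ≤
      penalty p.f p.c ρ x - Lrho p ρ / 2 * ‖d‖ ^ 2 - inner ℝ δ d := by
    have := mul_le_mul_of_nonneg_left tc' hρ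
    have hLe : Lrho p ρ / 2 * ‖d‖ ^ 2 = p.Lg / 2 * ‖d‖ ^ 2 + ρ * (p.LJ / 2 * ‖d‖ ^ 2) := by
      unfold Lrho; ring
    unfold penalty
    linarith
  -- The noisy step d is replaced by the exact step e, which is independent of the noise. This costs
  -- ‖δ‖² in the inner product and ‖δ‖²/2 in the quadratic term, hence 3/2.
  have h2 : Lrho p ρ * ‖d - e‖ ≤ ‖δ‖ :=
    stepModel_min_nonexpansive hρ hd (proxStep_min hp hρ x (gradient p.f x))
  have h3 : inner ℝ δ (proxGrad p ρ x) = -(Lrho p ρ * inner ℝ δ e) := by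
    rw [proxGrad, inner_neg_right, inner_smul_right]
  have h4 : -inner ℝ δ d ≤ -inner ℝ δ e + ‖δ‖ * ‖d - e‖ := by
    have := neg_le_of_abs_le (abs_real_inner_le_norm δ (d - e))
    rw [inner_sub_right] at this
    linarith
  have h5 : ‖e‖ ^ 2 ≤ 2 * ‖d‖ ^ 2 + 2 * ‖d - e‖ ^ 2 := by
    have := parallelogram_law_with_norm ℝ d (d - e)
    rw [sub_sub_cancel] at this
    nlinarith [sq_nonneg ‖d + (d - e)‖]
  rw [h3, norm_proxGrad hp hρ, ← he]
  set L := Lrho p ρ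
  have h6 : (L * ‖d - e‖) ^ 2 ≤ ‖δ‖ ^ 2 := by gcongr
  have h7 : ‖δ‖ * (L * ‖d - e‖) ≤ ‖δ‖ ^ 2 := by nlinarith [norm_nonneg δ]
  have h8 := mul_le_mul_of_nonneg_left h1 hL.le
  have h9 := mul_le_mul_of_nonneg_left h4 hL.le
  have h10 := mul_le_mul_of_nonneg_left h5 (sq_nonneg L)
  nlinarith

/-- The infimum of the penalty function, over a countable dense set. -/
noncomputable def penaltyInf (p : Problem n q Ξ) (ρ : ℝ) : ℝ :=
  ⨅ k, penalty p.f p.c ρ (TopologicalSpace.denseSeq (Euc n) k)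

/-- The given bound `s.Φlow` need not be measurable in ρ, and ρ is random. This infimum is, and it
lies above `s.Φlow`, so it can replace it in the merit function. -/
lemma measurable_penaltyInf : Measurable (penaltyInf p) := by
  refine Measurable.iInf fun k => ?_
  unfold penalty; fun_prop

lemma penaltyInf_le (hp : p.Assumptions) {ρ : ℝ} (hρ : 0 ≤ ρ) (x : Euc n) :
    penaltyInf p ρ ≤ penalty p.f p.c ρ x :=
  ciInf_denseSeq_eq (F := penalty p.f p.c ρ)
    (hp.f_contDiff.continuous.add (continuous_const.mul hp.c_contDiff.continuous.norm))
    (b := p.flow) (fun u => (hp.flow_le u).trans (le_add_of_nonneg_right (by positivity))) x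

lemma le_penaltyInf {s : Settings n} (hs : s.Valid p) {ρ : ℝ} (hρ : 0 < ρ) :
    s.Φlow ρ ≤ penaltyInf p ρ :=
  le_ciInf fun _ => hs.Φlow_le ρ hρ _

end ProxGradient

/-! ### The inner iteration: weighted descent and telescoping -/

section InnerRun

variable {n q : ℕ} {Ξ : Type*} [MeasurableSpace Ξ] {p : Problem n q Ξ} {s : Settings n}

lemma measurable_batchSize {α : Type*} {mα : MeasurableSpace α} {ρ : α → ℝ} {m : α → ℕ}
    (hρ : Measurable ρ) (hm : Measurable m) : Measurable fun a => batchSize p s (ρ a) (m a) := by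
  unfold batchSize Lrho
  exact Nat.measurable_ceil.comp (by fun_prop)

lemma measurable_innerLimit {α : Type*} {mα : MeasurableSpace α} {ρ : α → ℝ} {m : α → ℕ}
    (hρ : Measurable ρ) (hm : Measurable m) : Measurable fun a => innerLimit p s (ρ a) (m a) := by
  have := measurable_batchSize (p := p) (s := s) hρ hm
  unfold innerLimit
  exact Nat.measurable_ceil.comp (by fun_prop)

lemma measurable_scaled_gap (hp : p.Assumptions) {α : Type*} {mα : MeasurableSpace α} {ρ : α → ℝ}
    {x : α → Euc n} (hρ : Measurable ρ) (hx : Measurable x) :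
    Measurable fun a => Lrho p (ρ a) * (penalty p.f p.c (ρ a) (x a) - penaltyInf p (ρ a)) := by
  have h1 : Measurable fun a => Lrho p (ρ a) := by unfold Lrho; fun_prop
  have hf : Measurable p.f := hp.f_contDiff.continuous.measurable
  have hc : Measurable p.c := hp.c_contDiff.continuous.measurable
  exact h1.mul (((hf.comp hx).add (hρ.mul (hc.comp hx).norm)).sub
    (measurable_penaltyInf.comp hρ))

variable {ε : ℝ} {N : ℕ} {Ω : Type*} [mΩ : MeasurableSpace Ω] {P : Measure Ω}

namespace Run

lemma le_rho (r : Run p s ε N P) (ω : Ω) : ∀ k, k < N → s.ρ₀ + k * s.τ ≤ r.ρ k ω := by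
  intro k
  induction k with
  | zero => intro _; simp [r.ρ_zero ω]
  | succ k ih =>
    intro hk
    have h1 := r.ρ_increase (k + 1) (by omega) hk ω
    have h2 := ih (by omega)
    rw [Nat.add_sub_cancel] at h1
    push_cast
    linarith

lemma one_le_rho (r : Run p s ε N P) (hs : s.Valid p) {k : ℕ} (hk : k < N) (ω : Ω) :
    1 ≤ r.ρ k ω := by
  have h1 := r.le_rho ω k hk
  have := hs.ρ₀_ge
  have : (0 : ℝ) ≤ k * s.τ := mul_nonneg (Nat.cast_nonneg k) hs.τ_pos.le
  linarith

lemma rho_nonneg (r : Run p s ε N P) (hs : s.Valid p) {k : ℕ} (hk : k < N) (ω : Ω) :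
    0 ≤ r.ρ k ω := zero_le_one.trans (r.one_le_rho hs hk ω)

lemma one_le_budget (r : Run p s ε N P) (hp : p.Assumptions) (hs : s.Valid p) {k : ℕ}
    (hk1 : 1 ≤ k) (hk : k < N) (ω : Ω) : 1 ≤ r.budget k ω :=
  PenaltySFO.one_le_budget hp hs (r.rho_nonneg hs hk ω) (r.budget_ge k hk1 hk ω)

/-- The batch size of the `k`-th subproblem. -/
noncomputable def batch (r : Run p s ε N P) (k : ℕ) (ω : Ω) : ℕ :=
  batchSize p s (r.ρ k ω) (r.budget k ω)

/-- The iteration limit of the `k`-th subproblem. -/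
noncomputable def limit (r : Run p s ε N P) (k : ℕ) (ω : Ω) : ℕ :=
  innerLimit p s (r.ρ k ω) (r.budget k ω)

/-- The generalized gradient at the inner iterates. -/
noncomputable def pgrad (r : Run p s ε N P) (k i : ℕ) (ω : Ω) : Euc n :=
  proxGrad p (r.ρ k ω) (r.y k i ω)

/-- The error of the mini-batch gradients. -/
noncomputable def err (r : Run p s ε N P) (k i : ℕ) (ω : Ω) : Euc n :=
  noise p (r.y k i ω) (r.batch k ω) fun j => r.sample k i j ω

/-- The conditional probability of returning the `i`-th inner iterate, on the event `A`. -/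
noncomputable def weight (r : Run p s ε N P) (A : Set Ω) (k i : ℕ) (ω : Ω) : ℝ :=
  A.indicator (fun ω => if i ≤ r.limit k ω then 1 / (r.limit k ω : ℝ) else 0) ω

/-- The weighted merit function that decreases in expectation along the inner iterates. -/
noncomputable def merit (r : Run p s ε N P) (A : Set Ω) (k i : ℕ) (ω : Ω) : ℝ :=
  r.weight A k i ω *
    (Lrho p (r.ρ k ω) * (penalty p.f p.c (r.ρ k ω) (r.y k i ω) - penaltyInf p (r.ρ k ω)))

section

variable (r : Run p s ε N P) {k : ℕ} (hk1 : 1 ≤ k) (hk : k < N) {A : Set Ω}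
include hk1 hk

lemma measurable_rho {i : ℕ} (hi : 1 ≤ i) : Measurable[r.hist k i] (r.ρ k) :=
  (r.ρ_measurable k hk1 hk).mono ((r.hist k).mono hi) le_rfl

lemma measurable_budget {i : ℕ} (hi : 1 ≤ i) : Measurable[r.hist k i] (r.budget k) :=
  (r.budget_measurable k hk1 hk).mono ((r.hist k).mono hi) le_rfl

lemma measurable_batch {i : ℕ} (hi : 1 ≤ i) : Measurable[r.hist k i] (r.batch k) :=
  measurable_batchSize (r.measurable_rho hk1 hk hi) (r.measurable_budget hk1 hk hi)

lemma measurable_limit {i : ℕ} (hi : 1 ≤ i) : Measurable[r.hist k i] (r.limit k) :=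
  measurable_innerLimit (r.measurable_rho hk1 hk hi) (r.measurable_budget hk1 hk hi)

lemma measurable_pgrad (hp : p.Assumptions) (hs : s.Valid p) {i : ℕ} (hi : 1 ≤ i) :
    Measurable[r.hist k i] (r.pgrad k i) :=
  measurable_proxGrad hp (r.measurable_rho hk1 hk hi) (r.rho_nonneg hs hk)
    (r.y_adapted k hk1 hk i hi)

lemma measurable_weight (hA : MeasurableSet[r.hist k 1] A) {i : ℕ} (hi : 1 ≤ i) :
    Measurable[r.hist k i] (r.weight A k i) := by
  have h1 : Measurable fun m : ℕ => if i ≤ m then 1 / (m : ℝ) else 0 := measurable_from_nat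
  exact (h1.comp (r.measurable_limit hk1 hk hi)).indicator ((r.hist k).mono hi _ hA)

lemma measurable_merit (hp : p.Assumptions) (hA : MeasurableSet[r.hist k 1] A) {i : ℕ}
    (hi : 1 ≤ i) : Measurable[r.hist k i] (r.merit A k i) :=
  (r.measurable_weight hk1 hk hA hi).mul
    (measurable_scaled_gap hp (r.measurable_rho hk1 hk hi) (r.y_adapted k hk1 hk i hi))

lemma one_le_batch (hp : p.Assumptions) (hs : s.Valid p) (ω : Ω) : 1 ≤ r.batch k ω :=
  one_le_batchSize (r.one_le_budget hp hs hk1 hk ω)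

lemma one_le_limit (hp : p.Assumptions) (hs : s.Valid p) (ω : Ω) : 1 ≤ r.limit k ω :=
  one_le_innerLimit (r.one_le_budget hp hs hk1 hk ω)

omit hk1 hk in
lemma weight_nonneg (i : ℕ) (ω : Ω) : 0 ≤ r.weight A k i ω := by
  refine Set.indicator_nonneg (fun ω _ => ?_) ω
  positivity

omit hk1 hk in
lemma weight_le_one (i : ℕ) (ω : Ω) : r.weight A k i ω ≤ 1 := by
  refine Set.indicator_le' (fun ω _ => ?_) (fun _ _ => zero_le_one) ω
  split_ifs
  · rw [one_div]; exact Nat.cast_inv_le_one (r.limit k ω)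
  · exact zero_le_one

omit hk1 hk in
-- The weight drops to 0 after the random iteration limit. Monotonicity lets the sum over inner
-- iterates run to a deterministic index.
lemma weight_succ_le (i : ℕ) (ω : Ω) : r.weight A k (i + 1) ω ≤ r.weight A k i ω := by
  refine Set.indicator_le_indicator ?_
  split_ifs
  · exact le_rfl
  · omega
  · positivity
  · exact le_rfl

omit hk1 hk in
lemma sum_weight_le (B : ℕ) (ω : Ω) :
    ∑ i ∈ Finset.Ico 1 (B + 1), r.weight A k i ω ≤ A.indicator (fun _ => 1) ω := by
  by_cases hω : ω ∈ A
  · simp only [weight, Set.indicator_of_mem hω]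
    rw [← Finset.sum_filter, Finset.sum_const, nsmul_eq_mul]
    have hsub : (Finset.Ico 1 (B + 1)).filter (fun i => i ≤ r.limit k ω) ⊆
        Finset.Icc 1 (r.limit k ω) := fun i hi => by
      simp only [Finset.mem_filter, Finset.mem_Ico, Finset.mem_Icc] at hi ⊢
      omega
    have hcard := Finset.card_le_card hsub
    rw [Nat.card_Icc, Nat.add_sub_cancel] at hcard
    rw [mul_one_div]
    exact div_le_one_of_le₀ (by exact_mod_cast hcard) (Nat.cast_nonneg _)
  · simp [weight, Set.indicator_of_notMem hω]

omit hk1 in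
lemma merit_nonneg (hp : p.Assumptions) (hs : s.Valid p) (i : ℕ) (ω : Ω) :
    0 ≤ r.merit A k i ω :=
  mul_nonneg (r.weight_nonneg i ω) (mul_nonneg (Lrho_pos hp (r.rho_nonneg hs hk ω)).le
    (sub_nonneg.2 (penaltyInf_le hp (r.rho_nonneg hs hk ω) _)))

/-- The descent inequality times the weight. The merit is measured from the infimum, hence
nonnegative, so passing to the smaller weight at i + 1 only decreases it. -/
lemma merit_step (hp : p.Assumptions) (hs : s.Valid p) {i : ℕ} (hi : 1 ≤ i) (ω : Ω) :
    r.merit A k (i + 1) ω + r.weight A k i ω * ‖r.pgrad k i ω‖ ^ 2 / 4 ≤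
      r.merit A k i ω + inner ℝ (r.err k i ω) (r.weight A k i ω • r.pgrad k i ω) +
        3 / 2 * (r.weight A k i ω * ‖r.err k i ω‖ ^ 2) := by
  have hρ := r.rho_nonneg hs hk ω
  have hL := Lrho_pos hp hρ
  set g := (1 / (batchSize p s (r.ρ k ω) (r.budget k ω) : ℝ)) •
        ∑ j ∈ Finset.range (batchSize p s (r.ρ k ω) (r.budget k ω)),
          p.G (r.y k i ω) (r.sample k i j ω) with hg
  have hmin := r.y_succ k hk1 hk i hi ω
  rw [← hg] at hmin
  have hd : ∀ w, stepModel g (r.ρ k ω) (Lrho p (r.ρ k ω)) (p.c (r.y k i ω))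
      (fderiv ℝ p.c (r.y k i ω)) (r.y k (i + 1) ω - r.y k i ω) ≤
      stepModel g (r.ρ k ω) (Lrho p (r.ρ k ω)) (p.c (r.y k i ω))
      (fderiv ℝ p.c (r.y k i ω)) w := fun w => by
    have h := isMinOn_univ_iff.1 hmin (r.y k i ω + w)
    simp only [psi, add_sub_cancel_left] at h
    have e : 1 / (2 * (1 / Lrho p (r.ρ k ω))) = Lrho p (r.ρ k ω) / 2 := by field_simp
    rw [e] at h
    exact h
  have h := penalty_descent hp hρ (r.y k i ω) g _ hd
  rw [add_sub_cancel] at h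
  have hδ : g - gradient p.f (r.y k i ω) = r.err k i ω := rfl
  rw [hδ] at h
  have hw := r.weight_nonneg (A := A) (k := k) i ω
  have hsucc : r.merit A k (i + 1) ω ≤ r.weight A k i ω * (Lrho p (r.ρ k ω) *
      (penalty p.f p.c (r.ρ k ω) (r.y k (i + 1) ω) - penaltyInf p (r.ρ k ω))) :=
    mul_le_mul_of_nonneg_right (r.weight_succ_le i ω)
      (mul_nonneg hL.le (sub_nonneg.2 (penaltyInf_le hp hρ _)))
  have h2 := mul_le_mul_of_nonneg_left h hw
  rw [inner_smul_right]
  unfold merit pgrad at *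
  linarith

/-- A pointwise domination by Young's inequality. It supplies the integrability of ‖Q‖² that is
needed before the cross term may be said to have mean zero. -/
lemma weight_mul_sq_le (hp : p.Assumptions) (hs : s.Valid p) {i : ℕ} (hi : 1 ≤ i) (ω : Ω) :
    r.weight A k i ω * ‖r.pgrad k i ω‖ ^ 2 ≤
      8 * r.merit A k i ω + 28 * (r.weight A k i ω * ‖r.err k i ω‖ ^ 2) := by
  have h1 := r.merit_step hk1 hk (A := A) hp hs hi ω
  have h2 := r.merit_nonneg hk (A := A) hp hs (i + 1) ω
  have h3 : inner ℝ (r.err k i ω) (r.pgrad k i ω) ≤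
      2 * ‖r.err k i ω‖ ^ 2 + ‖r.pgrad k i ω‖ ^ 2 / 8 := by
    have := real_inner_le_norm (r.err k i ω) (r.pgrad k i ω)
    nlinarith [sq_nonneg (4 * ‖r.err k i ω‖ - ‖r.pgrad k i ω‖)]
  have h4 := mul_le_mul_of_nonneg_left h3 (r.weight_nonneg (A := A) (k := k) i ω)
  rw [inner_smul_right] at h1
  linarith

/-- The factors 4 and 6 come from clearing the 1/4 in `merit_step`. The budget also makes the
initial merit uniformly bounded, with no integrability assumption on the outer iterate. -/
lemma four_merit_one_add_le (hp : p.Assumptions) (hs : s.Valid p) (hε : 0 < ε) (ω : Ω) :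
    4 * r.merit A k 1 ω + 6 * (A.indicator (fun _ => (1 : ℝ)) ω * (p.σ ^ 2 / r.batch k ω)) ≤
      A.indicator (fun _ => 5 / 16 * ε) ω := by
  by_cases hω : ω ∈ A
  · have hρ1 := r.one_le_rho hs hk ω
    have hρ : 0 < r.ρ k ω := one_pos.trans_le hρ1
    have h1 := inner_error_le hp hs hε hρ (r.budget_ge k hk1 hk ω)
    have h2 := r.one_le_limit hk1 hk hp hs ω
    have h3 := le_penaltyInf hs hρ
    simp only [merit, weight, Set.indicator_of_mem hω, if_pos h2, one_mul, r.y_one k hk1 hk ω]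
    refine le_trans ?_ h1
    have hL := Lrho_pos hp hρ.le
    have h4 : 1 / (r.limit k ω : ℝ) * (Lrho p (r.ρ k ω) *
        (penalty p.f p.c (r.ρ k ω) (r.x k ω) - penaltyInf p (r.ρ k ω))) ≤
        Lrho p (r.ρ k ω) / (innerLimit p s (r.ρ k ω) (r.budget k ω)) *
          gap p s (r.ρ k ω) (r.x k ω) := by
      rw [← mul_assoc, one_div_mul_eq_div]
      unfold gap limit
      gcongr
    exact add_le_add (mul_le_mul_of_nonneg_left h4 (by norm_num)) le_rfl
  · simp [merit, weight, Set.indicator_of_notMem hω]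

variable [IsProbabilityMeasure P]

lemma integral_weight_err_sq (hp : p.Assumptions) (hs : s.Valid p)
    (hA : MeasurableSet[r.hist k 1] A) {i : ℕ} (hi : 1 ≤ i) :
    Integrable (fun ω => r.weight A k i ω * ‖r.err k i ω‖ ^ 2) P ∧
      ∫ ω, r.weight A k i ω * ‖r.err k i ω‖ ^ 2 ∂P ≤
        ∫ ω, r.weight A k i ω * (p.σ ^ 2 / r.batch k ω) ∂P :=
  integral_weight_noise_sq hp ((r.hist k).le i)
    (fun j => (r.sample_measurable k hk1 hk i hi j).mono ((r.hist k).le _) le_rfl)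
    (r.sample_law k hk1 hk i hi) (r.sample_iIndep k hk1 hk i hi)
    (r.sample_indep_past k hk1 hk i hi) (r.y_adapted k hk1 hk i hi)
    (r.measurable_batch hk1 hk hi) (r.one_le_batch hk1 hk hp hs)
    (r.measurable_weight hk1 hk hA hi) (r.weight_nonneg i) (r.weight_le_one i)

lemma integrable_weight_sq (hp : p.Assumptions) (hs : s.Valid p)
    (hA : MeasurableSet[r.hist k 1] A) {i : ℕ} (hi : 1 ≤ i)
    (hm : Integrable (r.merit A k i) P) :
    Integrable (fun ω => r.weight A k i ω * ‖r.pgrad k i ω‖ ^ 2) P := by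
  have hmeas : Measurable fun ω => r.weight A k i ω * ‖r.pgrad k i ω‖ ^ 2 :=
    ((r.measurable_weight hk1 hk hA hi).mono ((r.hist k).le i) le_rfl).mul
      (((r.measurable_pgrad hk1 hk hp hs hi).mono ((r.hist k).le i) le_rfl).norm.pow_const 2)
  refine ((hm.const_mul 8).add
    ((r.integral_weight_err_sq hk1 hk hp hs hA hi).1.const_mul 28)).mono'
    hmeas.aestronglyMeasurable (Filter.Eventually.of_forall fun ω => ?_)
  rw [Real.norm_of_nonneg (mul_nonneg (r.weight_nonneg i ω) (by positivity))]
  exact r.weight_mul_sq_le hk1 hk hp hs hi ω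

lemma integral_inner_err (hp : p.Assumptions) (hs : s.Valid p)
    (hA : MeasurableSet[r.hist k 1] A) {i : ℕ} (hi : 1 ≤ i)
    (hm : Integrable (r.merit A k i) P) :
    Integrable (fun ω => inner ℝ (r.err k i ω) (r.weight A k i ω • r.pgrad k i ω)) P ∧
      ∫ ω, inner ℝ (r.err k i ω) (r.weight A k i ω • r.pgrad k i ω) ∂P = 0 := by
  have hv : Measurable[r.hist k i] fun ω => r.weight A k i ω • r.pgrad k i ω :=
    (r.measurable_weight hk1 hk hA hi).smul (r.measurable_pgrad hk1 hk hp hs hi)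
  refine integral_inner_noise hp ((r.hist k).le i)
    (fun j => (r.sample_measurable k hk1 hk i hi j).mono ((r.hist k).le _) le_rfl)
    (r.sample_law k hk1 hk i hi) (r.sample_iIndep k hk1 hk i hi)
    (r.sample_indep_past k hk1 hk i hi) (r.y_adapted k hk1 hk i hi)
    (r.measurable_batch hk1 hk hi) (r.one_le_batch hk1 hk hp hs) hv ?_
  refine (r.integrable_weight_sq hk1 hk hp hs hA hi hm).mono'
    ((hv.mono ((r.hist k).le i) le_rfl).norm.pow_const 2).aestronglyMeasurable
    (Filter.Eventually.of_forall fun ω => ?_)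
  have h0 := r.weight_nonneg (A := A) (k := k) i ω
  have h1 := r.weight_le_one (A := A) (k := k) i ω
  rw [Real.norm_of_nonneg (by positivity), norm_smul, mul_pow, Real.norm_of_nonneg h0]
  gcongr
  nlinarith

lemma integrable_merit (hp : p.Assumptions) (hs : s.Valid p) (hε : 0 < ε)
    (hA : MeasurableSet[r.hist k 1] A) {i : ℕ} (hi : 1 ≤ i) :
    Integrable (r.merit A k i) P := by
  induction i, hi using Nat.le_induction with
  | base =>
    refine Integrable.of_bound ((r.measurable_merit hk1 hk hp hA le_rfl).mono
      ((r.hist k).le 1) le_rfl).aestronglyMeasurable (5 / 16 * ε)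
      (Filter.Eventually.of_forall fun ω => ?_)
    have h0 := r.merit_nonneg hk (A := A) hp hs 1 ω
    rw [Real.norm_of_nonneg h0]
    have h1 := r.four_merit_one_add_le hk1 hk (A := A) hp hs hε ω
    have h2 : A.indicator (fun _ => 5 / 16 * ε) ω ≤ 5 / 16 * ε :=
      Set.indicator_le_self' (fun _ _ => by positivity) ω
    have h3 : 0 ≤ A.indicator (fun _ => (1 : ℝ)) ω * (p.σ ^ 2 / r.batch k ω) :=
      mul_nonneg (Set.indicator_nonneg (fun _ _ => zero_le_one) ω) (by positivity)
    linarith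
  | succ i hi ih =>
    refine ((ih.add (r.integral_inner_err hk1 hk hp hs hA hi ih).1).add
      ((r.integral_weight_err_sq hk1 hk hp hs hA hi).1.const_mul (3 / 2))).mono'
      ((r.measurable_merit hk1 hk hp hA (by omega)).mono
        ((r.hist k).le _) le_rfl).aestronglyMeasurable
      (Filter.Eventually.of_forall fun ω => ?_)
    rw [Real.norm_of_nonneg (r.merit_nonneg hk hp hs _ ω)]
    have h1 := r.merit_step hk1 hk (A := A) hp hs hi ω
    have h2 : 0 ≤ r.weight A k i ω * ‖r.pgrad k i ω‖ ^ 2 / 4 :=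
      div_nonneg (mul_nonneg (r.weight_nonneg i ω) (by positivity)) (by norm_num)
    simp only [Pi.add_apply]
    linarith

lemma integral_merit_step (hp : p.Assumptions) (hs : s.Valid p) (hε : 0 < ε)
    (hA : MeasurableSet[r.hist k 1] A) {i : ℕ} (hi : 1 ≤ i) :
    ∫ ω, r.merit A k (i + 1) ω ∂P + (∫ ω, r.weight A k i ω * ‖r.pgrad k i ω‖ ^ 2 ∂P) / 4 ≤
      ∫ ω, r.merit A k i ω ∂P +
        3 / 2 * ∫ ω, r.weight A k i ω * (p.σ ^ 2 / r.batch k ω) ∂P := by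
  have hm := r.integrable_merit hk1 hk hp hs hε hA hi
  have hm' := r.integrable_merit hk1 hk hp hs hε hA (i := i + 1) (by omega)
  have hsq := r.integrable_weight_sq hk1 hk hp hs hA hi hm
  have hin := r.integral_inner_err hk1 hk hp hs hA hi hm
  have herr := r.integral_weight_err_sq hk1 hk hp hs hA hi
  have h := integral_mono (hm'.add (hsq.div_const 4))
    ((hm.add hin.1).add (herr.1.const_mul (3 / 2))) fun ω => by
      simpa using r.merit_step hk1 hk (A := A) hp hs hi ω
  rw [integral_add' hm' (hsq.div_const 4), integral_add' (hm.add hin.1) (herr.1.const_mul _),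
    integral_add' hm hin.1, hin.2, integral_div, integral_const_mul] at h
  linarith [herr.2]

/-- Telescoping of `integral_merit_step`; the final merit is dropped, and the weights sum to at most
1 on A. -/
lemma sum_integral_weight_sq_le (hp : p.Assumptions) (hs : s.Valid p) (hε : 0 < ε)
    (hA : MeasurableSet[r.hist k 1] A) (B : ℕ) :
    ∑ i ∈ Finset.Ico 1 (B + 1), ∫ ω, r.weight A k i ω * ‖r.pgrad k i ω‖ ^ 2 ∂P ≤
      5 / 16 * ε * P.real A := by
  have hA' : MeasurableSet A := (r.hist k).le 1 _ hA
  have hbm : Measurable fun ω => p.σ ^ 2 / (r.batch k ω : ℝ) := by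
    have := (r.measurable_batch hk1 hk le_rfl).mono ((r.hist k).le 1) le_rfl
    fun_prop
  have hbb : ∀ ω, ‖p.σ ^ 2 / (r.batch k ω : ℝ)‖ ≤ p.σ ^ 2 := fun ω => by
    rw [Real.norm_of_nonneg (by positivity)]
    exact div_le_self (sq_nonneg _) (by exact_mod_cast r.one_le_batch hk1 hk hp hs ω)
  have hbi : Integrable (fun ω => p.σ ^ 2 / (r.batch k ω : ℝ)) P :=
    Integrable.of_bound hbm.aestronglyMeasurable _ (Filter.Eventually.of_forall hbb)
  have hwi : ∀ i ∈ Finset.Ico 1 (B + 1),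
      Integrable (fun ω => r.weight A k i ω * (p.σ ^ 2 / r.batch k ω)) P := fun i hi => by
    refine hbi.mono' ((((r.measurable_weight hk1 hk hA (Finset.mem_Ico.1 hi).1).mono
      ((r.hist k).le i) le_rfl).mul hbm).aestronglyMeasurable)
      (Filter.Eventually.of_forall fun ω => ?_)
    have h0 : 0 ≤ p.σ ^ 2 / (r.batch k ω : ℝ) := by positivity
    rw [Real.norm_of_nonneg (mul_nonneg (r.weight_nonneg i ω) h0)]
    exact mul_le_of_le_one_left h0 (r.weight_le_one i ω)
  have hAi : Integrable
      (fun ω => A.indicator (fun _ => (1 : ℝ)) ω * (p.σ ^ 2 / r.batch k ω)) P := by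
    have : (fun ω => A.indicator (fun _ => (1 : ℝ)) ω * (p.σ ^ 2 / r.batch k ω)) =
        A.indicator fun ω => p.σ ^ 2 / (r.batch k ω : ℝ) := by
      funext ω; by_cases h : ω ∈ A <;> simp [h]
    rw [this]; exact hbi.indicator hA'
  have hm1 := r.integrable_merit hk1 hk hp hs hε hA le_rfl
  have tel : ∀ B : ℕ, ∫ ω, r.merit A k (B + 1) ω ∂P +
      (∑ i ∈ Finset.Ico 1 (B + 1), ∫ ω, r.weight A k i ω * ‖r.pgrad k i ω‖ ^ 2 ∂P) / 4 ≤
      ∫ ω, r.merit A k 1 ω ∂P + 3 / 2 * ∑ i ∈ Finset.Ico 1 (B + 1),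
        ∫ ω, r.weight A k i ω * (p.σ ^ 2 / r.batch k ω) ∂P := by
    intro B
    induction B with
    | zero => simp
    | succ B ih =>
      rw [Finset.sum_Ico_succ_top (Nat.le_add_left 1 B),
        Finset.sum_Ico_succ_top (Nat.le_add_left 1 B)]
      have := r.integral_merit_step hk1 hk hp hs hε hA (i := B + 1) (by omega)
      linarith
  have h1 : ∑ i ∈ Finset.Ico 1 (B + 1), ∫ ω, r.weight A k i ω * (p.σ ^ 2 / r.batch k ω) ∂P ≤
      ∫ ω, A.indicator (fun _ => (1 : ℝ)) ω * (p.σ ^ 2 / r.batch k ω) ∂P := by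
    rw [← integral_finsetSum _ hwi]
    refine integral_mono (integrable_finsetSum _ hwi) hAi fun ω => ?_
    simp only
    rw [← Finset.sum_mul]
    exact mul_le_mul_of_nonneg_right (r.sum_weight_le B ω) (by positivity)
  have h2 := integral_mono ((hm1.const_mul 4).add (hAi.const_mul 6))
    ((integrable_const (5 / 16 * ε)).indicator hA')
    fun ω => r.four_merit_one_add_le hk1 hk (A := A) hp hs hε ω
  rw [integral_add' (hm1.const_mul 4) (hAi.const_mul 6), integral_const_mul, integral_const_mul,
    integral_indicator_const _ hA', smul_eq_mul] at h2
  have h3 : 0 ≤ ∫ ω, r.merit A k (B + 1) ω ∂P :=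
    integral_nonneg fun ω => r.merit_nonneg hk hp hs _ ω
  linarith [tel B]

lemma tsum_lintegral_weight_sq_le (hp : p.Assumptions) (hs : s.Valid p) (hε : 0 < ε)
    (hA : MeasurableSet[r.hist k 1] A) :
    ∑' i, ∫⁻ ω, ENNReal.ofReal (r.weight A k (i + 1) ω * ‖r.pgrad k (i + 1) ω‖ ^ 2) ∂P ≤
      ENNReal.ofReal (5 / 16 * ε) * P A := by
  refine ENNReal.tsum_le_of_sum_range_le fun B => ?_
  have h := r.sum_integral_weight_sq_le hk1 hk hp hs hε hA B
  have h0 : ∀ i ω, 0 ≤ r.weight A k i ω * ‖r.pgrad k i ω‖ ^ 2 := fun i ω =>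
    mul_nonneg (r.weight_nonneg i ω) (by positivity)
  have hi : ∀ i, Integrable (fun ω => r.weight A k (i + 1) ω * ‖r.pgrad k (i + 1) ω‖ ^ 2) P :=
    fun i => r.integrable_weight_sq hk1 hk hp hs hA (by omega)
      (r.integrable_merit hk1 hk hp hs hε hA (by omega))
  have e : ∀ i, ∫⁻ ω, ENNReal.ofReal
      (r.weight A k (i + 1) ω * ‖r.pgrad k (i + 1) ω‖ ^ 2) ∂P =
      ENNReal.ofReal (∫ ω, r.weight A k (i + 1) ω * ‖r.pgrad k (i + 1) ω‖ ^ 2 ∂P) := fun i =>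
    (ofReal_integral_eq_lintegral_ofReal (hi i) (Filter.Eventually.of_forall (h0 _))).symm
  simp_rw [e]
  rw [← ENNReal.ofReal_sum_of_nonneg fun i _ => integral_nonneg (h0 _), ← ofReal_measureReal,
    ← ENNReal.ofReal_mul (by positivity)]
  refine ENNReal.ofReal_le_ofReal ?_
  rwa [Finset.sum_Ico_eq_sum_range, Nat.add_sub_cancel,
    Finset.sum_congr rfl fun i _ => by rw [add_comm 1 i]] at h

end

end Run

end InnerRun

lemma measurable_indicator_norm_sq {α E : Type*} {mα : MeasurableSpace α} [NormedAddCommGroup E]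
    [MeasurableSpace E] [OpensMeasurableSpace E] {A : Set α} (hA : MeasurableSet A) {f : α → E}
    (hf : Measurable f) : Measurable (A.indicator fun a => ENNReal.ofReal (‖f a‖ ^ 2)) :=
  (hf.norm.pow_const 2).ennreal_ofReal.indicator hA

/-! ### The returned index and random outer iterations -/

section OuterRun

variable {n q : ℕ} {Ξ : Type*} [MeasurableSpace Ξ] {p : Problem n q Ξ} {s : Settings n}
  {ε : ℝ} {N : ℕ} {Ω : Type*} [mΩ : MeasurableSpace Ω] {P : Measure Ω}

namespace Run

/-- The law of the returned index, tested against quantities of the `k`-th subproblem. -/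
lemma setLIntegral_R_eq [IsProbabilityMeasure P] (r : Run p s ε N P) {k : ℕ} (hk1 : 1 ≤ k)
    (hk : k < N) (i : ℕ) {F : Ω → ENNReal}
    (hF : Measurable[⨆ i, (r.hist k i : MeasurableSpace Ω)] F) :
    ∫⁻ ω in r.R k ⁻¹' {i}, F ω ∂P =
      ∫⁻ ω, ENNReal.ofReal (if 1 ≤ i ∧ i ≤ r.limit k ω then 1 / (r.limit k ω : ℝ) else 0) *
        F ω ∂P := by
  have hR : Measurable (r.R k) :=
    (r.R_measurable k hk1 hk).mono ((r.hist (k + 1)).le 1) le_rfl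
  refine setLIntegral_eq_of_condExp (iSup_le fun i => (r.hist k).le i)
    (hR (measurableSet_singleton i)) (fun ω => ?_) (r.R_uniform k hk1 hk i) hF
  positivity

/-- For each i the law of R is tested against the indicator that i is out of range; the density
times this indicator vanishes. -/
lemma ae_R_mem [IsProbabilityMeasure P] (r : Run p s ε N P) {k : ℕ} (hk1 : 1 ≤ k) (hk : k < N) :
    ∀ᵐ ω ∂P, 1 ≤ r.R k ω ∧ r.R k ω ≤ r.limit k ω := by
  have hR : Measurable (r.R k) :=
    (r.R_measurable k hk1 hk).mono ((r.hist (k + 1)).le 1) le_rfl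
  have hlim : Measurable[⨆ i, (r.hist k i : MeasurableSpace Ω)] (r.limit k) :=
    (r.measurable_limit hk1 hk le_rfl).mono
      (le_iSup (fun i => (r.hist k i : MeasurableSpace Ω)) 1) le_rfl
  have h : ∀ i, ∀ᵐ ω ∂P, r.R k ω = i → 1 ≤ i ∧ i ≤ r.limit k ω := by
    intro i
    have h1 : Measurable fun m : ℕ => if 1 ≤ i ∧ i ≤ m then (0 : ENNReal) else 1 :=
      measurable_from_nat
    have h2 := r.setLIntegral_R_eq hk1 hk i (F := fun ω => if 1 ≤ i ∧ i ≤ r.limit k ω then 0 else 1)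
      (h1.comp hlim)
    have h3 : ∀ ω, ENNReal.ofReal (if 1 ≤ i ∧ i ≤ r.limit k ω then 1 / (r.limit k ω : ℝ) else 0) *
        (if 1 ≤ i ∧ i ≤ r.limit k ω then (0 : ENNReal) else 1) = 0 := fun ω => by
      split_ifs <;> simp
    simp_rw [h3, lintegral_zero] at h2
    have hlim' : Measurable (r.limit k) :=
      (r.measurable_limit hk1 hk le_rfl).mono ((r.hist k).le 1) le_rfl
    have h4 := (lintegral_eq_zero_iff (h1.comp hlim')).1 h2
    have h5 := (ae_restrict_iff' (hR (measurableSet_singleton i))).1 h4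
    filter_upwards [h5] with ω hω hi
    by_contra hc
    have := hω hi
    simp [hc] at this
  filter_upwards [ae_all_iff.2 h] with ω hω using hω _ rfl

lemma aemeasurable_x_succ [IsProbabilityMeasure P] (r : Run p s ε N P) {k : ℕ} (hk1 : 1 ≤ k)
    (hk : k < N) : AEMeasurable (r.x (k + 1)) P := by
  have hR : Measurable (r.R k) :=
    (r.R_measurable k hk1 hk).mono ((r.hist (k + 1)).le 1) le_rfl
  have hy : ∀ i, Measurable (r.y k (i + 1)) := fun i =>
    (r.y_adapted k hk1 hk (i + 1) (by omega)).mono ((r.hist k).le _) le_rfl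
  have h : Measurable fun z : ℕ × Ω => r.y k (z.1 + 1) z.2 :=
    measurable_from_prod_countable_right hy
  -- The shift avoids inner index 0, where no measurability of y is given; almost surely R ≥ 1, so
  -- nothing changes.
  refine ⟨fun ω => r.y k (r.R k ω - 1 + 1) ω,
    h.comp ((measurable_from_nat (f := fun i => i - 1)).comp hR |>.prodMk measurable_id), ?_⟩
  filter_upwards [r.ae_R_mem hk1 hk] with ω hω
  rw [r.x_succ k hk1 hk ω, Nat.sub_add_cancel hω.1]

/-- Conditionally on the past of an outer iteration, the generalized gradient at the point that it
returns is small in mean square. -/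
lemma setLIntegral_proxGrad_le [IsProbabilityMeasure P] (r : Run p s ε N P) (hp : p.Assumptions)
    (hs : s.Valid p) (hε : 0 < ε) {k : ℕ} (hk1 : 1 ≤ k) (hk : k < N) {A : Set Ω}
    (hA : MeasurableSet[r.hist k 1] A) :
    ∫⁻ ω in A, ENNReal.ofReal (‖proxGrad p (r.ρ k ω) (r.x (k + 1) ω)‖ ^ 2) ∂P ≤
      ENNReal.ofReal (5 / 16 * ε) * P A := by
  have hA' : MeasurableSet A := (r.hist k).le 1 _ hA
  have hR : Measurable (r.R k) :=
    (r.R_measurable k hk1 hk).mono ((r.hist (k + 1)).le 1) le_rfl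
  set F : ℕ → Ω → ENNReal := fun i =>
    A.indicator fun ω => ENNReal.ofReal (‖r.pgrad k (i + 1) ω‖ ^ 2) with hFdef
  have hF : ∀ i, Measurable[r.hist k (i + 1)] (F i) := fun i =>
    measurable_indicator_norm_sq ((r.hist k).mono (by omega) _ hA)
      (r.measurable_pgrad hk1 hk hp hs (by omega))
  -- Split by the value of R, so that each piece involves a fixed inner iterate and the indicator of
  -- {R = i + 1} can be replaced by its conditional probability.
  have h1 : ∫⁻ ω in A, ENNReal.ofReal (‖proxGrad p (r.ρ k ω) (r.x (k + 1) ω)‖ ^ 2) ∂P =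
      ∫⁻ ω, ∑' i, (r.R k ⁻¹' {i + 1}).indicator (F i) ω ∂P := by
    rw [← lintegral_indicator hA']
    refine lintegral_congr_ae ?_
    filter_upwards [r.ae_R_mem hk1 hk] with ω hω
    have hne : ∀ i, i ≠ r.R k ω - 1 → (r.R k ⁻¹' {i + 1}).indicator (F i) ω = 0 := fun i hi =>
      Set.indicator_of_notMem (fun hc => hi (by
        have hc' : r.R k ω = i + 1 := hc
        omega)) _
    have hmem : ω ∈ r.R k ⁻¹' {r.R k ω - 1 + 1} := by
      rw [Nat.sub_add_cancel hω.1]; rfl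
    rw [tsum_eq_single (r.R k ω - 1) hne, Set.indicator_of_mem hmem]
    simp only [hFdef, pgrad, Nat.sub_add_cancel hω.1]
    by_cases hωA : ω ∈ A
    · simp [hωA, r.x_succ k hk1 hk ω]
    · simp [hωA]
  rw [h1, lintegral_tsum fun i => (((hF i).mono ((r.hist k).le _) le_rfl).indicator
    (hR (measurableSet_singleton _))).aemeasurable]
  refine le_trans (le_of_eq (tsum_congr fun i => ?_))
    (r.tsum_lintegral_weight_sq_le hk1 hk hp hs hε hA)
  rw [lintegral_indicator (hR (measurableSet_singleton _)), r.setLIntegral_R_eq hk1 hk (i + 1)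
    ((hF i).mono (le_iSup (fun i => (r.hist k i : MeasurableSpace Ω)) (i + 1)) le_rfl)]
  refine lintegral_congr fun ω => ?_
  by_cases hωA : ω ∈ A
  · simp only [hFdef, weight, Set.indicator_of_mem hωA]
    rw [← ENNReal.ofReal_mul (by positivity)]
    simp
  · simp [hFdef, weight, hωA]

variable [IsProbabilityMeasure P] (r : Run p s ε N P) {K : Ω → ℕ}

/-- The event {K = k} belongs to the information at the start of iteration k, so the localized
estimate applies on it, and the probabilities of these events sum to 1. -/
lemma lintegral_proxGrad_random_le (hp : p.Assumptions)
    (hs : s.Valid p) (hε : 0 < ε) (hK : ∀ ω, 1 ≤ K ω ∧ K ω < N)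
    (hKm : ∀ k, 1 ≤ k → k < N → MeasurableSet[r.hist k 1] (K ⁻¹' {k})) :
    ∫⁻ ω, ENNReal.ofReal (‖proxGrad p (r.ρ (K ω) ω) (r.x (K ω + 1) ω)‖ ^ 2) ∂P ≤
      ENNReal.ofReal (5 / 16 * ε) := by
  have hmeas : ∀ k ∈ Finset.Ico 1 N, MeasurableSet (K ⁻¹' {k}) := fun k hk =>
    (r.hist k).le 1 _ (hKm k (Finset.mem_Ico.1 hk).1 (Finset.mem_Ico.1 hk).2)
  have hdisj : Set.PairwiseDisjoint (↑(Finset.Ico 1 N)) fun k => K ⁻¹' {k} := by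
    intro i _ j _ hij
    exact Disjoint.preimage _ (by simpa using hij)
  have huniv : ⋃ k ∈ Finset.Ico 1 N, K ⁻¹' {k} = Set.univ := by
    ext ω; simp [hK ω]
  rw [← setLIntegral_univ, ← huniv, lintegral_biUnion_finset hdisj hmeas]
  calc _ ≤ ∑ k ∈ Finset.Ico 1 N, ENNReal.ofReal (5 / 16 * ε) * P (K ⁻¹' {k}) := by
        refine Finset.sum_le_sum fun k hk => ?_
        have hk' := Finset.mem_Ico.1 hk
        refine le_trans (le_of_eq ?_)
          (r.setLIntegral_proxGrad_le hp hs hε hk'.1 hk'.2 (hKm k hk'.1 hk'.2))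
        refine setLIntegral_congr_fun (hmeas k hk) fun ω hω => ?_
        have hω' : K ω = k := hω
        simp only [hω']
    _ = ENNReal.ofReal (5 / 16 * ε) := by
        rw [← Finset.mul_sum, ← measure_biUnion_finset hdisj hmeas, huniv, measure_univ, mul_one]

omit [IsProbabilityMeasure P] in
lemma aemeasurable_random {E : Type*} [MeasurableSpace E] {f : ℕ → Ω → E}
    (hf : ∀ k, 1 ≤ k → k < N → AEMeasurable (f k) P) (hK : ∀ ω, 1 ≤ K ω ∧ K ω < N)
    (hKm : ∀ k, 1 ≤ k → k < N → MeasurableSet (K ⁻¹' {k})) :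
    AEMeasurable (fun ω => f (K ω) ω) P := by
  have huniv : ⋃ k : Set.Ico 1 N, K ⁻¹' {(k : ℕ)} = Set.univ := by
    ext ω; simp [hK ω]
  rw [← Measure.restrict_univ (μ := P), ← huniv, aemeasurable_iUnion_iff]
  rintro ⟨k, hk⟩
  refine (hf k hk.1 hk.2).restrict.congr ?_
  refine (ae_restrict_iff' (hKm k hk.1 hk.2)).2 (Filter.Eventually.of_forall fun ω hω => ?_)
  have hω' : K ω = k := hω
  simp only [hω']

end Run

end OuterRun

/-! ### From the generalized gradient to stochastic criticality -/

section Criticality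

variable {n q : ℕ} {Ξ : Type*} [MeasurableSpace Ξ] {p : Problem n q Ξ}
  {Ω : Type*} [MeasurableSpace Ω] {P : Measure Ω}

/-- The truncation at 0 keeps the modified ρ nonnegative everywhere, as `measurable_proxGrad`
requires. -/
lemma exists_measurable_proxGrad (hp : p.Assumptions) {ρ : Ω → ℝ} {X : Ω → Euc n}
    (hρ : AEMeasurable ρ P) (hρ0 : ∀ ω, 0 ≤ ρ ω) (hX : AEMeasurable X P) :
    ∃ (ρ' : Ω → ℝ) (X' : Ω → Euc n), (∀ ω, 0 ≤ ρ' ω) ∧ Measurable X' ∧ X =ᵐ[P] X' ∧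
      Measurable (fun ω => proxGrad p (ρ' ω) (X' ω)) ∧
      (fun ω => proxGrad p (ρ ω) (X ω)) =ᵐ[P] fun ω => proxGrad p (ρ' ω) (X' ω) := by
  refine ⟨fun ω => max (hρ.mk ρ ω) 0, hX.mk X, fun ω => le_max_right _ _, hX.measurable_mk,
    hX.ae_eq_mk, measurable_proxGrad hp (hρ.measurable_mk.max measurable_const)
      (fun ω => le_max_right _ _) hX.measurable_mk, ?_⟩
  filter_upwards [hρ.ae_eq_mk, hX.ae_eq_mk] with ω h1 h2
  rw [← h1, ← h2, max_eq_left (hρ0 ω)]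

lemma integrable_sq_of_lintegral_le {E : Type*} [NormedAddCommGroup E] [MeasurableSpace E]
    [BorelSpace E] {f : Ω → E} (hf : AEMeasurable f P) {v : ℝ} (hv : 0 ≤ v)
    (h : ∫⁻ ω, ENNReal.ofReal (‖f ω‖ ^ 2) ∂P ≤ ENNReal.ofReal v) :
    Integrable (fun ω => ‖f ω‖ ^ 2) P ∧ ∫ ω, ‖f ω‖ ^ 2 ∂P ≤ v := by
  have h0 : 0 ≤ᵐ[P] fun ω => ‖f ω‖ ^ 2 := Filter.Eventually.of_forall fun ω => sq_nonneg _
  have hint : Integrable (fun ω => ‖f ω‖ ^ 2) P := by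
    refine ⟨(hf.norm.pow_const 2).aestronglyMeasurable, ?_⟩
    rw [hasFiniteIntegral_iff_ofReal h0]
    exact h.trans_lt ENNReal.ofReal_lt_top
  refine ⟨hint, ?_⟩
  rw [← ofReal_integral_eq_lintegral_ofReal hint h0] at h
  exact (ENNReal.ofReal_le_ofReal_iff hv).1 h

/-- A measurable choice of a parameter for which a residual is nearly as small as required. -/
lemma exists_measurable_residual_le [IsProbabilityMeasure P] {E F : Type*} [NormedAddCommGroup E]
    [MeasurableSpace E] [BorelSpace E] [SecondCountableTopology E] [NormedAddCommGroup F]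
    [MeasurableSpace F] [BorelSpace F] [SecondCountableTopology F]
    {R : E × F → E} (hR : Continuous R) {X Q : Ω → E} {v ε : ℝ} (hvε : v < ε) (hX : Measurable X)
    (hQ : Measurable Q) (hex : ∀ ω, ∃ l, R (X ω, l) = Q ω)
    (hi : Integrable (fun ω => ‖Q ω‖ ^ 2) P) (hv : ∫ ω, ‖Q ω‖ ^ 2 ∂P ≤ v) :
    ∃ lam : Ω → F, Measurable lam ∧ Integrable (fun ω => ‖R (X ω, lam ω)‖ ^ 2) P ∧
      ∫ ω, ‖R (X ω, lam ω)‖ ^ 2 ∂P ≤ ε := by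
  -- An exact multiplier exists at every ω, but the measurable choice is made from a dense sequence;
  -- the slack ε - v pays for the approximation.
  obtain ⟨lam, hlam, hsel⟩ := exists_measurable_select (TopologicalSpace.denseSeq F)
    (r := fun ω k => ‖R (X ω, TopologicalSpace.denseSeq F k)‖ ^ 2 < ‖Q ω‖ ^ 2 + (ε - v))
    (fun ω => by
      have ho : IsOpen {u : F | ‖R (X ω, u)‖ ^ 2 < ‖Q ω‖ ^ 2 + (ε - v)} :=
        isOpen_lt (by fun_prop) continuous_const
      obtain ⟨l, hl⟩ := hex ω
      have hl' : ‖R (X ω, l)‖ ^ 2 < ‖Q ω‖ ^ 2 + (ε - v) := by rw [hl]; linarith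
      exact (TopologicalSpace.denseRange_denseSeq F).exists_mem_open ho ⟨l, hl'⟩)
    (fun k => measurableSet_lt
      (((hR.measurable.comp (hX.prodMk measurable_const)).norm).pow_const 2)
      ((hQ.norm.pow_const 2).add_const _))
  have hle : ∀ ω, ‖R (X ω, lam ω)‖ ^ 2 ≤ ‖Q ω‖ ^ 2 + (ε - v) := fun ω => by
    obtain ⟨k, hk1, hk2⟩ := hsel ω
    rw [hk1]; exact hk2.le
  have hbase : Integrable (fun ω => ‖Q ω‖ ^ 2 + (ε - v)) P := hi.add (integrable_const _)
  have hmeas : Measurable (fun ω => ‖R (X ω, lam ω)‖ ^ 2) :=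
    (hR.measurable.comp (hX.prodMk hlam)).norm.pow_const 2
  have hint : Integrable (fun ω => ‖R (X ω, lam ω)‖ ^ 2) P :=
    hbase.mono' hmeas.aestronglyMeasurable (Filter.Eventually.of_forall fun ω => by
      rw [Real.norm_of_nonneg (sq_nonneg _)]; exact hle ω)
  refine ⟨lam, hlam, hint, (integral_mono hint hbase hle).trans ?_⟩
  rw [integral_add hi (integrable_const _), integral_const, probReal_univ, one_smul]
  linarith

lemma hasMultiplier_of_proxGrad [IsProbabilityMeasure P] (hp : p.Assumptions) {ρ : Ω → ℝ}
    {X : Ω → Euc n} {ε v : ℝ} (hvε : v < ε)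
    (hρ : AEMeasurable ρ P) (hρ0 : ∀ ω, 0 ≤ ρ ω) (hX : AEMeasurable X P)
    (hi : Integrable (fun ω => ‖proxGrad p (ρ ω) (X ω)‖ ^ 2) P)
    (hv : ∫ ω, ‖proxGrad p (ρ ω) (X ω)‖ ^ 2 ∂P ≤ v) : HasMultiplier p.f p.c P X ε := by
  obtain ⟨ρ', X', hρ', hX', hXX, hm, heq⟩ := exists_measurable_proxGrad hp hρ hρ0 hX
  have hJ : Continuous fun x => (fderiv ℝ p.c x).adjoint :=
    (LinearIsometryEquiv.continuous _).comp (hp.c_contDiff.continuous_fderiv one_ne_zero)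
  have hR : Continuous fun z : Euc n × Euc q =>
      gradient p.f z.1 + (fderiv ℝ p.c z.1).adjoint z.2 :=
    ((continuous_gradient_of_assumptions hp).comp continuous_fst).add
      ((hJ.comp continuous_fst).clm_apply continuous_snd)
  have hsq : (fun ω => ‖proxGrad p (ρ ω) (X ω)‖ ^ 2) =ᵐ[P]
      fun ω => ‖proxGrad p (ρ' ω) (X' ω)‖ ^ 2 := heq.fun_comp fun z => ‖z‖ ^ 2
  obtain ⟨lam, hlam, h1, h2⟩ := exists_measurable_residual_le hR hvε hX' hm
    (fun ω => exists_multiplier_proxGrad hp (hρ' ω) (X' ω)) (hi.congr hsq)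
    ((integral_congr_ae hsq).symm.le.trans hv)
  have hXl : (fun ω => ‖gradient p.f (X' ω) + (fderiv ℝ p.c (X' ω)).adjoint (lam ω)‖ ^ 2) =ᵐ[P]
      fun ω => ‖gradient p.f (X ω) + (fderiv ℝ p.c (X ω)).adjoint (lam ω)‖ ^ 2 := by
    filter_upwards [hXX] with ω hω
    rw [hω]
  exact ⟨lam, hlam, h1.congr hXl, (integral_congr_ae hXl).symm.le.trans h2⟩

/-- `penalty_mul_theta_le` divided by ρ, with ‖Q‖ = L_ρ‖d‖. The constant C̄ is made for κ_g + ρκ_J ≤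
C̄ L_ρ, and ρ ≥ 1 gives L_ρ ≤ (L_g + L_J)ρ. -/
lemma theta_le_of_bounds (hp : p.Assumptions) {b : Bounds} (hb : b.Valid) {ε ρ ρlow : ℝ}
    (hε : 0 < ε) (hlow : 0 < ρlow) (hρlow : ρlow ≤ ρ) (hρ1 : 1 ≤ ρ) {x : Euc n}
    (hg : ‖gradient p.f x‖ ≤ b.κg) (hJ : ‖fderiv ℝ p.c x‖ ≤ b.κJ) :
    theta p.c x ≤ b.κg / ρlow + 2 * Cbar p b ε / √ρlow * ‖proxGrad p ρ x‖ +
      √(2 * Cbar p b ε) * √(p.Lg + p.LJ) / √ρlow * √‖proxGrad p ρ x‖ := by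
  have hρ0 : 0 < ρ := one_pos.trans_le hρ1
  have hL := Lrho_pos hp hρ0.le
  have hLg := hp.Lg_pos
  have hLJ := hp.LJ_pos
  have hκg := hb.κg_pos
  have hκJ := hb.κJ_pos
  have h := penalty_mul_theta_le hρ0.le hL (proxStep_min hp hρ0.le x (gradient p.f x))
  set d := ‖proxStep p ρ x (gradient p.f x)‖ with hd
  set Q := ‖proxGrad p ρ x‖ with hQ
  have hQd : Q = Lrho p ρ * d := norm_proxGrad hp hρ0.le x
  set D := (‖gradient p.f x‖ + ρ * ‖fderiv ℝ p.c x‖) * d with hD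
  have hd0 : 0 ≤ d := norm_nonneg _
  have hQ0 : 0 ≤ Q := norm_nonneg _
  have hC0 : 0 ≤ Cbar p b ε := by unfold Cbar; positivity
  have hDQ : D ≤ Cbar p b ε * Q := by
    have h1 : b.κg ≤ √(b.κg ^ 2 + 0.25 * ε) := Real.le_sqrt_of_sq_le (by linarith)
    have h2 : ‖gradient p.f x‖ + ρ * ‖fderiv ℝ p.c x‖ ≤ Cbar p b ε * Lrho p ρ := by
      have h3 : Cbar p b ε * Lrho p ρ = b.κJ / p.LJ * p.Lg + ρ * b.κJ +
          √(b.κg ^ 2 + 0.25 * ε) + √(b.κg ^ 2 + 0.25 * ε) / p.Lg * (ρ * p.LJ) := by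
        unfold Cbar Lrho; field_simp; ring
      have h4 : 0 ≤ b.κJ / p.LJ * p.Lg := by positivity
      have h5 : 0 ≤ √(b.κg ^ 2 + 0.25 * ε) / p.Lg * (ρ * p.LJ) := by positivity
      have h6 := mul_le_mul_of_nonneg_left hJ hρ0.le
      linarith
    calc D ≤ Cbar p b ε * Lrho p ρ * d := mul_le_mul_of_nonneg_right h2 hd0
      _ = Cbar p b ε * Q := by rw [hQd]; ring
  have hs0 : 0 < √ρlow := Real.sqrt_pos.2 hlow
  have hsρ : √ρlow ≤ ρ :=
    (Real.sqrt_le_sqrt hρlow).trans ((Real.sqrt_le_left hρ0.le).2 (by nlinarith))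
  have hLρ : Lrho p ρ ≤ (p.Lg + p.LJ) * ρ := by unfold Lrho; nlinarith
  have hsq : √(2 * Lrho p ρ * D) ≤
      ρ * (√(2 * Cbar p b ε) * √(p.Lg + p.LJ) / √ρlow * √Q) := by
    have h1 : 2 * Lrho p ρ * D ≤ (2 * Cbar p b ε) * (p.Lg + p.LJ) * Q * ρ := by
      calc 2 * Lrho p ρ * D ≤ 2 * ((p.Lg + p.LJ) * ρ) * (Cbar p b ε * Q) := by gcongr
        _ = _ := by ring
    have h2 : √(2 * Lrho p ρ * D) ≤ √(2 * Cbar p b ε) * √(p.Lg + p.LJ) * √Q * √ρ := by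
      refine (Real.sqrt_le_sqrt h1).trans (le_of_eq ?_)
      rw [Real.sqrt_mul (by positivity), Real.sqrt_mul (by positivity),
        Real.sqrt_mul (by positivity)]
    have h3 : √ρ ≤ ρ / √ρlow := by
      rw [le_div_iff₀ hs0]
      calc √ρ * √ρlow ≤ √ρ * √ρ := by gcongr
        _ = ρ := Real.mul_self_sqrt hρ0.le
    calc _ ≤ √(2 * Cbar p b ε) * √(p.Lg + p.LJ) * √Q * (ρ / √ρlow) := h2.trans (by gcongr)
      _ = _ := by ring
  have hg' : ‖gradient p.f x‖ ≤ ρ * (b.κg / ρlow) := by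
    refine hg.trans ?_
    rw [← mul_div_assoc, le_div_iff₀ hlow]
    nlinarith
  have hD' : 2 * D ≤ ρ * (2 * Cbar p b ε / √ρlow * Q) := by
    have : 2 * (Cbar p b ε * Q) ≤ ρ * (2 * Cbar p b ε / √ρlow * Q) := by
      have e : ρ * (2 * Cbar p b ε / √ρlow * Q) = 2 * (Cbar p b ε * Q) * (ρ / √ρlow) := by ring
      rw [e]
      exact le_mul_of_one_le_right (by positivity) ((one_le_div hs0).2 hsρ)
    linarith
  have hfin : ρ * theta p.c x ≤ ρ * (b.κg / ρlow + 2 * Cbar p b ε / √ρlow * Q +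
      √(2 * Cbar p b ε) * √(p.Lg + p.LJ) / √ρlow * √Q) := by linarith
  exact le_of_mul_le_mul_left hfin hρ0

/-- With e = ε^{1/4}, the first and half powers of ‖Q‖ are bounded by affine functions of ‖Q‖²,
whose mean is at most e⁴. This plays the role of Jensen's inequality and gives integrability at
once. -/
lemma integral_theta_le [IsProbabilityMeasure P] (hp : p.Assumptions) {b : Bounds} (hb : b.Valid)
    {ε ρlow : ℝ} (hε : 0 < ε) (hε1 : ε < 1) (hlow : 0 < ρlow) {ρ : Ω → ℝ} {X : Ω → Euc n}
    (hρlow : ∀ ω, ρlow ≤ ρ ω) (hρ1 : ∀ ω, 1 ≤ ρ ω) (hX : AEMeasurable X P)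
    (hbd : ∀ᵐ ω ∂P, ‖p.c (X ω)‖ ≤ b.κc ∧ ‖gradient p.f (X ω)‖ ≤ b.κg ∧
      ‖fderiv ℝ p.c (X ω)‖ ≤ b.κJ)
    (hi : Integrable (fun ω => ‖proxGrad p (ρ ω) (X ω)‖ ^ 2) P)
    (hv : ∫ ω, ‖proxGrad p (ρ ω) (X ω)‖ ^ 2 ∂P ≤ ε) :
    Integrable (fun ω => theta p.c (X ω)) P ∧ ∫ ω, theta p.c (X ω) ∂P ≤
      (2 * Cbar p b ε + √(2 * Cbar p b ε) * √(p.Lg + p.LJ)) / √ρlow * ε ^ (1 / 4 : ℝ) +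
        b.κg / ρlow := by
  have hκg := hb.κg_pos
  have hκJ := hb.κJ_pos
  have hLg := hp.Lg_pos
  have hLJ := hp.LJ_pos
  have hC0 : 0 ≤ Cbar p b ε := by unfold Cbar; positivity
  have hint : Integrable (fun ω => theta p.c (X ω)) P := by
    refine Integrable.of_bound
      ((continuous_theta hp.c_contDiff).measurable.comp_aemeasurable hX).aestronglyMeasurable b.κc ?_
    filter_upwards [hbd] with ω hω
    rw [Real.norm_of_nonneg (theta_nonneg _ _)]
    exact (theta_le_norm _ _).trans hω.1
  refine ⟨hint, ?_⟩
  set e := ε ^ (1 / 4 : ℝ) with he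
  have he0 : 0 < e := Real.rpow_pos_of_pos hε _
  have he1 : e ≤ 1 := Real.rpow_le_one hε.le hε1.le (by norm_num)
  have he4 : e ^ 4 = ε := by
    rw [he, ← Real.rpow_natCast, ← Real.rpow_mul hε.le]; norm_num
  set a₁ := 2 * Cbar p b ε / √ρlow with ha₁
  set a₂ := √(2 * Cbar p b ε) * √(p.Lg + p.LJ) / √ρlow with ha₂
  have ha₁0 : 0 ≤ a₁ := by positivity
  have ha₂0 : 0 ≤ a₂ := by positivity
  set T : Ω → ℝ := fun ω => ‖proxGrad p (ρ ω) (X ω)‖ ^ 2 with hT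
  have hle : ∀ᵐ ω ∂P, theta p.c (X ω) ≤
      (b.κg / ρlow + a₁ * (e / 2) + a₂ * (3 * e / 4)) +
        (a₁ / (2 * e) + a₂ / (4 * e ^ 3)) * T ω := by
    filter_upwards [hbd] with ω hω
    refine (theta_le_of_bounds hp hb hε hlow (hρlow ω) (hρ1 ω) hω.2.1 hω.2.2).trans ?_
    rw [← ha₁, ← ha₂]
    simp only [hT]
    set Q := ‖proxGrad p (ρ ω) (X ω)‖
    have hQ0 : 0 ≤ Q := norm_nonneg _
    -- Tangency at Q = e; in the mean this yields (e + e³)/2 ≤ e.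
    have h1 : Q ≤ e / 2 + Q ^ 2 / (2 * e) := by
      have : e / 2 + Q ^ 2 / (2 * e) - Q = (Q - e) ^ 2 / (2 * e) := by field_simp; ring
      have : 0 ≤ (Q - e) ^ 2 / (2 * e) := by positivity
      linarith
    -- Tangency at √Q = e; in the mean this yields exactly e.
    have h2 : √Q ≤ 3 * e / 4 + Q ^ 2 / (4 * e ^ 3) := by
      set u := √Q
      have hu : u ^ 2 = Q := Real.sq_sqrt hQ0
      have hu0 : 0 ≤ u := Real.sqrt_nonneg _
      rw [← hu]
      have : 3 * e / 4 + (u ^ 2) ^ 2 / (4 * e ^ 3) - u =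
          (u - e) ^ 2 * (u ^ 2 + 2 * u * e + 3 * e ^ 2) / (4 * e ^ 3) := by field_simp; ring
      have : 0 ≤ (u - e) ^ 2 * (u ^ 2 + 2 * u * e + 3 * e ^ 2) / (4 * e ^ 3) := by positivity
      linarith
    have h3 := mul_le_mul_of_nonneg_left h1 ha₁0
    have h4 := mul_le_mul_of_nonneg_left h2 ha₂0
    have h5 : (a₁ / (2 * e) + a₂ / (4 * e ^ 3)) * Q ^ 2 =
        a₁ * (Q ^ 2 / (2 * e)) + a₂ * (Q ^ 2 / (4 * e ^ 3)) := by ring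
    linarith
  have hb2 := integral_mono_ae hint ((integrable_const _).add (hi.const_mul _)) hle
  rw [integral_add' (integrable_const _) (hi.const_mul _), integral_const_mul] at hb2
  simp only [integral_const, probReal_univ, one_smul] at hb2
  refine hb2.trans ?_
  have h6 : (a₁ / (2 * e) + a₂ / (4 * e ^ 3)) * ∫ ω, T ω ∂P ≤
      (a₁ / (2 * e) + a₂ / (4 * e ^ 3)) * e ^ 4 := by
    rw [he4]; gcongr
  have h7 : (a₁ / (2 * e) + a₂ / (4 * e ^ 3)) * e ^ 4 = a₁ * (e ^ 3 / 2) + a₂ * (e / 4) := by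
    field_simp
  have h8 : e ^ 3 ≤ e := by
    calc e ^ 3 ≤ e ^ 1 := pow_le_pow_of_le_one he0.le he1 (by norm_num)
      _ = e := pow_one e
  have h9 : a₁ * (e ^ 3 / 2) ≤ a₁ * (e / 2) := by gcongr
  have h10 : (2 * Cbar p b ε + √(2 * Cbar p b ε) * √(p.Lg + p.LJ)) / √ρlow * e =
      a₁ * e + a₂ * e := by rw [ha₁, ha₂]; ring
  rw [h10]
  linarith

end Criticality

/-! ### Bounds for the constants and the budget -/

section Constants

variable {n q : ℕ} {Ξ : Type*} [MeasurableSpace Ξ] {p : Problem n q Ξ} {s : Settings n}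
  {b : Bounds} {ε : ℝ}

lemma Cbar_pos (hp : p.Assumptions) (hb : b.Valid) : 0 < Cbar p b ε := by
  have := hp.Lg_pos; have := hp.LJ_pos; have := hb.κJ_pos
  unfold Cbar
  positivity

lemma Ctilde_nonneg : 0 ≤ Ctilde p s b ε :=
  le_max_of_le_left (by positivity)

/-- Monotonicity in ε replaces C̃ by its value at ε = 1, which makes the complexity constants
independent of ε. -/
lemma Ctilde_le_one (hp : p.Assumptions) (hs : s.Valid p) (hb : b.Valid) (hε1 : ε < 1) :
    Ctilde p s b ε ≤ Ctilde p s b 1 := by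
  have h1 := hp.Lg_pos
  have h2 := hp.LJ_pos
  have h3 := hb.κg_pos
  have h4 := hb.κJ_pos
  have hξ : 0 < 1 - s.ξ := sub_pos.2 hs.ξ_lt
  have hC : Cbar p b ε ≤ Cbar p b 1 := by unfold Cbar; gcongr
  have hC0 : 0 < Cbar p b ε := Cbar_pos hp hb
  refine max_le_max ?_ ?_
  · gcongr
  · gcongr

/-- When the penalty parameter has reached `rhoBar`, the infeasibility is at most `√ε`. -/
lemma theta_bound_le_sqrt (hp : p.Assumptions) (hs : s.Valid p) (hb : b.Valid) (hε : 0 < ε)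
    {ρ : ℝ} (hρ0 : 0 < ρ) (hρ : rhoBar p s b ε ≤ ρ) :
    (2 * Cbar p b ε + √(2 * Cbar p b ε) * √(p.Lg + p.LJ)) / √ρ * ε ^ (1 / 4 : ℝ) +
        b.κg / ρ ≤ √ε := by
  have hκg := hb.κg_pos
  have hC := Cbar_pos (ε := ε) hp hb
  have hξ0 := hs.ξ_pos
  have hξ1 : 0 < 1 - s.ξ := sub_pos.2 hs.ξ_lt
  set Z := 2 * Cbar p b ε + √(2 * Cbar p b ε) * √(p.Lg + p.LJ) with hZ
  have hZ0 : 0 ≤ Z := by positivity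
  set e := ε ^ (1 / 4 : ℝ) with he
  have he0 : 0 < e := Real.rpow_pos_of_pos hε _
  have he2 : e ^ 2 = √ε := by
    rw [he, ← Real.rpow_natCast, ← Real.rpow_mul hε.le, Real.sqrt_eq_rpow]; norm_num
  have hs0 : 0 < √ρ := Real.sqrt_pos.2 hρ0
  rw [rhoBar, ← he2] at hρ
  -- The two entries of the maximum in C̃ each bring one of the two terms below √ε / 2.
  have hA : (2 * Z) ^ 2 ≤ Ctilde p s b ε := by
    have h8 : √(8 * Cbar p b ε) = 2 * √(2 * Cbar p b ε) := by
      rw [show 8 * Cbar p b ε = 2 ^ 2 * (2 * Cbar p b ε) by ring,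
        Real.sqrt_mul (by norm_num), Real.sqrt_sq (by norm_num)]
    have h9 : 4 * Cbar p b ε + √(8 * Cbar p b ε) * √(p.Lg + p.LJ) = 2 * Z := by
      rw [h8, hZ]; ring
    refine le_trans ?_ (le_max_left _ _)
    rw [h9]
    exact le_div_self (sq_nonneg _) (by positivity) (pow_le_one₀ hξ0.le hs.ξ_lt.le)
  have hB : 2 * b.κg ≤ Ctilde p s b ε := by
    refine le_trans ?_ (le_max_right _ _)
    have h1 : 2 * b.κg ≤ √(4 * b.κg ^ 2 + ε) := Real.le_sqrt_of_sq_le (by nlinarith)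
    exact h1.trans (le_div_self (Real.sqrt_nonneg _) hξ1 (by linarith))
  have h1 : 2 * Z / e ≤ √ρ := by
    refine Real.le_sqrt_of_sq_le (le_trans ?_ hρ)
    rw [div_pow]
    gcongr
  have h2 : Z / √ρ * e ≤ e ^ 2 / 2 := by
    rw [div_le_iff₀ he0] at h1
    rw [div_mul_eq_mul_div, div_le_iff₀ hs0]
    nlinarith
  have h3 : b.κg / ρ ≤ e ^ 2 / 2 := by
    rw [div_le_iff₀ (by positivity)] at hρ
    rw [div_le_iff₀ hρ0]
    linarith
  rw [← he2]
  linarith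

/-- The constant in the bound for the number of oracle calls of one subproblem. -/
noncomputable def callConst (p : Problem n q Ξ) (s : Settings n) (b : Bounds) : ℝ :=
  (4 * (b.κf + b.κc + |p.flow|) * C2 p s + 4 * (p.Lg + p.LJ) * C3 p s) ^ 2 +
    128 * (p.Lg + p.LJ) * (b.κf + b.κc + |p.flow|) + C1 p s / p.Lg ^ 2 + 1

lemma callConst_nonneg (hp : p.Assumptions) (hs : s.Valid p) (hb : b.Valid) :
    0 ≤ callConst p s b := by
  have := hp.Lg_pos; have := hp.LJ_pos; have := hb.κf_pos; have := hb.κc_pos; have := hs.Dt_pos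
  unfold callConst C1
  positivity

/-- For ρ ≥ 1 both L_ρ and the gap grow at most linearly in ρ, and every term is at most a multiple
of ρ²/ε² ≥ 1. The added 1 absorbs the rounding of the budget. -/
lemma budgetBound_add_one_le (hp : p.Assumptions) (hs : s.Valid p) (hb : b.Valid) (hε : 0 < ε)
    (hε1 : ε < 1) {ρ : ℝ} (hρ : 1 ≤ ρ) {x : Euc n} (hf : p.f x ≤ b.κf) (hc : ‖p.c x‖ ≤ b.κc) :
    budgetBound p s ε ρ x + 1 ≤ callConst p s b * (ρ ^ 2 / ε ^ 2) := by
  have hρ0 : 0 < ρ := one_pos.trans_le hρ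
  have hL := Lrho_pos hp hρ0.le
  have hD := gap_nonneg hs hρ0 x
  have hLg := hp.Lg_pos
  have hLJ := hp.LJ_pos
  have hκf := hb.κf_pos
  have hκc := hb.κc_pos
  have hσ := hp.σ_pos
  have hDt := hs.Dt_pos
  have hC1 : 0 ≤ C1 p s := by unfold C1; positivity
  have hC2 : 0 ≤ C2 p s := by unfold C2; positivity
  have hC3 : 0 ≤ C3 p s := by unfold C3; positivity
  set M := b.κf + b.κc + |p.flow| with hM
  have hM0 : 0 ≤ M := by positivity
  have hDM : gap p s ρ x ≤ M * ρ := by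
    have h1 := hs.flow_le ρ hρ0
    have h2 := mul_le_mul_of_nonneg_left hc hρ0.le
    have h3 := neg_abs_le p.flow
    have h4 : b.κf ≤ b.κf * ρ := le_mul_of_one_le_right hκf.le hρ
    have h5 : |p.flow| ≤ |p.flow| * ρ := le_mul_of_one_le_right (abs_nonneg _) hρ
    unfold gap penalty
    rw [hM, add_mul, add_mul]
    linarith
  have hLM : Lrho p ρ ≤ (p.Lg + p.LJ) * ρ := by unfold Lrho; nlinarith
  have hLlow : p.Lg ≤ Lrho p ρ := le_add_of_nonneg_right (by positivity)
  have hr1 : 1 ≤ ρ ^ 2 / ε ^ 2 := by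
    rw [one_le_div (by positivity)]
    exact pow_le_pow_left₀ hε.le (by linarith) 2
  have t1 : (4 * gap p s ρ x * C2 p s + 4 * Lrho p ρ * C3 p s) ^ 2 / ε ^ 2 ≤
      (4 * M * C2 p s + 4 * (p.Lg + p.LJ) * C3 p s) ^ 2 * (ρ ^ 2 / ε ^ 2) := by
    calc _ ≤ (4 * (M * ρ) * C2 p s + 4 * ((p.Lg + p.LJ) * ρ) * C3 p s) ^ 2 / ε ^ 2 := by gcongr
      _ = _ := by ring
  have t2 : 128 * Lrho p ρ * gap p s ρ x / ε ≤
      128 * (p.Lg + p.LJ) * M * (ρ ^ 2 / ε ^ 2) := by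
    calc _ ≤ 128 * ((p.Lg + p.LJ) * ρ) * (M * ρ) / ε ^ 2 := by
          gcongr
          nlinarith
      _ = _ := by ring
  have t3 : C1 p s / Lrho p ρ ^ 2 ≤ C1 p s / p.Lg ^ 2 * (ρ ^ 2 / ε ^ 2) := by
    calc _ ≤ C1 p s / p.Lg ^ 2 := by gcongr
      _ ≤ _ := le_mul_of_one_le_right (by positivity) hr1
  have t4 : budgetBound p s ε ρ x ≤
      ((4 * gap p s ρ x * C2 p s + 4 * Lrho p ρ * C3 p s) ^ 2 / ε ^ 2 +
        128 * Lrho p ρ * gap p s ρ x / ε) + C1 p s / Lrho p ρ ^ 2 :=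
    max_le_add_of_nonneg (by positivity) (by positivity)
  unfold callConst
  rw [← hM, add_mul, add_mul, add_mul, one_mul]
  linarith

/-- The constant in the bound for the penalty parameter that first reaches `rhoBar`. -/
noncomputable def lastRhoConst (p : Problem n q Ξ) (s : Settings n) (b : Bounds)
    (Λ : ℝ) : ℝ :=
  4 * Λ * (Ctilde p s b 1 + s.ρ₀ + s.τ) / (1 - s.ξ)

/-- The constant in the bound for the total number of oracle calls. -/
noncomputable def totalCallConst (p : Problem n q Ξ) (s : Settings n) (b : Bounds)
    (Λ : ℝ) : ℝ :=
  2 * Λ * callConst p s b * (Ctilde p s b 1 ^ 3 / s.τ + lastRhoConst p s b Λ ^ 2)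

end Constants

/-! ### The hitting time of ρ̄ and the final estimates -/

section Main

variable {n q : ℕ} {Ξ : Type*} [MeasurableSpace Ξ] {p : Problem n q Ξ} {s : Settings n}
  {b : Bounds} {ε : ℝ} {N : ℕ} {Ω : Type*} [mΩ : MeasurableSpace Ω] {P : Measure Ω}

namespace Run

section Hit

variable (r : Run p s ε N P)

lemma rhoBar_le_of_Nhat (hs : s.Valid p) {k : ℕ} (hkN : k < N)
    (hk : Nhat p s b ε ≤ (k : ℤ) + 1) (ω : Ω) : rhoBar p s b ε ≤ r.ρ k ω := by
  have hτ := hs.τ_pos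
  have h1 : rhoBar p s b ε / s.τ - s.ρ₀ / s.τ + 1 ≤ ((k : ℤ) + 1 : ℤ) :=
    (Int.le_ceil _).trans (by exact_mod_cast hk)
  push_cast at h1
  have h2 : (rhoBar p s b ε - s.ρ₀) / s.τ ≤ k := by rw [sub_div]; linarith
  rw [div_le_iff₀ hτ] at h2
  linarith [r.le_rho ω k hkN]

lemma hit_spec (hs : s.Valid p) (hN : 2 ≤ N) (hNhat : Nhat p s b ε ≤ (N : ℤ)) (ω : Ω) :
    1 ≤ r.hit (rhoBar p s b ε) ω ∧ r.hit (rhoBar p s b ε) ω + 1 ≤ N ∧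
      (r.hit (rhoBar p s b ε) ω : ℤ) + 1 ≤ max 2 (Nhat p s b ε) ∧
      rhoBar p s b ε ≤ r.ρ (r.hit (rhoBar p s b ε) ω) ω := by
  -- By ρ_k ≥ ρ₀ + kτ the threshold is reached at k₀ at the latest. Since k₀ < N, the values of ρ
  -- beyond the run do not influence the hitting time.
  set k₀ := max 1 (Nhat p s b ε - 1).toNat with hk₀
  have hk₀N : k₀ < N := by omega
  have hmem : k₀ ∈ {k : ℕ | 1 ≤ k ∧ rhoBar p s b ε ≤ r.ρ k ω} :=
    ⟨le_max_left _ _, r.rhoBar_le_of_Nhat hs hk₀N (by omega) ω⟩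
  have h1 : r.hit (rhoBar p s b ε) ω ≤ k₀ := Nat.sInf_le hmem
  have h2 := Nat.sInf_mem ⟨k₀, hmem⟩
  refine ⟨h2.1, by omega, ?_, h2.2⟩
  omega

lemma lt_of_lt_hit {ρbar : ℝ} {ω : Ω} {k : ℕ} (hk1 : 1 ≤ k) (hk : k < r.hit ρbar ω) :
    r.ρ k ω < ρbar := by
  by_contra h
  exact Nat.notMem_of_lt_sInf hk ⟨hk1, not_lt.1 h⟩

lemma hist_one_mono {j k : ℕ} (hj : 1 ≤ j) (hjk : j ≤ k) (hk : k < N) :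
    (r.hist j 1 : MeasurableSpace Ω) ≤ r.hist k 1 := by
  induction k, hjk using Nat.le_induction with
  | base => exact le_rfl
  | succ k hjk ih => exact (ih (by omega)).trans (r.hist_le k (by omega) (by omega) 1)

/-- Step (a) fixes ρ_k before the oracle of iteration k is called, so whether k is the hitting time
is already decided at the start of iteration k. -/
lemma measurableSet_hit (hs : s.Valid p) (hN : 2 ≤ N) (hNhat : Nhat p s b ε ≤ (N : ℤ)) {k : ℕ}
    (hk1 : 1 ≤ k) (hk : k < N) :
    MeasurableSet[r.hist k 1] (r.hit (rhoBar p s b ε) ⁻¹' {k}) := by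
  have hset : r.hit (rhoBar p s b ε) ⁻¹' {k} = r.ρ k ⁻¹' Set.Ici (rhoBar p s b ε) ∩
      ⋂ j ∈ Finset.Ico 1 k, r.ρ j ⁻¹' Set.Iio (rhoBar p s b ε) := by
    ext ω
    simp only [Set.mem_preimage, Set.mem_singleton_iff, Set.mem_inter_iff, Set.mem_Ici,
      Set.mem_iInter, Finset.mem_Ico, Set.mem_Iio]
    have hspec := r.hit_spec (b := b) hs hN hNhat ω
    constructor
    · rintro rfl
      exact ⟨hspec.2.2.2, fun j hj => r.lt_of_lt_hit hj.1 hj.2⟩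
    · rintro ⟨h1, h2⟩
      refine le_antisymm (Nat.sInf_le ⟨hk1, h1⟩) (not_lt.1 fun hlt => ?_)
      exact absurd hspec.2.2.2 (not_le.2 (h2 _ ⟨hspec.1, hlt⟩))
  rw [hset]
  refine MeasurableSet.inter (r.ρ_measurable k hk1 hk measurableSet_Ici) ?_
  refine Finset.measurableSet_biInter _ fun j hj => ?_
  have hj' := Finset.mem_Ico.1 hj
  exact r.hist_one_mono hj'.1 hj'.2.le hk _
    (r.ρ_measurable j hj'.1 (by omega) measurableSet_Iio)

end Hit

variable [IsProbabilityMeasure P] (r : Run p s ε N P)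

/-- Criticality of the outer iterate that follows a random outer iteration `K`. -/
lemma random_iterate (hp : p.Assumptions) (hs : s.Valid p) (hb : b.Valid)
    (hε : 0 < ε) (hε1 : ε < 1) (hr : r.BoundedBy b) {K : Ω → ℕ}
    (hK : ∀ ω, 1 ≤ K ω ∧ K ω < N)
    (hKm : ∀ k, 1 ≤ k → k < N → MeasurableSet[r.hist k 1] (K ⁻¹' {k})) {ρlow : ℝ}
    (hlow : 0 < ρlow) (hρlow : ∀ ω, ρlow ≤ r.ρ (K ω) ω) :
    HasMultiplier p.f p.c P (fun ω => r.x (K ω + 1) ω) ε ∧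
      Integrable (fun ω => theta p.c (r.x (K ω + 1) ω)) P ∧
      ∫ ω, theta p.c (r.x (K ω + 1) ω) ∂P ≤
        (2 * Cbar p b ε + √(2 * Cbar p b ε) * √(p.Lg + p.LJ)) / √ρlow * ε ^ (1 / 4 : ℝ) +
          b.κg / ρlow := by
  have hKm' : ∀ k, 1 ≤ k → k < N → MeasurableSet (K ⁻¹' {k}) := fun k h1 h2 =>
    (r.hist k).le 1 _ (hKm k h1 h2)
  have hX : AEMeasurable (fun ω => r.x (K ω + 1) ω) P :=
    aemeasurable_random (f := fun k => r.x (k + 1)) (fun k h1 h2 => r.aemeasurable_x_succ h1 h2)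
      hK hKm'
  have hρ : AEMeasurable (fun ω => r.ρ (K ω) ω) P :=
    aemeasurable_random (f := r.ρ)
      (fun k h1 h2 => ((r.ρ_measurable k h1 h2).mono ((r.hist k).le 1) le_rfl).aemeasurable)
      hK hKm'
  have hρ1 : ∀ ω, 1 ≤ r.ρ (K ω) ω := fun ω => r.one_le_rho hs (hK ω).2 ω
  have hρ0 : ∀ ω, 0 ≤ r.ρ (K ω) ω := fun ω => zero_le_one.trans (hρ1 ω)
  obtain ⟨ρ', X', -, -, -, hm, heq⟩ := exists_measurable_proxGrad hp hρ hρ0 hX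
  obtain ⟨hi, hv⟩ := integrable_sq_of_lintegral_le ⟨_, hm, heq⟩ (by positivity)
    (r.lintegral_proxGrad_random_le hp hs hε hK hKm)
  refine ⟨hasMultiplier_of_proxGrad hp (by linarith) hρ hρ0 hX hi hv,
    integral_theta_le hp hb hε hε1 hlow hρlow hρ1 hX ?_ hi (hv.trans (by linarith))⟩
  have hall : ∀ᵐ ω ∂P, ∀ k, 1 ≤ k → k ≤ N → ‖p.c (r.x k ω)‖ ≤ b.κc ∧
      ‖gradient p.f (r.x k ω)‖ ≤ b.κg ∧ ‖fderiv ℝ p.c (r.x k ω)‖ ≤ b.κJ := by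
    refine ae_all_iff.2 fun k => ?_
    by_cases hk : 1 ≤ k ∧ k ≤ N
    · filter_upwards [hr k hk.1 hk.2] with ω hω _ _ using hω.2
    · exact Filter.Eventually.of_forall fun ω h1 h2 => absurd ⟨h1, h2⟩ hk
  filter_upwards [hall] with ω hω
  exact hω _ (by omega) (hK ω).2

lemma ae_calls_le (hp : p.Assumptions) (hs : s.Valid p) (hb : b.Valid)
    (hε : 0 < ε) (hε1 : ε < 1) (hr : r.BoundedBy b) {Λ : ℝ} (hΛ : 1 ≤ Λ)
    (he : r.EconomicalBudgets Λ) :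
    ∀ᵐ ω ∂P, ∀ k, 1 ≤ k → k < N →
      (r.calls k ω : ℝ) ≤ 2 * Λ * callConst p s b * (r.ρ k ω ^ 2 / ε ^ 2) := by
  refine ae_all_iff.2 fun k => ?_
  by_cases hk : 1 ≤ k ∧ k < N
  · filter_upwards [hr k hk.1 hk.2.le, r.ae_R_mem hk.1 hk.2] with ω hω hR _ _
    have h1 : r.calls k ω ≤ 2 * r.budget k ω :=
      (Nat.mul_le_mul_left _ hR.2).trans
        (batchSize_mul_innerLimit_le (r.one_le_budget hp hs hk.1 hk.2 ω))
    have h1' : (r.calls k ω : ℝ) ≤ 2 * r.budget k ω := by exact_mod_cast h1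
    have h2 := he k hk.1 hk.2 ω
    have h3 := budgetBound_add_one_le hp hs hb hε hε1 (r.one_le_rho hs hk.2 ω) hω.1 hω.2.1
    have hσ := hp.σ_pos
    have hDt := hs.Dt_pos
    have h4 : (⌈budgetBound p s ε (r.ρ k ω) (r.x k ω)⌉₊ : ℝ) ≤
        budgetBound p s ε (r.ρ k ω) (r.x k ω) + 1 := by
      refine (Nat.ceil_lt_add_one (le_max_of_le_right ?_)).le
      unfold C1; positivity
    have h5 := mul_le_mul_of_nonneg_left (h4.trans h3) (zero_le_one.trans hΛ)
    linarith
  · exact Filter.Eventually.of_forall fun ω h1 h2 => absurd ⟨h1, h2⟩ hk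

omit [IsProbabilityMeasure P] in
-- One of the two candidates of `steering_admissible` for ρ_{k-1} + τ is admissible, and the larger
-- one bounds both.
lemma rho_le_of_economical (hs : s.Valid p) {Λ : ℝ} (hΛ : 1 ≤ Λ) (he : r.EconomicalPenalties Λ)
    {k : ℕ} (hk1 : 1 ≤ k) (hk : k < N) (ω : Ω) :
    r.ρ k ω ≤ Λ * (4 * (r.ρ (k - 1) ω + s.τ) / (1 - s.ξ)) := by
  have hξ0 := hs.ξ_pos
  have hξ1 : 0 < 1 - s.ξ := sub_pos.2 hs.ξ_lt
  have hρ' : 0 < r.ρ (k - 1) ω + s.τ :=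
    add_pos_of_nonneg_of_pos (r.rho_nonneg hs (by omega) ω) hs.τ_pos
  have hle : r.ρ (k - 1) ω + s.τ ≤ 4 * (r.ρ (k - 1) ω + s.τ) / (1 - s.ξ) := by
    rw [le_div_iff₀ hξ1]
    nlinarith
  rcases steering_admissible (c := p.c) hξ0 hs.ξ_lt hρ' (r.x k ω) (r.g k ω) with h | h
  · exact (he k hk1 hk ω _ le_rfl h).trans
      (mul_le_mul_of_nonneg_left hle (zero_le_one.trans hΛ))
  · exact he k hk1 hk ω _ hle h

/-! ### Counting oracle calls -/

section Complexity

variable (hp : p.Assumptions) (hs : s.Valid p) (hb : b.Valid) (hε : 0 < ε) (hε1 : ε < 1)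
  (hN : 2 ≤ N) (hNhat : Nhat p s b ε ≤ (N : ℤ)) (hr : r.BoundedBy b) {Λ : ℝ} (hΛ : 1 ≤ Λ)
  (he : r.EconomicalBudgets Λ)
include hp hs hb hε hε1 hN hNhat hr hΛ he

lemma ae_sum_calls_before_hit_le :
    ∀ᵐ ω ∂P, ((∑ k ∈ Finset.Ico 1 (r.hit (rhoBar p s b ε) ω), r.calls k ω : ℕ) : ℝ) ≤
      2 * Λ * callConst p s b * (Ctilde p s b 1 ^ 3 / s.τ) * (1 / √ε) ^ 7 := by
  have hc := callConst_nonneg hp hs hb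
  have hτ := hs.τ_pos
  have hsε : 0 < √ε := Real.sqrt_pos.2 hε
  have hε4 : √ε ^ 4 = ε ^ 2 := by
    rw [show √ε ^ 4 = (√ε ^ 2) ^ 2 by ring, Real.sq_sqrt hε.le]
  have hC1 : 0 ≤ Ctilde p s b 1 := Ctilde_nonneg
  have hbar0 : 0 ≤ rhoBar p s b ε := div_nonneg Ctilde_nonneg hsε.le
  have hbar : rhoBar p s b ε ≤ Ctilde p s b 1 / √ε := by
    unfold rhoBar
    have := Ctilde_le_one hp hs hb hε1
    gcongr
  filter_upwards [r.ae_calls_le hp hs hb hε hε1 hr hΛ he] with ω hω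
  have hspec := r.hit_spec (b := b) hs hN hNhat ω
  set K := r.hit (rhoBar p s b ε) ω with hK
  -- From ρ₀ + (K-1)τ ≤ ρ_{K-1} < ρ̄; for K = 1 there is nothing to count.
  have hK1 : ((K - 1 : ℕ) : ℝ) ≤ rhoBar p s b ε / s.τ := by
    rw [le_div_iff₀ hτ]
    rcases Nat.lt_or_ge 1 K with h | h
    · have h1 := r.le_rho ω (K - 1) (by omega)
      have h2 := r.lt_of_lt_hit (ρbar := rhoBar p s b ε) (ω := ω) (k := K - 1) (by omega)
        (by omega)
      have := hs.ρ₀_ge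
      linarith
    · rw [show K - 1 = 0 by omega]; simpa using hbar0
  push_cast
  have hsum : ∑ k ∈ Finset.Ico 1 K, (r.calls k ω : ℝ) ≤
      (K - 1 : ℕ) • (2 * Λ * callConst p s b * (rhoBar p s b ε ^ 2 / ε ^ 2)) := by
    rw [← Nat.card_Ico]
    refine Finset.sum_le_card_nsmul _ _ _ fun k hk => ?_
    have hk' := Finset.mem_Ico.1 hk
    refine (hω k hk'.1 (by omega)).trans ?_
    have h1 := r.lt_of_lt_hit hk'.1 hk'.2
    have h2 := r.rho_nonneg hs (k := k) (by omega) ω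
    gcongr
  refine hsum.trans ?_
  rw [nsmul_eq_mul]
  calc ((K - 1 : ℕ) : ℝ) * (2 * Λ * callConst p s b * (rhoBar p s b ε ^ 2 / ε ^ 2))
      ≤ rhoBar p s b ε / s.τ * (2 * Λ * callConst p s b * (rhoBar p s b ε ^ 2 / ε ^ 2)) := by
        gcongr
    _ ≤ (Ctilde p s b 1 / √ε) / s.τ *
        (2 * Λ * callConst p s b * ((Ctilde p s b 1 / √ε) ^ 2 / ε ^ 2)) := by gcongr
    _ = _ := by rw [← hε4]; field_simp

lemma ae_calls_hit_le (hep : r.EconomicalPenalties Λ) :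
    ∀ᵐ ω ∂P, (r.calls (r.hit (rhoBar p s b ε) ω) ω : ℝ) ≤
      2 * Λ * callConst p s b * lastRhoConst p s b Λ ^ 2 * (1 / √ε) ^ 7 := by
  have hc := callConst_nonneg hp hs hb
  have hτ := hs.τ_pos
  have hξ1 : 0 < 1 - s.ξ := sub_pos.2 hs.ξ_lt
  have hρ₀ := hs.ρ₀_ge
  have hsε : 0 < √ε := Real.sqrt_pos.2 hε
  have hε4 : √ε ^ 4 = ε ^ 2 := by
    rw [show √ε ^ 4 = (√ε ^ 2) ^ 2 by ring, Real.sq_sqrt hε.le]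
  have hw : 1 ≤ 1 / √ε := by
    rw [one_le_div hsε]
    exact Real.sqrt_le_one.2 hε1.le
  have hbar : rhoBar p s b ε ≤ Ctilde p s b 1 * (1 / √ε) := by
    unfold rhoBar
    rw [mul_one_div]
    have := Ctilde_le_one hp hs hb hε1
    gcongr
  have hC1 : 0 ≤ Ctilde p s b 1 := Ctilde_nonneg
  filter_upwards [r.ae_calls_le hp hs hb hε hε1 hr hΛ he] with ω hω
  have hspec := r.hit_spec (b := b) hs hN hNhat ω
  set K := r.hit (rhoBar p s b ε) ω with hK
  -- For K = 1 the previous value is the input ρ₀, which may exceed ρ̄; this is why ρ₀ enters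
  -- `lastRhoConst`.
  have hprev : r.ρ (K - 1) ω ≤ (Ctilde p s b 1 + s.ρ₀) * (1 / √ε) := by
    rcases Nat.lt_or_ge 1 K with h | h
    · have h2 := r.lt_of_lt_hit (ρbar := rhoBar p s b ε) (ω := ω) (k := K - 1) (by omega)
        (by omega)
      nlinarith
    · rw [show K - 1 = 0 by omega, r.ρ_zero]
      nlinarith
  have hlast : r.ρ K ω ≤ lastRhoConst p s b Λ * (1 / √ε) := by
    refine (r.rho_le_of_economical hs hΛ hep hspec.1 (by omega) ω).trans ?_
    have h1 : r.ρ (K - 1) ω + s.τ ≤ (Ctilde p s b 1 + s.ρ₀ + s.τ) * (1 / √ε) := by nlinarith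
    calc Λ * (4 * (r.ρ (K - 1) ω + s.τ) / (1 - s.ξ))
        ≤ Λ * (4 * ((Ctilde p s b 1 + s.ρ₀ + s.τ) * (1 / √ε)) / (1 - s.ξ)) := by gcongr
      _ = _ := by unfold lastRhoConst; ring
  have hρ0 := r.rho_nonneg hs (k := K) (by omega) ω
  refine (hω K hspec.1 (by omega)).trans ?_
  calc 2 * Λ * callConst p s b * (r.ρ K ω ^ 2 / ε ^ 2)
      ≤ 2 * Λ * callConst p s b * ((lastRhoConst p s b Λ * (1 / √ε)) ^ 2 / ε ^ 2) := by gcongr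
    _ = 2 * Λ * callConst p s b * lastRhoConst p s b Λ ^ 2 * (1 / √ε) ^ 6 := by
      rw [← hε4]; field_simp
    _ ≤ _ := by
      gcongr
      norm_num

end Complexity

end Run

lemma rpow_neg_seven_half (hε : 0 < ε) : ε ^ (-(7 / 2) : ℝ) = (1 / √ε) ^ 7 := by
  rw [one_div, inv_pow, Real.sqrt_eq_rpow, ← Real.rpow_natCast, ← Real.rpow_mul hε.le,
    ← Real.rpow_neg hε.le]
  norm_num

end Main

end PenaltySFO

theorem mainTheorem1 {n q : ℕ} {Ξ : Type*} [MeasurableSpace Ξ]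
    (p : PenaltySFO.Problem n q Ξ) (hp : p.Assumptions)
    (s : PenaltySFO.Settings n) (hs : s.Valid p)
    (b : PenaltySFO.Bounds) (hb : b.Valid) :
    -- the output of the penalty method
    (∀ (ε : ℝ), 0 < ε → ε < 1 → ∀ (N : ℕ), 2 ≤ N →
      ∀ (Ω : Type*) [MeasurableSpace Ω] (P : Measure Ω) [IsProbabilityMeasure P]
        (r : PenaltySFO.Run p s ε N P), r.BoundedBy b →
        Integrable (fun ω => PenaltySFO.theta p.c (r.x N ω)) P ∧
        ∫ ω, PenaltySFO.theta p.c (r.x N ω) ∂P ≤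
          (2 * PenaltySFO.Cbar p b ε + √(2 * PenaltySFO.Cbar p b ε) * √(p.Lg + p.LJ)) /
              (s.ξ * √(s.ρ₀ + ((N : ℝ) - 1) * s.τ)) * ε ^ (1 / 4 : ℝ) +
            √(b.κg ^ 2 + 0.25 * ε) / ((1 - s.ξ) * (s.ρ₀ + ((N : ℝ) - 1) * s.τ)) ∧
        PenaltySFO.HasMultiplier p.f p.c P (r.x N) ε ∧
        (PenaltySFO.Nhat p s b ε ≤ (N : ℤ) →
          PenaltySFO.IsStochasticCritical p.f p.c P (r.x N) ε)) ∧
    -- the total number of oracle calls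
    (∀ Λ : ℝ, 1 ≤ Λ → ∃ C : ℝ, ∀ (ε : ℝ), 0 < ε → ε < 1 →
      ∀ (N : ℕ), 2 ≤ N → PenaltySFO.Nhat p s b ε ≤ (N : ℤ) →
      ∀ (Ω : Type*) [MeasurableSpace Ω] (P : Measure Ω) [IsProbabilityMeasure P]
        (r : PenaltySFO.Run p s ε N P), r.BoundedBy b →
        (∀ ω, 1 ≤ r.hit (PenaltySFO.rhoBar p s b ε) ω ∧
          r.hit (PenaltySFO.rhoBar p s b ε) ω + 1 ≤ N ∧
          (r.hit (PenaltySFO.rhoBar p s b ε) ω : ℤ) + 1 ≤ max 2 (PenaltySFO.Nhat p s b ε)) ∧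
        PenaltySFO.IsStochasticCritical p.f p.c P
          (fun ω => r.x (r.hit (PenaltySFO.rhoBar p s b ε) ω + 1) ω) ε ∧
        (r.EconomicalBudgets Λ →
          (∀ᵐ ω ∂P, ((∑ k ∈ Finset.Ico 1 (r.hit (PenaltySFO.rhoBar p s b ε) ω),
              r.calls k ω : ℕ) : ℝ) ≤ C * ε ^ (-(7 / 2) : ℝ)) ∧
          (r.EconomicalPenalties Λ →
            ∀ᵐ ω ∂P, ((∑ k ∈ Finset.Ico 1 (r.hit (PenaltySFO.rhoBar p s b ε) ω + 1),
              r.calls k ω : ℕ) : ℝ) ≤ C * ε ^ (-(7 / 2) : ℝ)))) := by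
  refine ⟨fun ε hε hε1 N hN Ω _ P _ r hr => ?_, fun Λ hΛ => ?_⟩
  · have hcast : ((N - 1 : ℕ) : ℝ) = (N : ℝ) - 1 := by
      rw [Nat.cast_sub (by omega), Nat.cast_one]
    have hNN : N - 1 + 1 = N := by omega
    have hτ := hs.τ_pos
    have hρ₀ := hs.ρ₀_ge
    have hξ0 := hs.ξ_pos
    have hξ1 : 0 < 1 - s.ξ := sub_pos.2 hs.ξ_lt
    have hκg := hb.κg_pos
    have hC := PenaltySFO.Cbar_pos (ε := ε) hp hb
    have hlow : 0 < s.ρ₀ + ((N : ℝ) - 1) * s.τ := by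
      rw [← hcast]; positivity
    -- The output x_N is returned by iteration N - 1, where ρ ≥ ρ₀ + (N-1)τ.
    have h := r.random_iterate hp hs hb hε hε1 hr (K := fun _ => N - 1)
      (fun _ => by omega) (fun k _ _ => measurable_const (measurableSet_singleton k)) hlow
      (fun ω => by rw [← hcast]; exact r.le_rho ω (N - 1) (by omega))
    simp only [hNN] at h
    refine ⟨h.2.1, h.2.2.trans (add_le_add ?_ ?_), h.1, fun hNhat => ⟨h.1, h.2.1, ?_⟩⟩
    -- The available bound has neither ξ nor 1 - ξ in its denominators, so 0 < ξ < 1 only weakens it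
    -- to the claimed form.
    · refine mul_le_mul_of_nonneg_right ?_ (Real.rpow_nonneg hε.le _)
      have hs0 := Real.sqrt_pos.2 hlow
      refine div_le_div_of_nonneg_left (by positivity) (by positivity) ?_
      exact mul_le_of_le_one_left hs0.le hs.ξ_lt.le
    · refine div_le_div₀ (Real.sqrt_nonneg _) (Real.le_sqrt_of_sq_le (by linarith))
        (by positivity) ?_
      exact mul_le_of_le_one_left hlow.le (by linarith)
    · refine h.2.2.trans (PenaltySFO.theta_bound_le_sqrt hp hs hb hε hlow ?_)
      have h1 : PenaltySFO.rhoBar p s b ε / s.τ - s.ρ₀ / s.τ + 1 ≤ (N : ℝ) :=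
        (Int.le_ceil _).trans (by exact_mod_cast hNhat)
      have h2 : (PenaltySFO.rhoBar p s b ε - s.ρ₀) / s.τ ≤ (N : ℝ) - 1 := by
        rw [sub_div]; linarith
      rw [div_le_iff₀ hτ] at h2
      linarith
  · refine ⟨PenaltySFO.totalCallConst p s b Λ, fun ε hε hε1 N hN hNhat Ω _ P _ r hr => ?_⟩
    have hspec := r.hit_spec (b := b) hs hN hNhat
    -- The maximum with 1 is still a lower bound for ρ_K and is visibly positive.
    have hlow : 0 < max (PenaltySFO.rhoBar p s b ε) 1 := lt_max_of_lt_right one_pos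
    have h := r.random_iterate hp hs hb hε hε1 hr (K := r.hit (PenaltySFO.rhoBar p s b ε))
      (fun ω => ⟨(hspec ω).1, (hspec ω).2.1⟩)
      (fun k h1 h2 => r.measurableSet_hit hs hN hNhat h1 h2) hlow
      (fun ω => max_le (hspec ω).2.2.2 (r.one_le_rho hs (hspec ω).2.1 ω))
    have hc := PenaltySFO.callConst_nonneg hp hs hb
    have hτ := hs.τ_pos
    have hC1 : 0 ≤ PenaltySFO.Ctilde p s b 1 := PenaltySFO.Ctilde_nonneg
    have hsε : 0 < √ε := Real.sqrt_pos.2 hε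
    refine ⟨fun ω => ⟨(hspec ω).1, (hspec ω).2.1, (hspec ω).2.2.1⟩,
      ⟨h.1, h.2.1, h.2.2.trans
        (PenaltySFO.theta_bound_le_sqrt hp hs hb hε hlow (le_max_left _ _))⟩,
      fun he => ⟨?_, fun hep => ?_⟩⟩
    · filter_upwards [r.ae_sum_calls_before_hit_le hp hs hb hε hε1 hN hNhat hr hΛ he] with ω hω
      rw [PenaltySFO.rpow_neg_seven_half hε]
      refine hω.trans (mul_le_mul_of_nonneg_right ?_ (by positivity))
      unfold PenaltySFO.totalCallConst
      exact mul_le_mul_of_nonneg_left (le_add_of_nonneg_right (sq_nonneg _)) (by positivity)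
    · filter_upwards [r.ae_sum_calls_before_hit_le hp hs hb hε hε1 hN hNhat hr hΛ he,
        r.ae_calls_hit_le hp hs hb hε hε1 hN hNhat hr hΛ he hep] with ω hω hω'
      rw [PenaltySFO.rpow_neg_seven_half hε, Finset.sum_Ico_succ_top (hspec ω).1, Nat.cast_add]
      refine (add_le_add hω hω').trans (le_of_eq ?_)
      unfold PenaltySFO.totalCallConst
      ring
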